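/- **Model.** The input is given in a read-only memory that a program can only query, one query per step. A program has a fixed finite code and a fixed number of registers, each holding a natural number; in one step it loads a constant, adds, subtracts, multiplies, divides (with integer quotient), queries the memory, or compares two registers and jumps. "Using $O(1)$ extra space" means that, besides the fixed number of registers, every register holds at every time a number of $O(\log n)$ bits (formally, at most a constant times the bit length of $n$). A tree $T=(V,E)$ with $n$ vertices has vertex weights $w(v)\ge 0$ and edge lengths $l(e)>0$, which are integers of $O(\log n)$ bits (so that a weight or a length is a word of memory). It is stored with a root and an order of the children of each vertex, and the constant-time queries are: $n$, the root, $Parent(u)$, $FirstChild(u)$, $NextChild(u,v)$, the weight of $u$, and the length of the edge from $u$ to its parent. For an array of $n$ words of $O(\log n)$ bits the queries are $n$ and the $i$-th entry. All points on the edges of $T$ are points of $T$, and $d$ is the distance along $T$. For a finite non-empty set $X$ of points put $S(X,T)=\max_{v\in V} w(v)\min_{\alpha\in X}d(\alpha,v)$. A weighted 2-center of $T$ is a set $X$ of two (distinct) points of $T$ that minimizes $S(X,T)$ among all sets of two points of $T$. **Theorem.** Let $M:\mathbb N\to\mathbb N$ be such that the median (the element of rank $\lceil n/2\rceil$) of any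 $n\ge 1$ words of $O(\log n)$ bits given in a read-only memory can be computed by a program in $O(M(n))$ time using $O(1)$ extra space. Then there is a program that, for every tree $T$ with $n\ge 2$ vertices given in a read-only memory, computes a weighted 2-center of $T$ in $O((n+M(n))\log^2 n)$ time using $O(1)$ extra space. Each of the two points is reported exactly, as an edge $uv$ together with the distance from $u$ on that edge as a quotient of two natural numbers. Here, both in the hypothesis and in the conclusion, there is a single program for all inputs: for every $\kappa$, if the input numbers have at most $\kappa$ times as many bits as $n$, then the running time and the register sizes obey the stated bounds with constants that depend only on $\kappa$ (and on the program). -/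

import Mathlib

/-! ### The constant-work-space model

A program has a fixed number of registers, each holding one word (a natural number), and a
finite code.  The input sits in a read-only memory that can only be queried.  Every instruction
costs one step. -/

namespace ConstantWorkSpace

/-- A read-only memory: each query name `q` answers, in one step, with a word that depends on two
argument words (a query may ignore its arguments). -/
abbrev ReadOnlyMemory (Q : Type) := Q → ℕ → ℕ → ℕ

/-- Instructions of a machine with `k` registers. -/
inductive Instr (Q : Type) (k : ℕ) where
  | const (dst : Fin k) (c : ℕ)
  | add (dst a b : Fin k)
  | sub (dst a b : Fin k)
  | mul (dst a b : Fin k)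
  | div (dst a b : Fin k)
  | query (q : Q) (dst a b : Fin k)
  | jumpIfLt (a b : Fin k) (target : ℕ)

/-- A program with `m` output words. The number `k` of registers is part of the program, so it
does not depend on the input. -/
structure Program (Q : Type) (m : ℕ) where
  k : ℕ
  code : List (Instr Q k)
  out : Fin m → Fin k

structure State (k : ℕ) where
  pc : ℕ
  reg : Fin k → ℕ

namespace State

variable {k : ℕ}

/-- Store a word in a register and go to the next instruction. -/
def store (s : State k) (dst : Fin k) (x : ℕ) : State k :=
  ⟨s.pc + 1, Function.update s.reg dst x⟩

/-- The effect of one instruction. Subtraction is truncated at `0`, division is integer division. -/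
def exec {Q : Type} (mem : ReadOnlyMemory Q) (s : State k) : Instr Q k → State k
  | .const dst c => s.store dst c
  | .add dst a b => s.store dst (s.reg a + s.reg b)
  | .sub dst a b => s.store dst (s.reg a - s.reg b)
  | .mul dst a b => s.store dst (s.reg a * s.reg b)
  | .div dst a b => s.store dst (s.reg a / s.reg b)
  | .query q dst a b => s.store dst (mem q (s.reg a) (s.reg b))
  | .jumpIfLt a b target => ⟨if s.reg a < s.reg b then target else s.pc + 1, s.reg⟩

end State

namespace Program

variable {Q : Type} {m : ℕ}

/-- The machine halts when the program counter leaves the code. -/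
def Halted (P : Program Q m) (s : State P.k) : Prop := P.code.length ≤ s.pc

/-- One step; a halted machine does not move. -/
def step (P : Program Q m) (mem : ReadOnlyMemory Q) (s : State P.k) : State P.k :=
  match P.code[s.pc]? with
  | none => s
  | some i => s.exec mem i

/-- The state after `t` steps, starting at the first instruction with all registers `0`. -/
def run (P : Program Q m) (mem : ReadOnlyMemory Q) (t : ℕ) : State P.k :=
  (P.step mem)^[t] ⟨0, fun _ => 0⟩

/-- The words in the output registers. -/
def output (P : Program Q m) (s : State P.k) : Fin m → ℕ := fun i => s.reg (P.out i)

/-- On the read-only input `mem`, the program halts after at most `time` steps with an output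
satisfying `post`, and no register ever holds a word of more than `bits` bits. -/
def RunsIn (P : Program Q m) (mem : ReadOnlyMemory Q) (time bits : ℕ)
    (post : (Fin m → ℕ) → Prop) : Prop :=
  (∃ t ≤ time, P.Halted (P.run mem t) ∧ post (P.output (P.run mem t))) ∧
    ∀ t i, Nat.size ((P.run mem t).reg i) ≤ bits

end Program

/-! ### Selection of the median -/

inductive ArrayQuery where
  | size
  | entry

/-- An array of `n` words in read-only memory: its size, and random access to its entries. -/
def arrayMemory {n : ℕ} (a : Fin n → ℕ) : ReadOnlyMemory ArrayQuery
  | .size, _, _ => n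
  | .entry, i, _ => if h : i < n then a ⟨i, h⟩ else 0

/-- `x` is the median of the array, i.e. its element of rank `⌈n / 2⌉`. -/
def IsMedian {n : ℕ} (a : Fin n → ℕ) (x : ℕ) : Prop :=
  (Finset.univ.filter fun j => a j < x).card < (n + 1) / 2 ∧
    (n + 1) / 2 ≤ (Finset.univ.filter fun j => a j ≤ x).card

/-- The median of `n` words of `O(log n)` bits given in a read-only memory can be computed in
time `O(M n)` with `O(1)` registers of `O(log n)` bits. -/
def MedianComputableInTime (M : ℕ → ℕ) : Prop :=
  ∃ P : Program ArrayQuery 1, ∀ κ : ℕ, ∃ C : ℕ, ∀ n : ℕ, 1 ≤ n → ∀ a : Fin n → ℕ,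
    (∀ i, Nat.size (a i) ≤ κ * Nat.size n) →
      P.RunsIn (arrayMemory a) (C * M n) (C * Nat.size n) fun o => IsMedian a (o 0)

/-! ### Weighted trees and their weighted centers -/

/-- A tree on `n` vertices with vertex weights and positive edge lengths. -/
structure WeightedTree (n : ℕ) where
  graph : SimpleGraph (Fin n)
  isTree : graph.IsTree
  weight : Fin n → ℕ
  length : Sym2 (Fin n) → ℕ
  length_pos : ∀ e ∈ graph.edgeSet, 0 < length e

namespace WeightedTree

variable {n : ℕ} (T : WeightedTree n)

/-- The distance of two vertices: the least length of a walk between them. -/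
noncomputable def vdist (u v : Fin n) : ℕ :=
  ⨅ p : T.graph.Walk u v, (p.edges.map T.length).sum

/-- A point on an edge `uv`, given by its distance `offset` from `u` along the edge. -/
structure EdgePoint where
  u : Fin n
  v : Fin n
  adj : T.graph.Adj u v
  offset : ℝ
  offset_nonneg : 0 ≤ offset
  offset_le : offset ≤ T.length s(u, v)

variable {T} in
/-- The distance from a point on an edge to a vertex. -/
noncomputable def EdgePoint.dist (x : T.EdgePoint) (z : Fin n) : ℝ :=
  min (x.offset + T.vdist x.u z) ((T.length s(x.u, x.v) - x.offset) + T.vdist x.v z)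

/-- Two descriptions give the same point of the tree iff they give the same distance to every
vertex (a point can be described from both ends of its edge, and a vertex lies on all the edges
that meet there). -/
instance edgePointSetoid : Setoid T.EdgePoint where
  r x y := ∀ z, x.dist z = y.dist z
  iseqv :=
    { refl := fun _ _ => rfl
      symm := fun {x y} (h : ∀ z, x.dist z = y.dist z) z => (h z).symm
      trans := fun {x y w} (h : ∀ z, x.dist z = y.dist z) (k : ∀ z, y.dist z = w.dist z) z =>
        (h z).trans (k z) }

/-- The points of the tree, i.e. all points on its edges. -/
def Point := Quotient T.edgePointSetoid

variable {T} in
/-- The distance from a point of the tree to a vertex. -/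
noncomputable def Point.dist (α : T.Point) (z : Fin n) : ℝ :=
  Quotient.lift (fun x : T.EdgePoint => x.dist z) (fun x y (h : ∀ z, x.dist z = y.dist z) => h z) α

/-- `S(X, T) = max_v w(v) d(X, v)`, where `d(X, v) = min_{α ∈ X} d(α, v)`. -/
noncomputable def cost (X : Finset T.Point) : ℝ :=
  ⨆ v : Fin n, (⨅ α : X, α.1.dist v) * (T.weight v : ℝ)

/-- `X` is a weighted `p`-center: a set of `p` points of the tree of minimum cost. -/
def IsWeightedCenter (p : ℕ) (X : Finset T.Point) : Prop :=
  X.card = p ∧ ∀ Y : Finset T.Point, Y.card = p → T.cost X ≤ T.cost Y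

/-- All weights and lengths are words of at most `κ * Nat.size n` bits. -/
def FitsInWords (κ : ℕ) : Prop :=
  (∀ v, Nat.size (T.weight v) ≤ κ * Nat.size n) ∧
    ∀ e ∈ T.graph.edgeSet, Nat.size (T.length e) ≤ κ * Nat.size n

/-- The data that the representation in memory adds to the tree: a root, which determines the
parent of every vertex, and an arbitrary order of the children of every vertex. -/
structure Layout where
  root : Fin n
  parent : Fin n → Option (Fin n)
  children : Fin n → List (Fin n)
  parent_eq_some : ∀ v u, parent v = some u ↔
    T.graph.Adj u v ∧ T.graph.dist root v = T.graph.dist root u + 1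
  mem_children : ∀ u v, v ∈ children u ↔ parent v = some u
  nodup_children : ∀ u, (children u).Nodup

end WeightedTree

/-! ### Trees in read-only memory -/

/-- Vertices are stored as `1, …, n`; the word `0` stands for "no vertex". -/
def vertexWord {n : ℕ} : Option (Fin n) → ℕ
  | none => 0
  | some v => v + 1

/-- The vertex stored as the word `x`, if any. -/
def wordVertex (n : ℕ) (x : ℕ) : Option (Fin n) :=
  if h : 1 ≤ x ∧ x ≤ n then some ⟨x - 1, by omega⟩ else none

inductive TreeQuery where
  | size
  | root
  | parent
  | firstChild
  | nextChild
  | weight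
  | length

/-- The queries to a tree: the number of vertices, the root, `Parent(u)`, `FirstChild(u)`,
`NextChild(u, v)` (the child of `u` that comes after its child `v`), the weight of `u`, and the
length of the edge from `u` to its parent. -/
def WeightedTree.Layout.memory {n : ℕ} {T : WeightedTree n} (L : T.Layout) :
    ReadOnlyMemory TreeQuery
  | .size, _, _ => n
  | .root, _, _ => vertexWord (some L.root)
  | .parent, x, _ => vertexWord ((wordVertex n x).bind L.parent)
  | .firstChild, x, _ => vertexWord ((wordVertex n x).bind fun u => (L.children u)[0]?)
  | .nextChild, x, y => vertexWord ((wordVertex n x).bind fun u => (wordVertex n y).bind fun v =>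
      (L.children u)[(L.children u).idxOf v + 1]?)
  | .weight, x, _ => ((wordVertex n x).map T.weight).getD 0
  | .length, x, _ => ((wordVertex n x).bind fun u =>
      (L.parent u).map fun p => T.length s(u, p)).getD 0

/-- The words `x, y, a, b` describe the point at distance `a / b` from `u` on the edge `uv`, where
`u` and `v` are the vertices stored as `x` and `y`. -/
def Describes {n : ℕ} (T : WeightedTree n) (x y a b : ℕ) (α : T.Point) : Prop :=
  ∃ e : T.EdgePoint, vertexWord (some e.u) = x ∧ vertexWord (some e.v) = y ∧ 0 < b ∧
    e.offset = (a : ℝ) / b ∧ α = Quotient.mk T.edgePointSetoid e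

/-- The eight output words describe the two points of a weighted 2-center. -/
def ReportsTwoCenter {n : ℕ} (T : WeightedTree n) (o : Fin 8 → ℕ) : Prop :=
  ∃ (X : Finset T.Point) (α β : T.Point), T.IsWeightedCenter 2 X ∧ (X : Set T.Point) = {α, β} ∧
    Describes T (o 0) (o 1) (o 2) (o 3) α ∧ Describes T (o 4) (o 5) (o 6) (o 7) β

end ConstantWorkSpace

/-! For a value `r`, let the ball of a vertex `v` be the set of points within `r / w(v)` of `v`; two
points have cost at most `r` iff every ball contains one of them. Balls are subtrees, so feasibility
is decided greedily. Let `v₁` be the vertex whose ball has the deepest top (the point of the ball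
nearest to the root) and let `A` be that top. Every ball that misses `A` is disjoint from the ball
of `v₁` (`greedy_disjoint`). Among the balls that miss `A`, let `v₂` be again the one with the
deepest top, and `B` that top. If the ball of some `w` misses both points, the balls of `v₁`, `v₂`,
`w` are pairwise disjoint (`TwoPoints.three_apart`). Two balls meet exactly when `r` is at least
`d(u,v) w(u) w(v) / (w(u) + w(v))`. Of three vertices two share a nearest centre, so the least of
the three quotients bounds every cost from below (`le_cost_of_apart`), and it exceeds `r`.

The test has to run in linear time without marking vertices. An Euler tour driven by parent, first
child and next child visits a subtree and keeps track of the depth (`Visits.tour`). Touring the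
subtrees of the successive ancestors of a point, each without the part already seen, yields all
distances from that point (`ClimbVisits.climbTour`). Such a tour knows the distance to one point
only, so the tour from `B` cannot tell what `A` covers. The remedy is to remember the first vertex
`u` that the tour from `A` finds uncovered, and the top `q` of the subtree completed before the
climb that led to `u`. Below `q` everything is covered by `A`; outside, `B` covers all that `A`
covers as soon as `B` covers `u` (`covered_of_covered`). So a tour from `B` that leaves out the
subtree of `q` and prefers `u` as its witness settles the test (`runs_test`).

The optimal value is found by galloping followed by bisection. Let `N` bound `n`, the weights and
the depths. A failed test returns a quotient with denominator at most `2 * N` that is a lower bound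
for all costs, and this quotient is tested next. If it passes, it is the optimal value, attained
exactly by the two points found. If it fails, a larger such quotient appears. Hence, while the
search goes on, two different quotients with denominators at most `2 * N` lie between the current
lower end and the optimum, and the interval of a bisection cannot be shorter than `1 / (4 * N ^ 2)`
(`Bracketed.S_le`). Since `N` is polynomial in `n`, `O(log n)` tests suffice.

The algorithm is written in a structured language whose semantics counts loop iterations and bounds
the stored words. Compilation loses only constant factors in time and in bits
(`Cmd.exists_program`). -/

namespace ConstantWorkSpace

/-! ### A structured language over words, and its compilation -/

/-- Word-valued expressions over registers named by natural numbers. -/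
inductive WExpr (Q : Type) where
  | reg (i : ℕ)
  | lit (c : ℕ)
  | add (a b : WExpr Q)
  | sub (a b : WExpr Q)
  | mul (a b : WExpr Q)
  | query (q : Q) (a b : WExpr Q)

namespace WExpr

variable {Q : Type}

instance : Add (WExpr Q) := ⟨add⟩
instance : Sub (WExpr Q) := ⟨sub⟩
instance : Mul (WExpr Q) := ⟨mul⟩

def eval (mem : ReadOnlyMemory Q) (σ : ℕ → ℕ) : WExpr Q → ℕ
  | reg i => σ i
  | lit c => c
  | add a b => a.eval mem σ + b.eval mem σ
  | sub a b => a.eval mem σ - b.eval mem σ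
  | mul a b => a.eval mem σ * b.eval mem σ
  | query q a b => mem q (a.eval mem σ) (b.eval mem σ)

section simp_lemmas
variable (mem : ReadOnlyMemory Q) (σ : ℕ → ℕ) (a b : WExpr Q)
@[simp] theorem eval_reg (i : ℕ) : (reg i : WExpr Q).eval mem σ = σ i := rfl
@[simp] theorem eval_lit (i : ℕ) : (lit i : WExpr Q).eval mem σ = i := rfl
@[simp] theorem eval_add : (a + b).eval mem σ = a.eval mem σ + b.eval mem σ := rfl
@[simp] theorem eval_sub : (a - b).eval mem σ = a.eval mem σ - b.eval mem σ := rfl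
@[simp] theorem eval_mul : (a * b).eval mem σ = a.eval mem σ * b.eval mem σ := rfl
@[simp] theorem eval_query (q : Q) :
    (query q a b).eval mem σ = mem q (a.eval mem σ) (b.eval mem σ) := rfl
end simp_lemmas

/-- All registers that occur have an index below `K`. -/
def regBound : WExpr Q → ℕ
  | reg i => i + 1
  | lit _ => 0
  | add a b | sub a b | mul a b | query _ a b => max a.regBound b.regBound

def depth : WExpr Q → ℕ
  | reg _ | lit _ => 1
  | add a b | sub a b | mul a b | query _ a b => max a.depth (b.depth + 1)

/-- A size such that the value is at most the `size`-th power of a bound for the registers. -/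
def size : WExpr Q → ℕ
  | reg _ => 1
  | lit c => c + 1
  | add a b | sub a b | mul a b | query _ a b => a.size + b.size

theorem size_pos (e : WExpr Q) : 1 ≤ e.size := by
  induction e <;> simp only [size] <;> omega

/-- The base `W + 2` is at least 2, so a sum is at most the product of the bounds of its terms, and
a literal `c` is below `2 ^ c`. Only stored words are kept below `W`; intermediate values get this
polynomial bound, which costs a constant factor in the number of bits. -/
theorem eval_le {mem : ReadOnlyMemory Q} {σ : ℕ → ℕ} {W : ℕ} (hmem : ∀ q x y, mem q x y ≤ W)
    (hσ : ∀ i, σ i ≤ W) (e : WExpr Q) : e.eval mem σ ≤ (W + 2) ^ e.size := by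
  have one : ∀ a : WExpr Q, W + 2 ≤ (W + 2) ^ a.size := fun a => by
    simpa using Nat.pow_le_pow_right (n := W + 2) (by omega) a.size_pos
  have left : ∀ a b : WExpr Q, (W + 2) ^ a.size ≤ (W + 2) ^ (a.size + b.size) := fun a b =>
    Nat.pow_le_pow_right (by omega) (by omega)
  induction e with
  | reg i => simp only [eval, size, pow_one]; have := hσ i; omega
  | lit c =>
    simp only [eval, size]
    exact (Nat.lt_two_pow_self.le.trans (Nat.pow_le_pow_left (by omega) c)).trans
      (Nat.pow_le_pow_right (by omega) (by omega))
  | add a b ha hb =>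
    simp only [eval, size, pow_add]
    have h1 := one a
    have h2 := one b
    nlinarith
  | mul a b ha hb => simp only [eval, size, pow_add]; exact Nat.mul_le_mul ha hb
  | sub a b ha hb => exact ((Nat.sub_le _ _).trans ha).trans (left a b)
  | query q a b ha hb =>
    exact (((hmem _ _ _).trans (by omega : W ≤ W + 2)).trans (one a)).trans (left a b)

/-- Code that leaves the value in register `t`, using registers from `t` on. -/
def code (k : ℕ) [NeZero k] : WExpr Q → ℕ → List (Instr Q k)
  | reg i, t => [.const (Fin.ofNat k t) 0, .add (Fin.ofNat k t) (Fin.ofNat k t) (Fin.ofNat k i)]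
  | lit c, t => [.const (Fin.ofNat k t) c]
  | add a b, t => a.code k t ++ b.code k (t + 1) ++
      [.add (Fin.ofNat k t) (Fin.ofNat k t) (Fin.ofNat k (t + 1))]
  | sub a b, t => a.code k t ++ b.code k (t + 1) ++
      [.sub (Fin.ofNat k t) (Fin.ofNat k t) (Fin.ofNat k (t + 1))]
  | mul a b, t => a.code k t ++ b.code k (t + 1) ++
      [.mul (Fin.ofNat k t) (Fin.ofNat k t) (Fin.ofNat k (t + 1))]
  | query q a b, t => a.code k t ++ b.code k (t + 1) ++
      [.query q (Fin.ofNat k t) (Fin.ofNat k t) (Fin.ofNat k (t + 1))]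

end WExpr

/-- Structured commands; the conditions are comparisons `a < b`. -/
inductive Cmd (Q : Type) where
  | skip
  | set (d : ℕ) (e : WExpr Q)
  | seq (c c' : Cmd Q)
  | ite (a b : WExpr Q) (c c' : Cmd Q)
  | loop (a b : WExpr Q) (c : Cmd Q)

/-- Big-step semantics. Every stored word is at most `W`; the last index counts the iterations of
all loops. -/
inductive Exec {Q : Type} (mem : ReadOnlyMemory Q) (W : ℕ) :
    Cmd Q → (ℕ → ℕ) → (ℕ → ℕ) → ℕ → Prop
  | skip {σ : ℕ → ℕ} : Exec mem W .skip σ σ 0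
  | set {d : ℕ} {e : WExpr Q} {σ : ℕ → ℕ} : e.eval mem σ ≤ W →
      Exec mem W (.set d e) σ (Function.update σ d (e.eval mem σ)) 0
  | seq {c c' : Cmd Q} {σ σ₁ σ₂ : ℕ → ℕ} {t t' : ℕ} : Exec mem W c σ σ₁ t →
      Exec mem W c' σ₁ σ₂ t' → Exec mem W (.seq c c') σ σ₂ (t + t')
  | ite_true {a b : WExpr Q} {c c' : Cmd Q} {σ σ₁ : ℕ → ℕ} {t : ℕ} :
      a.eval mem σ < b.eval mem σ → Exec mem W c σ σ₁ t → Exec mem W (.ite a b c c') σ σ₁ t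
  | ite_false {a b : WExpr Q} {c c' : Cmd Q} {σ σ₁ : ℕ → ℕ} {t : ℕ} :
      ¬ a.eval mem σ < b.eval mem σ → Exec mem W c' σ σ₁ t → Exec mem W (.ite a b c c') σ σ₁ t
  | loop_true {a b : WExpr Q} {c : Cmd Q} {σ σ₁ σ₂ : ℕ → ℕ} {t t' : ℕ} :
      a.eval mem σ < b.eval mem σ → Exec mem W c σ σ₁ t → Exec mem W (.loop a b c) σ₁ σ₂ t' →
      Exec mem W (.loop a b c) σ σ₂ (t + t' + 1)
  | loop_false {a b : WExpr Q} {c : Cmd Q} {σ : ℕ → ℕ} :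
      ¬ a.eval mem σ < b.eval mem σ → Exec mem W (.loop a b c) σ σ 0

theorem Exec.le {Q : Type} {mem : ReadOnlyMemory Q} {W : ℕ} {c : Cmd Q} {σ σ' : ℕ → ℕ} {t : ℕ}
    (h : Exec mem W c σ σ' t) : (∀ i, σ i ≤ W) → ∀ i, σ' i ≤ W := by
  induction h with
  | skip => exact id
  | set he =>
    intro hσ i
    rw [Function.update_apply]
    split_ifs
    exacts [he, hσ i]
  | seq _ _ h1 h2 => exact fun hσ => h2 (h1 hσ)
  | ite_true _ _ h | ite_false _ _ h => exact h
  | loop_true _ _ _ h1 h2 => exact fun hσ => h2 (h1 hσ)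
  | loop_false _ => exact id

namespace Cmd

variable {Q : Type}

def regBound : Cmd Q → ℕ
  | skip => 0
  | set d e => max (d + 1) e.regBound
  | seq c c' => max c.regBound c'.regBound
  | ite a b c c' => max (max a.regBound b.regBound) (max c.regBound c'.regBound)
  | loop a b c => max (max a.regBound b.regBound) c.regBound

def depth : Cmd Q → ℕ
  | skip => 0
  | set _ e => e.depth
  | seq c c' => max c.depth c'.depth
  | ite a b c c' => max (max a.depth (b.depth + 1)) (max c.depth c'.depth)
  | loop a b c => max (max a.depth (b.depth + 1)) c.depth

def size : Cmd Q → ℕ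
  | skip => 0
  | set _ e => e.size
  | seq c c' => max c.size c'.size
  | ite a b c c' => max (max a.size b.size) (max c.size c'.size)
  | loop a b c => max (max a.size b.size) c.size

/-- The machine can only jump after a comparison, so an unconditional jump compares 0 with 1 in two
scratch registers. -/
def jump (k : ℕ) [NeZero k] (K target : ℕ) : List (Instr Q k) :=
  [.const (Fin.ofNat k K) 0, .const (Fin.ofNat k (K + 1)) 1,
    .jumpIfLt (Fin.ofNat k K) (Fin.ofNat k (K + 1)) target]

def condCode (k : ℕ) [NeZero k] (K : ℕ) (a b : WExpr Q) (target : ℕ) : List (Instr Q k) :=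
  a.code k K ++ b.code k (K + 1) ++ [.jumpIfLt (Fin.ofNat k K) (Fin.ofNat k (K + 1)) target]

/-- The length of the code depends neither on its address nor on the jump targets, so the targets
can be computed before the code is laid out. -/
def len (k : ℕ) [NeZero k] (K : ℕ) : Cmd Q → ℕ
  | skip => 0
  | set _ e => (e.code k K).length + 2
  | seq c c' => c.len k K + c'.len k K
  | ite a b c c' => (condCode k K a b 0).length + (c'.len k K + 3) + c.len k K
  | loop a b c => (condCode k K a b 0).length + 3 + (c.len k K + 3)

/-- Code to be placed at address `pc`; the registers from `K` on are scratch. -/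
def code (k : ℕ) [NeZero k] (K : ℕ) : Cmd Q → ℕ → List (Instr Q k)
  | skip, _ => []
  | set d e, _ => e.code k K ++ [.const (Fin.ofNat k d) 0,
      .add (Fin.ofNat k d) (Fin.ofNat k d) (Fin.ofNat k K)]
  | seq c c', pc => c.code k K pc ++ c'.code k K (pc + c.len k K)
  | ite a b c c', pc =>
      let l := (condCode k K a b 0).length
      condCode k K a b (pc + l + (c'.len k K + 3)) ++ (c'.code k K (pc + l) ++
        jump k K (pc + l + (c'.len k K + 3) + c.len k K)) ++
        c.code k K (pc + l + (c'.len k K + 3))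
  | loop a b c, pc =>
      let l := (condCode k K a b 0).length
      condCode k K a b (pc + l + 3) ++ jump k K (pc + l + 3 + (c.len k K + 3)) ++
        (c.code k K (pc + l + 3) ++ jump k K pc)

theorem length_condCode (k : ℕ) [NeZero k] (K : ℕ) (a b : WExpr Q) (target : ℕ) :
    (condCode k K a b target).length = (condCode k K a b 0).length := by
  simp [condCode]

theorem length_code (k : ℕ) [NeZero k] (K : ℕ) (c : Cmd Q) (pc : ℕ) :
    (c.code k K pc).length = c.len k K := by
  induction c generalizing pc with
  | skip => rfl
  | set d e => simp [code, len]
  | seq c c' h h' => simp [code, len, h, h']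
  | ite a b c c' h h' => simp [code, len, h, h', length_condCode k K a b _, jump]; omega
  | loop a b c h => simp [code, len, h, length_condCode k K a b _, jump]; omega

end Cmd

/-! ### Simulation of structured commands by the machine -/

section simulation

variable {Q : Type} {m : ℕ} (P : Program Q m) (mem : ReadOnlyMemory Q) (B : ℕ)

/-- In `t` steps the machine moves from `s` to `s'`, with all registers at most `B` on the way. -/
def Reach (s : State P.k) (t : ℕ) (s' : State P.k) : Prop :=
  (P.step mem)^[t] s = s' ∧ ∀ j ≤ t, ∀ i, ((P.step mem)^[j] s).reg i ≤ B

variable {P mem B}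

theorem Reach.trans {s s' s'' : State P.k} {t t' : ℕ} (h : Reach P mem B s t s')
    (h' : Reach P mem B s' t' s'') : Reach P mem B s (t + t') s'' := by
  refine ⟨by rw [add_comm, Function.iterate_add_apply, h.1, h'.1], fun j hj => ?_⟩
  rcases le_total j t with hjt | hjt
  · exact h.2 j hjt
  · obtain ⟨i, rfl⟩ := Nat.exists_eq_add_of_le hjt
    rw [add_comm, Function.iterate_add_apply, h.1]
    exact h'.2 i (by omega)

variable (P) in
/-- The list `l` of instructions stands in the code of `P` at address `pc`. -/
def CodeAt (pc : ℕ) (l : List (Instr Q P.k)) : Prop :=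
  ∃ l₁ l₂, P.code = l₁ ++ l ++ l₂ ∧ l₁.length = pc

theorem CodeAt.left {pc : ℕ} {l l' : List (Instr Q P.k)} (h : CodeAt P pc (l ++ l')) :
    CodeAt P pc l := by
  obtain ⟨l₁, l₂, h, h'⟩ := h
  exact ⟨l₁, l' ++ l₂, by simp [h], h'⟩

theorem CodeAt.right {pc : ℕ} {l l' : List (Instr Q P.k)} (h : CodeAt P pc (l ++ l')) :
    CodeAt P (pc + l.length) l' := by
  obtain ⟨l₁, l₂, h, h'⟩ := h
  exact ⟨l₁ ++ l, l₂, by simp [h], by simp [h']⟩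

theorem CodeAt.tail {pc : ℕ} {i : Instr Q P.k} {l : List (Instr Q P.k)}
    (h : CodeAt P pc (i :: l)) : CodeAt P (pc + 1) l :=
  CodeAt.right (l := [i]) h

theorem CodeAt.reach {pc : ℕ} {i : Instr Q P.k} {l : List (Instr Q P.k)}
    (h : CodeAt P pc (i :: l)) {reg : Fin P.k → ℕ} (hreg : ∀ j, reg j ≤ B) {s' : State P.k}
    (hs' : State.exec mem ⟨pc, reg⟩ i = s') (hB : ∀ j, s'.reg j ≤ B) :
    Reach P mem B ⟨pc, reg⟩ 1 s' := by
  have hstep : P.step mem ⟨pc, reg⟩ = s' := by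
    obtain ⟨l₁, l₂, h, rfl⟩ := h
    simp [Program.step, h, hs']
  refine ⟨by simpa using hstep, fun j hj => ?_⟩
  interval_cases j
  · simpa using hreg
  · simpa [hstep] using hB

theorem update_le {ι : Type*} [DecidableEq ι] {f : ι → ℕ} {B x : ℕ} {i : ι} (hf : ∀ j, f j ≤ B)
    (hx : x ≤ B) (j : ι) : Function.update f i x j ≤ B := by
  rw [Function.update_apply]
  split_ifs
  exacts [hx, hf j]

theorem CodeAt.store {pc : ℕ} {i : Instr Q P.k} {l : List (Instr Q P.k)}
    (h : CodeAt P pc (i :: l)) {reg : Fin P.k → ℕ} (hreg : ∀ j, reg j ≤ B) {d : Fin P.k} {x : ℕ}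
    (hx : x ≤ B) (hi : State.exec mem ⟨pc, reg⟩ i = State.store ⟨pc, reg⟩ d x) :
    Reach P mem B ⟨pc, reg⟩ 1 ⟨pc + 1, Function.update reg d x⟩ :=
  h.reach hreg hi (update_le hreg hx)

theorem ofNat_eq_iff {k : ℕ} [NeZero k] {i j : ℕ} (hi : i < k) (hj : j < k) :
    Fin.ofNat k i = Fin.ofNat k j ↔ i = j := by
  simp [Fin.ext_iff, Nat.mod_eq_of_lt hi, Nat.mod_eq_of_lt hj]

variable [NeZero P.k]

variable (P) in
/-- The machine registers below `K` hold the words of `σ`. -/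
def Agree (K : ℕ) (σ : ℕ → ℕ) (reg : Fin P.k → ℕ) : Prop :=
  ∀ i < K, reg (Fin.ofNat P.k i) = σ i

variable (P mem B) in
/-- The compiled expression leaves its value in the register that it is given, and changes no
register below. -/
def WExpr.Simulated (K : ℕ) (σ : ℕ → ℕ) (e : WExpr Q) : Prop :=
  ∀ (t pc : ℕ) (reg : Fin P.k → ℕ), e.regBound ≤ K → K ≤ t → t + e.depth ≤ P.k →
    CodeAt P pc (e.code P.k t) → (∀ i, reg i ≤ B) → Agree P K σ reg →
    ∃ reg', Reach P mem B ⟨pc, reg⟩ (e.code P.k t).length ⟨pc + (e.code P.k t).length, reg'⟩ ∧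
      reg' (Fin.ofNat P.k t) = e.eval mem σ ∧
      (∀ j < t, reg' (Fin.ofNat P.k j) = reg (Fin.ofNat P.k j)) ∧ ∀ i, reg' i ≤ B

/-- The scratch registers form a stack: the first operand stays in `t` while the second is computed
into `t + 1`, because code for an expression changes nothing below its target. One argument serves
all four binary constructors. -/
theorem WExpr.Simulated.binop {K : ℕ} {σ : ℕ → ℕ} {a b e : WExpr Q} (f : ℕ → ℕ → ℕ)
    (I : Fin P.k → Fin P.k → Instr Q P.k)
    (hI : ∀ s d d', State.exec mem s (I d d') = s.store d (f (s.reg d) (s.reg d')))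
    (hf : e.eval mem σ ≤ B) (hev : e.eval mem σ = f (a.eval mem σ) (b.eval mem σ))
    (hK : e.regBound = max a.regBound b.regBound) (hd : e.depth = max a.depth (b.depth + 1))
    (hc : ∀ t, e.code P.k t = a.code P.k t ++ b.code P.k (t + 1) ++
        [I (Fin.ofNat P.k t) (Fin.ofNat P.k (t + 1))])
    (iha : a.Simulated P mem B K σ) (ihb : b.Simulated P mem B K σ) :
    e.Simulated P mem B K σ := by
  intro t pc reg hKe hKt htk hcode hreg hag
  rw [hc] at hcode ⊢
  rw [hd] at htk
  rw [hK] at hKe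
  rw [hev] at hf ⊢
  have hbd : 1 ≤ b.depth := by cases b <;> simp [WExpr.depth]
  obtain ⟨r1, h1, h1t, h1f, h1B⟩ := iha t pc reg (by omega) hKt (by omega) hcode.left.left hreg hag
  obtain ⟨r2, h2, h2t, h2f, h2B⟩ := ihb (t + 1) _ r1 (by omega) (by omega) (by omega)
    hcode.left.right h1B (fun i hi => by rw [h1f i (by omega), hag i hi])
  have h3 := CodeAt.store (mem := mem) (B := B) hcode.right h2B (d := Fin.ofNat P.k t)
    (x := f (a.eval mem σ) (b.eval mem σ)) hf
    (by rw [hI]; simp only [h2t, h2f t (by omega), h1t])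
  rw [List.length_append, ← add_assoc] at h3
  refine ⟨Function.update r2 (Fin.ofNat P.k t) (f (a.eval mem σ) (b.eval mem σ)), ?_, ?_, ?_,
    update_le h2B hf⟩
  · simpa [add_assoc] using (h1.trans h2).trans h3
  · rw [Function.update_self]
  · intro j hj
    rw [Function.update_of_ne, h2f j (by omega), h1f j hj]
    rw [Ne, ofNat_eq_iff (by omega) (by omega)]
    omega

theorem WExpr.simulated {W K : ℕ} (hmem : ∀ q x y, mem q x y ≤ W) {σ : ℕ → ℕ}
    (hσ : ∀ i, σ i ≤ W) (e : WExpr Q) (hB : (W + 2) ^ e.size ≤ B) :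
    e.Simulated P mem B K σ := by
  have hpow : ∀ {x y : ℕ}, (W + 2) ^ (x + y) ≤ B → (W + 2) ^ x ≤ B ∧ (W + 2) ^ y ≤ B :=
    fun h => ⟨(Nat.pow_le_pow_right (by omega) (by omega)).trans h,
      (Nat.pow_le_pow_right (by omega) (by omega)).trans h⟩
  have hv := (WExpr.eval_le hmem hσ e).trans hB
  induction e with
  | reg i =>
    intro t pc reg hK hKt htk hcode hreg hag
    simp only [WExpr.code, WExpr.regBound, WExpr.depth, WExpr.eval_reg] at *
    have hne : Fin.ofNat P.k i ≠ Fin.ofNat P.k t := by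
      rw [Ne, ofNat_eq_iff (by omega) (by omega)]; omega
    have h1 := CodeAt.store (mem := mem) hcode hreg (d := Fin.ofNat P.k t) (x := 0) (by omega) rfl
    have h2 := CodeAt.store (mem := mem) hcode.tail
      (update_le hreg (Nat.zero_le _) (i := Fin.ofNat P.k t))
      (d := Fin.ofNat P.k t) (x := σ i) hv (by
        simp only [State.exec]
        rw [Function.update_of_ne hne, Function.update_self, hag i (by omega), zero_add])
    refine ⟨_, h1.trans h2, by rw [Function.update_self], ?_,
      update_le (update_le hreg (Nat.zero_le _)) hv⟩
    intro j hj
    have hne : Fin.ofNat P.k j ≠ Fin.ofNat P.k t := by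
      rw [Ne, ofNat_eq_iff (by omega) (by omega)]; omega
    rw [Function.update_of_ne hne, Function.update_of_ne hne]
  | lit c =>
    intro t pc reg hK hKt htk hcode hreg hag
    simp only [WExpr.code, WExpr.depth, WExpr.eval_lit] at *
    refine ⟨_, CodeAt.store hcode hreg hv rfl, by rw [Function.update_self], ?_, update_le hreg hv⟩
    intro j hj
    rw [Function.update_of_ne]
    rw [Ne, ofNat_eq_iff (by omega) (by omega)]; omega
  | add a b iha ihb =>
    obtain ⟨ha, hb⟩ := hpow hB
    exact .binop (· + ·) (fun d d' => .add d d d') (fun _ _ _ => rfl) hv rfl rfl rfl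
      (fun _ => rfl) (iha ha ((WExpr.eval_le hmem hσ _).trans ha))
      (ihb hb ((WExpr.eval_le hmem hσ _).trans hb))
  | sub a b iha ihb =>
    obtain ⟨ha, hb⟩ := hpow hB
    exact .binop (· - ·) (fun d d' => .sub d d d') (fun _ _ _ => rfl) hv rfl rfl rfl
      (fun _ => rfl) (iha ha ((WExpr.eval_le hmem hσ _).trans ha))
      (ihb hb ((WExpr.eval_le hmem hσ _).trans hb))
  | mul a b iha ihb =>
    obtain ⟨ha, hb⟩ := hpow hB
    exact .binop (· * ·) (fun d d' => .mul d d d') (fun _ _ _ => rfl) hv rfl rfl rfl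
      (fun _ => rfl) (iha ha ((WExpr.eval_le hmem hσ _).trans ha))
      (ihb hb ((WExpr.eval_le hmem hσ _).trans hb))
  | query q a b iha ihb =>
    obtain ⟨ha, hb⟩ := hpow hB
    exact .binop (mem q) (fun d d' => .query q d d d') (fun _ _ _ => rfl) hv rfl rfl rfl
      (fun _ => rfl) (iha ha ((WExpr.eval_le hmem hσ _).trans ha))
      (ihb hb ((WExpr.eval_le hmem hσ _).trans hb))

/-- Evaluating the two sides of a comparison and branching on it. -/
theorem Cmd.condCode_reach {W K : ℕ} (hmem : ∀ q x y, mem q x y ≤ W) {σ : ℕ → ℕ}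
    (hσ : ∀ i, σ i ≤ W) (a b : WExpr Q) (ha : (W + 2) ^ a.size ≤ B) (hb : (W + 2) ^ b.size ≤ B)
    {pc target : ℕ} {reg : Fin P.k → ℕ} (hK : max a.regBound b.regBound ≤ K)
    (hk : K + max a.depth (b.depth + 1) ≤ P.k)
    (hcode : CodeAt P pc (condCode P.k K a b target)) (hreg : ∀ i, reg i ≤ B)
    (hag : Agree P K σ reg) :
    ∃ reg', Reach P mem B ⟨pc, reg⟩ (condCode P.k K a b 0).length
      ⟨if a.eval mem σ < b.eval mem σ then target else pc + (condCode P.k K a b 0).length, reg'⟩ ∧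
      Agree P K σ reg' ∧ ∀ i, reg' i ≤ B := by
  unfold condCode at hcode
  have hbd : 1 ≤ b.depth := by cases b <;> simp [WExpr.depth]
  obtain ⟨r1, h1, h1t, h1f, h1B⟩ := a.simulated hmem hσ ha K pc reg (by omega) le_rfl (by omega)
    hcode.left.left hreg hag
  have hag1 : Agree P K σ r1 := fun i hi => by rw [h1f i (by omega), hag i hi]
  obtain ⟨r2, h2, h2t, h2f, h2B⟩ := b.simulated hmem hσ hb (K + 1) _ r1 (by omega) (by omega)
    (by omega) hcode.left.right h1B hag1
  have h3 := CodeAt.reach (mem := mem) (B := B) hcode.right h2B rfl h2B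
  simp only [State.exec] at h3
  rw [h2t, h2f K (by omega), h1t, List.length_append, ← add_assoc] at h3
  refine ⟨r2, ?_, fun i hi => by rw [h2f i (by omega), hag1 i hi], h2B⟩
  simpa [condCode, add_assoc] using (h1.trans h2).trans h3

theorem Cmd.jump_reach {K : ℕ} {σ : ℕ → ℕ} {pc target : ℕ} {reg : Fin P.k → ℕ} (hB : 1 ≤ B)
    (hk : K + 1 < P.k) (hcode : CodeAt P pc (jump P.k K target)) (hreg : ∀ i, reg i ≤ B)
    (hag : Agree P K σ reg) :
    ∃ reg', Reach P mem B ⟨pc, reg⟩ 3 ⟨target, reg'⟩ ∧ Agree P K σ reg' ∧ ∀ i, reg' i ≤ B := by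
  unfold jump at hcode
  have h1 := CodeAt.store (mem := mem) hcode hreg (d := Fin.ofNat P.k K) (x := 0) (by omega) rfl
  have hB1 := update_le hreg (Nat.zero_le B) (i := Fin.ofNat P.k K)
  have h2 := CodeAt.store (mem := mem) hcode.tail hB1 (d := Fin.ofNat P.k (K + 1)) (x := 1) hB rfl
  have hB2 := update_le hB1 hB (i := Fin.ofNat P.k (K + 1))
  have h3 := CodeAt.reach (mem := mem) hcode.tail.tail hB2 rfl hB2
  have hne : Fin.ofNat P.k K ≠ Fin.ofNat P.k (K + 1) := by
    rw [Ne, ofNat_eq_iff (by omega) (by omega)]; omega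
  simp only [State.exec, Function.update_self, Function.update_of_ne hne, Nat.lt_one_iff,
    if_true] at h3
  refine ⟨_, (h1.trans h2).trans h3, fun i hi => ?_, hB2⟩
  rw [Function.update_of_ne, Function.update_of_ne, hag i hi] <;>
  · rw [Ne, ofNat_eq_iff (by omega) (by omega)]; omega

/-- Apart from repetitions by loops, each instruction is passed at most once, and each counted
iteration pays for one more pass through the code. This gives the factor `t + 1`. -/
theorem Exec.reach {W K : ℕ} (hmem : ∀ q x y, mem q x y ≤ W) (hB : 1 ≤ B) {c : Cmd Q}
    {σ σ' : ℕ → ℕ} {t : ℕ} (h : Exec mem W c σ σ' t) :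
    ∀ {pc : ℕ} {reg : Fin P.k → ℕ}, (∀ i, σ i ≤ W) → (W + 2) ^ c.size ≤ B → c.regBound ≤ K →
    K + c.depth + 1 < P.k → CodeAt P pc (c.code P.k K pc) → (∀ i, reg i ≤ B) → Agree P K σ reg →
    ∃ s reg', s ≤ c.len P.k K * (t + 1) ∧ Reach P mem B ⟨pc, reg⟩ s ⟨pc + c.len P.k K, reg'⟩ ∧
      Agree P K σ' reg' ∧ ∀ i, reg' i ≤ B := by
  have hpow : ∀ {x y : ℕ}, (W + 2) ^ (max x y) ≤ B → (W + 2) ^ x ≤ B ∧ (W + 2) ^ y ≤ B :=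
    fun h => ⟨(Nat.pow_le_pow_right (by omega) (by omega)).trans h,
      (Nat.pow_le_pow_right (by omega) (by omega)).trans h⟩
  induction h with
  | skip =>
    intro pc reg hσ hBe hK hk hcode hreg hag
    exact ⟨0, reg, by simp, ⟨by simp [Cmd.len], fun j hj => by
      obtain rfl := Nat.le_zero.1 hj; exact hreg⟩, hag, hreg⟩
  | @set d e σ he =>
    intro pc reg hσ hBe hK hk hcode hreg hag
    simp only [Cmd.code, Cmd.size, Cmd.regBound, Cmd.depth, Cmd.len] at *
    obtain ⟨r1, h1, h1t, h1f, h1B⟩ := e.simulated hmem hσ hBe K pc reg (by omega) le_rfl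
      (by omega) hcode.left hreg hag
    have hv := (WExpr.eval_le hmem hσ e).trans hBe
    have hne : Fin.ofNat P.k K ≠ Fin.ofNat P.k d := by
      rw [Ne, ofNat_eq_iff (by omega) (by omega)]; omega
    have h2 := CodeAt.store (mem := mem) hcode.right h1B (d := Fin.ofNat P.k d) (x := 0)
      (by omega) rfl
    have hB2 := update_le h1B (Nat.zero_le B) (i := Fin.ofNat P.k d)
    have h3 := CodeAt.store (mem := mem) hcode.right.tail hB2 (d := Fin.ofNat P.k d)
      (x := e.eval mem σ) hv (by
        simp only [State.exec, Function.update_self, Function.update_of_ne hne, h1t, zero_add])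
    refine ⟨_, _, ?_, (h1.trans h2).trans h3, fun i hi => ?_, update_le hB2 hv⟩
    · omega
    · by_cases hid : i = d
      · subst hid; simp only [Function.update_self]
      · have hne : Fin.ofNat P.k i ≠ Fin.ofNat P.k d := by
          rwa [Ne, ofNat_eq_iff (by omega) (by omega)]
        rw [Function.update_of_ne hne, Function.update_of_ne hne, Function.update_of_ne hid,
          h1f i (by omega), hag i hi]
  | @seq c c' σ σ₁ σ₂ t t' hc hc' ih ih' =>
    intro pc reg hσ hBe hK hk hcode hreg hag
    simp only [Cmd.code, Cmd.size, Cmd.regBound, Cmd.depth, Cmd.len] at *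
    obtain ⟨hB1, hB2⟩ := hpow hBe
    obtain ⟨s1, r1, hs1, h1, hag1, h1B⟩ := ih hσ hB1 (by omega) (by omega) hcode.left hreg hag
    have hr := hcode.right
    rw [Cmd.length_code] at hr
    obtain ⟨s2, r2, hs2, h2, hag2, h2B⟩ := ih' (hc.le hσ) hB2 (by omega) (by omega) hr h1B hag1
    exact ⟨s1 + s2, r2, by nlinarith, by simpa [add_assoc] using h1.trans h2, hag2, h2B⟩
  | @ite_true a b c c' σ σ₁ t hab hc ih =>
    intro pc reg hσ hBe hK hk hcode hreg hag
    simp only [Cmd.code, Cmd.size, Cmd.regBound, Cmd.depth, Cmd.len] at *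
    obtain ⟨⟨ha, hb⟩, hB1, hB2⟩ := And.imp hpow hpow (hpow hBe)
    obtain ⟨r1, h1, hag1, h1B⟩ := Cmd.condCode_reach hmem hσ a b ha hb (by omega) (by omega)
      hcode.left.left hreg hag
    have hr := hcode.right
    simp only [List.length_append, Cmd.length_condCode P.k K a b (_ + _), Cmd.length_code,
      show ∀ x, (Cmd.jump (Q := Q) P.k K x).length = 3 from fun _ => rfl, ← add_assoc] at hr
    rw [if_pos hab] at h1
    simp only [← add_assoc] at h1
    obtain ⟨s2, r2, hs2, h2, hag2, h2B⟩ := ih hσ hB1 (by omega) (by omega) hr h1B hag1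
    refine ⟨_, r2, ?_, by simpa [add_assoc] using h1.trans h2, hag2, h2B⟩
    nlinarith
  | @ite_false a b c c' σ σ₁ t hab hc ih =>
    intro pc reg hσ hBe hK hk hcode hreg hag
    simp only [Cmd.code, Cmd.size, Cmd.regBound, Cmd.depth, Cmd.len] at *
    obtain ⟨⟨ha, hb⟩, hB1, hB2⟩ := And.imp hpow hpow (hpow hBe)
    obtain ⟨r1, h1, hag1, h1B⟩ := Cmd.condCode_reach hmem hσ a b ha hb (by omega) (by omega)
      hcode.left.left hreg hag
    have hr := hcode.left.right
    rw [Cmd.length_condCode] at hr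
    rw [if_neg hab] at h1
    obtain ⟨s2, r2, hs2, h2, hag2, h2B⟩ := ih hσ hB2 (by omega) (by omega) hr.left h1B hag1
    have hj := hr.right
    rw [Cmd.length_code] at hj
    obtain ⟨r3, h3, hag3, h3B⟩ := Cmd.jump_reach (mem := mem) hB (by omega) hj h2B hag2
    refine ⟨_, r3, ?_, by simpa [add_assoc] using (h1.trans h2).trans h3, hag3, h3B⟩
    nlinarith
  | @loop_false a b c σ hab =>
    intro pc reg hσ hBe hK hk hcode hreg hag
    simp only [Cmd.code, Cmd.size, Cmd.regBound, Cmd.depth, Cmd.len] at *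
    obtain ⟨⟨ha, hb⟩, hB1⟩ := And.imp_left hpow (hpow hBe)
    obtain ⟨r1, h1, hag1, h1B⟩ := Cmd.condCode_reach hmem hσ a b ha hb (by omega) (by omega)
      hcode.left.left hreg hag
    have hj := hcode.left.right
    rw [Cmd.length_condCode] at hj
    rw [if_neg hab] at h1
    obtain ⟨r3, h3, hag3, h3B⟩ := Cmd.jump_reach (mem := mem) hB (by omega) hj h1B hag1
    refine ⟨_, r3, ?_, by simpa [add_assoc] using h1.trans h3, hag3, h3B⟩
    omega
  | @loop_true a b c σ σ₁ σ₂ t t' hab hc hc' ih ih' =>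
    intro pc reg hσ hBe hK hk hcode hreg hag
    have hcode' := hcode
    have hBe' := hBe
    simp only [Cmd.code] at hcode
    simp only [Cmd.size, Cmd.regBound, Cmd.depth] at hBe hK hk
    obtain ⟨⟨ha, hb⟩, hB1⟩ := And.imp_left hpow (hpow hBe)
    obtain ⟨r1, h1, hag1, h1B⟩ := Cmd.condCode_reach hmem hσ a b ha hb (by omega) (by omega)
      hcode.left.left hreg hag
    have hr := hcode.right
    simp only [List.length_append, Cmd.length_condCode P.k K a b (_ + _),
      show ∀ x, (Cmd.jump (Q := Q) P.k K x).length = 3 from fun _ => rfl, ← add_assoc] at hr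
    rw [if_pos hab] at h1
    obtain ⟨s2, r2, hs2, h2, hag2, h2B⟩ := ih hσ hB1 (by omega) (by omega) hr.left h1B hag1
    have hj := hr.right
    rw [Cmd.length_code] at hj
    obtain ⟨r3, h3, hag3, h3B⟩ := Cmd.jump_reach (mem := mem) hB (by omega) hj h2B hag2
    -- The jump has led back to `pc`, where the code of the whole loop stands, so the induction
    -- hypothesis for the remaining iterations applies.
    obtain ⟨s4, r4, hs4, h4, hag4, h4B⟩ := ih' (hc.le hσ) hBe' (by simpa [Cmd.regBound] using hK)
      (by simpa [Cmd.depth] using hk) hcode' h3B hag3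
    refine ⟨_, r4, ?_, ((h1.trans h2).trans h3).trans h4, hag4, h4B⟩
    simp only [Cmd.len] at hs4 ⊢
    nlinarith

end simulation

/-- Every structured command is computed by a program. -/
theorem Cmd.exists_program {Q : Type} {m : ℕ} (c : Cmd Q) (outs : Fin m → ℕ) :
    ∃ (P : Program Q m) (E : ℕ), ∀ (mem : ReadOnlyMemory Q) (W t : ℕ) (post : (Fin m → ℕ) → Prop),
      (∀ q x y, mem q x y ≤ W) →
      (∃ σ t', t' ≤ t ∧ Exec mem W c (fun _ => 0) σ t' ∧ post fun i => σ (outs i)) →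
      P.RunsIn mem (E * (t + 1)) (E * Nat.size (W + 2)) post := by
  -- `K` lies above every register that the command or the output names, so scratch work destroys
  -- nothing; the two registers added to the depth leave room for comparisons and jumps.
  let K := c.regBound + Finset.univ.sup outs + 1
  let k := K + c.depth + 2
  have hk : NeZero k := ⟨by omega⟩
  let P : Program Q m := ⟨k, c.code k K 0, fun i => Fin.ofNat k (outs i)⟩
  have hPk : NeZero P.k := hk
  refine ⟨P, c.len k K + c.size + 1, fun mem W t post hmem ⟨σ, t', htt, hex, hpost⟩ => ?_⟩
  have hcode : CodeAt P 0 (c.code P.k K 0) := ⟨[], [], by simp [P], rfl⟩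
  obtain ⟨s, reg, hs, hreach, hag, -⟩ := hex.reach (P := P) (B := (W + 2) ^ (c.size + 1)) (K := K)
    (reg := fun _ => 0) hmem (Nat.one_le_pow _ _ (by omega)) (fun _ => Nat.zero_le _)
    (Nat.pow_le_pow_right (by omega) (by omega)) (by omega) (by simp only [P, k]; omega) hcode
    (fun _ => Nat.zero_le _) (fun _ _ => rfl)
  have hrun : P.run mem s = ⟨0 + c.len P.k K, reg⟩ := hreach.1
  have hhalt : P.Halted (P.run mem s) := by
    rw [hrun]; simp [Program.Halted, P, Cmd.length_code]
  refine ⟨⟨s, hs.trans ?_, hhalt, ?_⟩, fun j i => ?_⟩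
  · exact Nat.mul_le_mul (by simp only [P]; omega) (by omega)
  · rw [hrun]
    convert hpost using 2 with i
    refine hag _ ?_
    have := Finset.le_sup (f := outs) (Finset.mem_univ i)
    omega
  · have hle : (P.run mem j).reg i ≤ (W + 2) ^ (c.size + 1) := by
      rcases le_total j s with h | h
      · exact hreach.2 j h i
      -- A halted machine does not move, so the bound persists at all later times.
      · have : P.run mem j = P.run mem s := by
          induction j, h using Nat.le_induction with
          | base => rfl
          | succ j _ ih =>
            have hstep : P.run mem (j + 1) = P.step mem (P.run mem j) :=
              Function.iterate_succ_apply' _ _ _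
            rw [hstep, ih]
            unfold Program.step
            rw [List.getElem?_eq_none hhalt]
        rw [this]
        exact hreach.2 s le_rfl i
    refine Nat.size_le.2 (hle.trans_lt ((Nat.pow_lt_pow_left (Nat.lt_size_self _)
      (by omega)).trans_le ?_))
    rw [← pow_mul]
    exact Nat.pow_le_pow_right (by omega) (by rw [mul_comm]; exact Nat.mul_le_mul (by omega) le_rfl)

/-! ### Reasoning about structured commands -/

infixr:67 " ;; " => Cmd.seq

section hoare

variable {Q : Type} {mem : ReadOnlyMemory Q} {W : ℕ}

variable (mem W) in
/-- From `σ` the command terminates after at most `t` loop iterations in a state satisfying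
`post`. -/
def Runs (c : Cmd Q) (σ : ℕ → ℕ) (t : ℕ) (post : (ℕ → ℕ) → Prop) : Prop :=
  ∃ σ' t', t' ≤ t ∧ Exec mem W c σ σ' t' ∧ post σ'

theorem Runs.mono {c : Cmd Q} {σ : ℕ → ℕ} {t t' : ℕ} {post post' : (ℕ → ℕ) → Prop}
    (h : Runs mem W c σ t post) (ht : t ≤ t') (hp : ∀ σ', post σ' → post' σ') :
    Runs mem W c σ t' post' := by
  obtain ⟨σ', s, hs, he, h⟩ := h
  exact ⟨σ', s, hs.trans ht, he, hp _ h⟩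

theorem Runs.seq {c c' : Cmd Q} {σ : ℕ → ℕ} {t t' : ℕ} {post post' : (ℕ → ℕ) → Prop}
    (h : Runs mem W c σ t post) (h' : ∀ σ', post σ' → Runs mem W c' σ' t' post') :
    Runs mem W (c ;; c') σ (t + t') post' := by
  obtain ⟨σ₁, s, hs, he, h⟩ := h
  obtain ⟨σ₂, s', hs', he', h'⟩ := h' σ₁ h
  exact ⟨σ₂, s + s', by omega, he.seq he', h'⟩

theorem Runs.ite {a b : WExpr Q} {c c' : Cmd Q} {σ : ℕ → ℕ} {t : ℕ} {post : (ℕ → ℕ) → Prop}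
    (h : a.eval mem σ < b.eval mem σ → Runs mem W c σ t post)
    (h' : ¬ a.eval mem σ < b.eval mem σ → Runs mem W c' σ t post) :
    Runs mem W (.ite a b c c') σ t post := by
  by_cases hab : a.eval mem σ < b.eval mem σ
  · obtain ⟨σ₁, s, hs, he, h⟩ := h hab
    exact ⟨σ₁, s, hs, .ite_true hab he, h⟩
  · obtain ⟨σ₁, s, hs, he, h⟩ := h' hab
    exact ⟨σ₁, s, hs, .ite_false hab he, h⟩

/-- The registers that a command may change. -/
def Cmd.Writes : Cmd Q → ℕ → Prop
  | .skip, _ => False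
  | .set d _, i => i = d
  | .seq c c', i => c.Writes i ∨ c'.Writes i
  | .ite _ _ c c', i => c.Writes i ∨ c'.Writes i
  | .loop _ _ c, i => c.Writes i

theorem Exec.frame {c : Cmd Q} {σ σ' : ℕ → ℕ} {t : ℕ} (h : Exec mem W c σ σ' t) {i : ℕ} :
    ¬ c.Writes i → σ' i = σ i := by
  induction h with
  | skip => exact fun _ => rfl
  | set _ => exact fun hi => Function.update_of_ne hi _ _
  | seq _ _ h h' => exact fun hi => (h' fun h => hi (.inr h)).trans (h fun h => hi (.inl h))
  | ite_true _ _ h => exact fun hi => h fun h => hi (.inl h)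
  | ite_false _ _ h => exact fun hi => h fun h => hi (.inr h)
  | loop_true _ _ _ h h' => exact fun hi => (h' hi).trans (h hi)
  | loop_false _ => exact fun _ => rfl

theorem Runs.frame {c : Cmd Q} {σ : ℕ → ℕ} {t : ℕ} {post : (ℕ → ℕ) → Prop}
    (h : Runs mem W c σ t post) :
    Runs mem W c σ t fun σ' => post σ' ∧ ∀ i, ¬ c.Writes i → σ' i = σ i := by
  obtain ⟨σ', s, hs, he, h⟩ := h
  exact ⟨σ', s, hs, he, h, fun i => he.frame⟩

variable (mem W) in
/-- Weakest preconditions of loop-free commands. -/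
def Cmd.wp : Cmd Q → ((ℕ → ℕ) → Prop) → (ℕ → ℕ) → Prop
  | .skip, post, σ => post σ
  | .set d e, post, σ => e.eval mem σ ≤ W ∧ post (Function.update σ d (e.eval mem σ))
  | .seq c c', post, σ => c.wp (c'.wp post) σ
  | .ite a b c c', post, σ => (a.eval mem σ < b.eval mem σ → c.wp post σ) ∧
      (¬ a.eval mem σ < b.eval mem σ → c'.wp post σ)
  | .loop _ _ _, _, _ => False

theorem Runs.of_wp {c : Cmd Q} {σ : ℕ → ℕ} {post : (ℕ → ℕ) → Prop} (h : c.wp mem W post σ) :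
    Runs mem W c σ 0 post := by
  induction c generalizing σ post with
  | skip => exact ⟨σ, 0, le_rfl, .skip, h⟩
  | set d e => exact ⟨_, 0, le_rfl, .set h.1, h.2⟩
  | seq c c' ih ih' => exact (ih h).seq fun σ' h' => ih' h'
  | ite a b c c' ih ih' => exact Runs.ite (fun hab => ih (h.1 hab)) fun hab => ih' (h.2 hab)
  | loop a b c => exact h.elim

/-- Branching on the equality of two words. -/
def Cmd.ifEq (a b : WExpr Q) (c c' : Cmd Q) : Cmd Q := .ite ((a - b) + (b - a)) (.lit 1) c c'

theorem Cmd.wp_ifEq {a b : WExpr Q} {c c' : Cmd Q} {post : (ℕ → ℕ) → Prop} {σ : ℕ → ℕ} :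
    (Cmd.ifEq a b c c').wp mem W post σ ↔ (a.eval mem σ = b.eval mem σ → c.wp mem W post σ) ∧
      (a.eval mem σ ≠ b.eval mem σ → c'.wp mem W post σ) := by
  have : (a.eval mem σ - b.eval mem σ) + (b.eval mem σ - a.eval mem σ) < 1 ↔
      a.eval mem σ = b.eval mem σ := by omega
  simp only [Cmd.ifEq, Cmd.wp, WExpr.eval_add, WExpr.eval_sub, WExpr.eval_lit, this, ne_eq]

theorem Cmd.writes_ifEq {a b : WExpr Q} {c c' : Cmd Q} {i : ℕ} :
    (Cmd.ifEq a b c c').Writes i ↔ c.Writes i ∨ c'.Writes i := Iff.rfl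

/-- Some iterations of a loop, not necessarily all. -/
inductive Iter (mem : ReadOnlyMemory Q) (W : ℕ) (a b : WExpr Q) (c : Cmd Q) :
    (ℕ → ℕ) → (ℕ → ℕ) → ℕ → Prop
  | refl {σ : ℕ → ℕ} : Iter mem W a b c σ σ 0
  | step {σ σ₁ σ₂ : ℕ → ℕ} {t t' : ℕ} : a.eval mem σ < b.eval mem σ → Exec mem W c σ σ₁ t →
      Iter mem W a b c σ₁ σ₂ t' → Iter mem W a b c σ σ₂ (t + t' + 1)

variable (mem W) in
/-- From `σ`, some iterations of the loop, of total cost at most `t`, lead to a state satisfying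
`post`. -/
def Iterates (a b : WExpr Q) (c : Cmd Q) (σ : ℕ → ℕ) (t : ℕ) (post : (ℕ → ℕ) → Prop) : Prop :=
  ∃ σ' t', t' ≤ t ∧ Iter mem W a b c σ σ' t' ∧ post σ'

section
variable {a b : WExpr Q} {c : Cmd Q} {σ : ℕ → ℕ} {t t' : ℕ} {post post' : (ℕ → ℕ) → Prop}

theorem Iterates.refl (h : post σ) : Iterates mem W a b c σ 0 post := ⟨σ, 0, le_rfl, .refl, h⟩

theorem Iterates.mono (h : Iterates mem W a b c σ t post) (ht : t ≤ t')
    (hp : ∀ σ', post σ' → post' σ') : Iterates mem W a b c σ t' post' := by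
  obtain ⟨σ', s, hs, he, h⟩ := h
  exact ⟨σ', s, hs.trans ht, he, hp _ h⟩

theorem Iter.trans {σ₁ σ₂ : ℕ → ℕ} (h : Iter mem W a b c σ σ₁ t) :
    Iter mem W a b c σ₁ σ₂ t' → Iter mem W a b c σ σ₂ (t + t') := by
  induction h with
  | refl => intro h; simpa using h
  | @step σ σ₁ σ₂ s s' hab hc _ ih =>
    intro h
    have := Iter.step hab hc (ih h)
    rwa [show s + s' + 1 + t' = s + (s' + t') + 1 by omega]

/-- A tour is a single flat loop, whereas its correctness is proved by recursion over subtrees.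
Stretches of iterations that can be concatenated reconcile the two. -/
theorem Iterates.trans (h : Iterates mem W a b c σ t post)
    (h' : ∀ σ', post σ' → Iterates mem W a b c σ' t' post') :
    Iterates mem W a b c σ (t + t') post' := by
  obtain ⟨σ₁, s, hs, he, h⟩ := h
  obtain ⟨σ₂, s', hs', he', h'⟩ := h' σ₁ h
  exact ⟨σ₂, s + s', by omega, he.trans he', h'⟩

theorem Iterates.of_runs (hab : a.eval mem σ < b.eval mem σ) (h : Runs mem W c σ t post) :
    Iterates mem W a b c σ (t + 1) post := by
  obtain ⟨σ₁, s, hs, he, h⟩ := h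
  exact ⟨σ₁, s + 0 + 1, by omega, .step hab he .refl, h⟩

theorem Iter.exec {σ₁ : ℕ → ℕ} (h : Iter mem W a b c σ σ₁ t) :
    ¬ a.eval mem σ₁ < b.eval mem σ₁ → Exec mem W (.loop a b c) σ σ₁ t := by
  induction h with
  | refl => exact fun h => .loop_false h
  | step hab hc _ ih => exact fun h => .loop_true hab hc (ih h)

theorem Iterates.runs (h : Iterates mem W a b c σ t post)
    (hp : ∀ σ', post σ' → ¬ a.eval mem σ' < b.eval mem σ') :
    Runs mem W (.loop a b c) σ t post := by
  obtain ⟨σ', s, hs, he, h⟩ := h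
  exact ⟨σ', s, hs, he.exec (hp _ h), h⟩

/-- A loop with an invariant `I k`, where `k` bounds the cost of the remaining iterations. -/
theorem Runs.loop {I : ℕ → (ℕ → ℕ) → Prop}
    (h : ∀ k σ, I k σ → a.eval mem σ < b.eval mem σ →
      ∃ τ k', τ + 1 + k' ≤ k ∧ Runs mem W c σ τ (I k')) {k : ℕ} (hI : I k σ) :
    Runs mem W (.loop a b c) σ k
      fun σ' => (∃ k', I k' σ') ∧ ¬ a.eval mem σ' < b.eval mem σ' := by
  induction k using Nat.strong_induction_on generalizing σ with
  | _ k ih =>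
    by_cases hab : a.eval mem σ < b.eval mem σ
    · obtain ⟨τ, k', hk, σ₁, s, hs, he, h1⟩ := h k σ hI hab
      obtain ⟨σ₂, s', hs', he', h2⟩ := ih k' (by omega) h1
      exact ⟨σ₂, s + s' + 1, by omega, .loop_true hab he he', h2⟩
    · exact ⟨σ, 0, Nat.zero_le _, .loop_false hab, ⟨k, hI⟩, hab⟩

end

end hoare

namespace WeightedTree

variable {n : ℕ} (T : WeightedTree n)

/-! ### The vertex metric -/

theorem vdist_le_walk {u v : Fin n} (p : T.graph.Walk u v) :
    T.vdist u v ≤ (p.edges.map T.length).sum :=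
  ciInf_le (OrderBot.bddBelow _) p

theorem exists_walk_vdist (u v : Fin n) :
    ∃ p : T.graph.Walk u v, (p.edges.map T.length).sum = T.vdist u v := by
  have : Nonempty (T.graph.Walk u v) := T.isTree.connected u v
  exact Nat.sInf_mem (Set.range_nonempty _)

@[simp] theorem vdist_self (u : Fin n) : T.vdist u u = 0 := by
  simpa using T.vdist_le_walk (SimpleGraph.Walk.nil : T.graph.Walk u u)

theorem vdist_comm (u v : Fin n) : T.vdist u v = T.vdist v u := by
  have : ∀ u v, T.vdist u v ≤ T.vdist v u := fun u v => by
    obtain ⟨p, hp⟩ := T.exists_walk_vdist v u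
    simpa [hp] using T.vdist_le_walk p.reverse
  exact (this u v).antisymm (this v u)

theorem vdist_triangle (u v w : Fin n) : T.vdist u w ≤ T.vdist u v + T.vdist v w := by
  obtain ⟨p, hp⟩ := T.exists_walk_vdist u v
  obtain ⟨q, hq⟩ := T.exists_walk_vdist v w
  simpa [hp, hq] using T.vdist_le_walk (p.append q)

theorem vdist_le_length {u v : Fin n} (h : T.graph.Adj u v) : T.vdist u v ≤ T.length s(u, v) := by
  simpa using T.vdist_le_walk h.toWalk

namespace Layout

variable {T} (L : T.Layout)

/-! ### Ancestors and descendants -/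

/-- `v` is a descendant of `u`, or `u` itself. -/
def Desc (v u : Fin n) : Prop := Relation.ReflTransGen (fun v p => L.parent v = some p) v u

/-- The distance from the root. -/
noncomputable def depth (v : Fin n) : ℕ := T.vdist L.root v

/-- The length of the edge to the parent. -/
def len (v : Fin n) : ℕ := ((L.parent v).map fun p => T.length s(v, p)).getD 0

/-- Unlike `depth`, this ignores the edge lengths: it is the measure for inductions along the tree
and counts climbing steps. -/
noncomputable def hop (v : Fin n) : ℕ := T.graph.dist L.root v

variable {L}

theorem adj_of_parent {v p : Fin n} (h : L.parent v = some p) : T.graph.Adj p v :=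
  ((L.parent_eq_some v p).1 h).1

theorem hop_parent {v p : Fin n} (h : L.parent v = some p) : L.hop v = L.hop p + 1 :=
  ((L.parent_eq_some v p).1 h).2

theorem len_of_parent {v p : Fin n} (h : L.parent v = some p) : L.len v = T.length s(v, p) := by
  simp [len, h]

theorem len_pos {v p : Fin n} (h : L.parent v = some p) : 0 < L.len v := by
  rw [len_of_parent h]
  exact T.length_pos _ (adj_of_parent h).symm

theorem parent_or_of_adj {u v : Fin n} (h : T.graph.Adj u v) :
    L.parent v = some u ∨ L.parent u = some v := by
  rcases T.isTree.dist_eq_dist_add_one_of_adj L.root h with h' | h'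
  · exact .inr ((L.parent_eq_some u v).2 ⟨h.symm, h'⟩)
  · exact .inl ((L.parent_eq_some v u).2 ⟨h, h'⟩)

theorem parent_root : L.parent L.root = none := by
  by_contra h
  obtain ⟨p, hp⟩ := Option.ne_none_iff_exists'.1 h
  have := hop_parent hp
  simp [hop] at this

theorem exists_parent {v : Fin n} (h : v ≠ L.root) : ∃ p, L.parent v = some p := by
  obtain ⟨p, hp⟩ := (T.isTree.connected v L.root).exists_walk_length_eq_dist
  cases p with
  | nil => exact absurd rfl h
  | cons hadj p =>
    rename_i u
    rcases parent_or_of_adj (L := L) hadj with h' | h'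
    · have h1 := hop_parent h'
      have h2 := SimpleGraph.dist_le p
      simp only [hop, T.graph.dist_comm (u := L.root)] at h1
      simp only [SimpleGraph.Walk.length_cons] at hp
      omega
    · exact ⟨u, h'⟩

theorem desc_root (v : Fin n) : L.Desc v L.root := by
  induction hk : L.hop v generalizing v with
  | zero =>
    by_cases h : v = L.root
    · rw [h]; exact .refl
    · obtain ⟨p, hp⟩ := exists_parent h
      have := hop_parent hp
      omega
  | succ k ih =>
    by_cases h : v = L.root
    · rw [h]; exact .refl
    · obtain ⟨p, hp⟩ := exists_parent h
      have := hop_parent hp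
      exact .head hp (ih p (by omega))

theorem Desc.rfl {v : Fin n} : L.Desc v v := .refl

theorem Desc.trans {u v w : Fin n} (h : L.Desc u v) (h' : L.Desc v w) : L.Desc u w :=
  Relation.ReflTransGen.trans h h'

theorem Desc.of_parent {v p : Fin n} (h : L.parent v = some p) : L.Desc v p := .single h

theorem Desc.eq_or_parent {v u : Fin n} (h : L.Desc v u) :
    v = u ∨ ∃ p, L.parent v = some p ∧ L.Desc p u := by
  rcases Relation.ReflTransGen.cases_head h with h | ⟨p, hp, h⟩
  · exact .inl h
  · exact .inr ⟨p, hp, h⟩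

theorem Desc.parent {v u p : Fin n} (h : L.Desc v u) (hp : L.parent v = some p) (hne : v ≠ u) :
    L.Desc p u := by
  rcases h.eq_or_parent with h | ⟨p', hp', h⟩
  · exact absurd h hne
  · rw [hp] at hp'
    cases hp'
    exact h

theorem Desc.eq_or_child {v u : Fin n} (h : L.Desc v u) :
    v = u ∨ ∃ c, L.parent c = some u ∧ L.Desc v c := by
  rcases Relation.ReflTransGen.cases_tail h with h | ⟨c, h, hc⟩
  · exact .inl h.symm
  · exact .inr ⟨c, hc, h⟩

theorem Desc.hop_le {v u : Fin n} (h : L.Desc v u) : L.hop u ≤ L.hop v := by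
  induction h with
  | refl => exact le_rfl
  | tail _ hp ih => have := hop_parent hp; omega

theorem Desc.antisymm {v u : Fin n} (h : L.Desc v u) (h' : L.hop v ≤ L.hop u) : v = u := by
  rcases h.eq_or_parent with h | ⟨p, hp, h⟩
  · exact h
  · have := hop_parent hp
    have := h.hop_le
    omega

theorem Desc.total {v a b : Fin n} (h : L.Desc v a) (h' : L.Desc v b) : L.Desc a b ∨ L.Desc b a :=
  Relation.ReflTransGen.total_of_right_unique
    (fun _ _ _ h h' => Option.some_injective _ (h.symm.trans h')) h h'

theorem not_desc_parent {v p : Fin n} (h : L.parent v = some p) : ¬ L.Desc p v := fun h' => by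
  have := h'.hop_le
  have := hop_parent h
  omega

theorem eq_of_siblings {u c c' v : Fin n} (hc : L.parent c = some u) (hc' : L.parent c' = some u)
    (h : L.Desc v c) (h' : L.Desc v c') : c = c' := by
  rcases h.total h' with h | h
  · exact h.antisymm (by rw [hop_parent hc, hop_parent hc'])
  · exact (h.antisymm (by rw [hop_parent hc, hop_parent hc'])).symm

/-! ### Distances along the tree -/

/-- Distances are infima over all walks, not only paths, so the walk is followed edge by edge. The
only edge into the subtree of `x` ends at `x`, hence the step that enters the subtree leads to `x`
itself, and the triangle inequality handles the steps before it. -/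
theorem walk_into {x z u : Fin n} (p : T.graph.Walk z u) (hz : ¬ L.Desc z x) (hu : L.Desc u x) :
    T.vdist z x + T.vdist x u ≤ (p.edges.map T.length).sum := by
  induction p with
  | nil => exact absurd hu hz
  | @cons z z' u hadj p ih =>
    simp only [SimpleGraph.Walk.edges_cons, List.map_cons, List.sum_cons]
    by_cases hz' : L.Desc z' x
    · have hx : z' = x := by
        rcases parent_or_of_adj (L := L) hadj with h | h
        · by_contra hne
          exact hz (hz'.parent h hne)
        · exact absurd ((Desc.of_parent h).trans hz') hz
      subst hx
      have h1 := T.vdist_le_length hadj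
      have h2 := T.vdist_le_walk p
      omega
    · have h1 := T.vdist_le_length hadj
      have h2 := T.vdist_triangle z z' x
      have h3 := ih hz' hu
      omega

/-- The path from outside a subtree to a vertex inside it passes through its top. -/
theorem vdist_into {x z u : Fin n} (hz : ¬ L.Desc z x ∨ z = x) (hu : L.Desc u x) :
    T.vdist z u = T.vdist z x + T.vdist x u := by
  rcases hz with hz | rfl
  · refine (T.vdist_triangle z x u).antisymm ?_
    obtain ⟨p, hp⟩ := T.exists_walk_vdist z u
    rw [← hp]
    exact walk_into p hz hu
  · simp

/-- The same induction, stopping one vertex earlier: the edge that enters the subtree starts at the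
parent `q`. -/
theorem walk_top {x q z : Fin n} (hq : L.parent x = some q) (p : T.graph.Walk z x)
    (hz : ¬ L.Desc z x) : T.vdist z q + L.len x ≤ (p.edges.map T.length).sum := by
  induction p with
  | nil => exact absurd .rfl hz
  | @cons z z' u hadj p ih =>
    simp only [SimpleGraph.Walk.edges_cons, List.map_cons, List.sum_cons]
    by_cases hz' : L.Desc z' u
    · rcases parent_or_of_adj (L := L) hadj with h | h
      · by_cases hne : z' = u
        · subst hne
          rw [h] at hq
          cases hq
          rw [len_of_parent h, Sym2.eq_swap]
          simp
        · exact absurd (hz'.parent h hne) hz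
      · exact absurd ((Desc.of_parent h).trans hz') hz
    · have h1 := T.vdist_le_length hadj
      have h2 := T.vdist_triangle z z' q
      have h3 := ih hq hz'
      omega

/-- The path from outside a subtree to its top passes through the parent of the top. -/
theorem vdist_top {x q z : Fin n} (hq : L.parent x = some q) (hz : ¬ L.Desc z x) :
    T.vdist z x = T.vdist z q + L.len x := by
  refine le_antisymm ?_ ?_
  · have h1 := T.vdist_le_length (adj_of_parent hq).symm
    rw [← len_of_parent hq, T.vdist_comm] at h1
    have h2 := T.vdist_triangle z q x
    omega
  · obtain ⟨p, hp⟩ := T.exists_walk_vdist z x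
    rw [← hp]
    exact walk_top hq p hz

theorem vdist_parent_of_desc {a p v : Fin n} (hp : L.parent a = some p) (hv : L.Desc v a) :
    T.vdist p v = L.len a + T.vdist a v := by
  rw [vdist_into (.inl (not_desc_parent hp)) hv, vdist_top hp (not_desc_parent hp)]
  simp

theorem vdist_of_not_desc {a p v : Fin n} (hp : L.parent a = some p) (hv : ¬ L.Desc v a) :
    T.vdist a v = L.len a + T.vdist p v := by
  rw [T.vdist_comm a, vdist_top hp hv, T.vdist_comm p, add_comm]

@[simp] theorem depth_root : L.depth L.root = 0 := by simp [depth]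

theorem depth_of_desc {v a : Fin n} (h : L.Desc v a) : L.depth v = L.depth a + T.vdist a v := by
  refine vdist_into ?_ h
  by_cases ha : L.Desc L.root a
  · exact .inr (ha.antisymm (by simp [hop]))
  · exact .inl ha

theorem vdist_parent {v p : Fin n} (h : L.parent v = some p) : T.vdist p v = L.len v := by
  simpa using vdist_parent_of_desc h .rfl

theorem depth_parent {v p : Fin n} (h : L.parent v = some p) :
    L.depth v = L.depth p + L.len v := by
  rw [depth_of_desc (Desc.of_parent h), vdist_parent h]

theorem len_root : L.len L.root = 0 := by simp [len, parent_root]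

theorem len_le_depth (v : Fin n) : L.len v ≤ L.depth v := by
  by_cases h : v = L.root
  · simp [h, len_root]
  · obtain ⟨p, hp⟩ := exists_parent h
    have := depth_parent hp
    omega

theorem hop_lt (v : Fin n) : L.hop v < n := by
  obtain ⟨p, hp, hl⟩ := (T.isTree.connected L.root v).exists_path_of_dist
  simpa [hop, hl] using hp.length_lt

theorem depth_le {Z : ℕ} (hZ : ∀ v, L.len v ≤ Z) (v : Fin n) : L.depth v ≤ L.hop v * Z := by
  induction hk : L.hop v generalizing v with
  | zero =>
    by_cases h : v = L.root
    · simp [h]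
    · obtain ⟨p, hp⟩ := exists_parent h
      have := hop_parent hp
      omega
  | succ k ih =>
    by_cases h : v = L.root
    · simp [h]
    · obtain ⟨p, hp⟩ := exists_parent h
      have h1 := hop_parent hp
      have h2 := ih p (by omega)
      have h3 := depth_parent hp
      have h4 := hZ v
      rw [h3]
      linarith

end Layout

end WeightedTree

open WeightedTree WeightedTree.Layout

/-! ### Queries -/

section queries

variable {n : ℕ} {T : WeightedTree n} (L : T.Layout)

/-- The word that stands for a vertex. -/
def word (v : Fin n) : ℕ := v + 1

theorem vertexWord_some (v : Fin n) : vertexWord (some v) = word v := rfl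
@[simp] theorem vertexWord_none : vertexWord (none : Option (Fin n)) = 0 := rfl
theorem word_pos (v : Fin n) : 0 < word v := Nat.succ_pos _
@[simp] theorem word_ne_zero (v : Fin n) : word v ≠ 0 := Nat.succ_ne_zero _
theorem word_le (v : Fin n) : word v ≤ n := v.2
@[simp] theorem word_inj {u v : Fin n} : word u = word v ↔ u = v := by
  simp [word, Fin.ext_iff]

theorem vertexWord_le (o : Option (Fin n)) : vertexWord o ≤ n := by
  cases o with
  | none => exact Nat.zero_le _
  | some v => exact word_le v

theorem vertexWord_eq_word {o : Option (Fin n)} {v : Fin n} :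
    vertexWord o = word v ↔ o = some v := by
  cases o with
  | none => simp [(word_ne_zero v).symm]
  | some u => simp [vertexWord_some]

@[simp] theorem wordVertex_word (v : Fin n) : wordVertex n (word v) = some v := by
  have : word v ≤ n := word_le v
  simp [wordVertex, word]

@[simp] theorem memory_root (x y : ℕ) : L.memory .root x y = word L.root := rfl
@[simp] theorem memory_parent (v : Fin n) (y : ℕ) :
    L.memory .parent (word v) y = vertexWord (L.parent v) := by simp [Layout.memory]
@[simp] theorem memory_firstChild (v : Fin n) (y : ℕ) :
    L.memory .firstChild (word v) y = vertexWord (L.children v)[0]? := by simp [Layout.memory]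
@[simp] theorem memory_nextChild (u v : Fin n) : L.memory .nextChild (word u) (word v) =
    vertexWord (L.children u)[(L.children u).idxOf v + 1]? := by simp [Layout.memory]
@[simp] theorem memory_weight (v : Fin n) (y : ℕ) :
    L.memory .weight (word v) y = T.weight v := by simp [Layout.memory]
@[simp] theorem memory_length (v : Fin n) (y : ℕ) :
    L.memory .length (word v) y = L.len v := by simp [Layout.memory, len]

namespace WExpr

abbrev parent (e : WExpr TreeQuery) : WExpr TreeQuery := .query .parent e (.lit 0)
abbrev firstChild (e : WExpr TreeQuery) : WExpr TreeQuery := .query .firstChild e (.lit 0)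
abbrev nextChild (e e' : WExpr TreeQuery) : WExpr TreeQuery := .query .nextChild e e'
abbrev weight (e : WExpr TreeQuery) : WExpr TreeQuery := .query .weight e (.lit 0)
abbrev len (e : WExpr TreeQuery) : WExpr TreeQuery := .query .length e (.lit 0)
abbrev root : WExpr TreeQuery := .query .root (.lit 0) (.lit 0)

end WExpr

end queries

/-! ### The Euler tour of a subtree -/

/-- Current vertex of a tour. -/
@[simp] abbrev rV : ℕ := 0
/-- The child to be entered next, if any. -/
@[simp] abbrev rC : ℕ := 1
/-- Depth of the current vertex. -/
@[simp] abbrev rDep : ℕ := 2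
/-- Whether the tour goes on. -/
@[simp] abbrev rM : ℕ := 3
/-- Top of the subtree that is toured. -/
@[simp] abbrev rX : ℕ := 4
/-- Tops of two subtrees that are left out. -/
@[simp] abbrev rY : ℕ := 5
@[simp] abbrev rQ : ℕ := 8

/-- One step along the Euler tour of the subtree of `rX`; `visit` is run once at each vertex. -/
def tourStep (visit : Cmd TreeQuery) : Cmd TreeQuery :=
  .ite (.reg rC) (.lit 1)
    (.ifEq (.reg rV) (.reg rX) (.set rM (.lit 0))
      (.set rC (.nextChild (.parent (.reg rV)) (.reg rV)) ;;
        .set rDep (.reg rDep - .len (.reg rV)) ;; .set rV (.parent (.reg rV))))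
    (.ifEq (.reg rC) (.reg rY) (.set rC (.nextChild (.reg rV) (.reg rC)))
      (.ifEq (.reg rC) (.reg rQ) (.set rC (.nextChild (.reg rV) (.reg rC)))
        ((.set rV (.reg rC) ;; .set rDep (.reg rDep + .len (.reg rV))) ;;
          visit ;; .set rC (.firstChild (.reg rV)))))

/-- The tour of the subtree of `rX` without the subtrees of `rY` and `rQ`, where `rDep` is the
depth of the parent of `rX` at the start. -/
def tour (visit : Cmd TreeQuery) : Cmd TreeQuery :=
  (.set rC (.reg rX) ;; .set rM (.lit 1)) ;; .loop (.lit 0) (.reg rM) (tourStep visit)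

/-! ### Correctness and cost of the Euler tour -/

section tour

variable {n : ℕ} {T : WeightedTree n} (L : T.Layout) (y q : Option (Fin n))

/-- `v` lies in one of the subtrees that are left out. -/
def Barred (v : Fin n) : Prop := (∃ u ∈ y, L.Desc v u) ∨ ∃ u ∈ q, L.Desc v u

variable {L y q} in
theorem Barred.of_desc {u v : Fin n} (h : Barred L y q u) (hv : L.Desc v u) : Barred L y q v :=
  h.imp (fun ⟨a, ha, h⟩ => ⟨a, ha, hv.trans h⟩) fun ⟨a, ha, h⟩ => ⟨a, ha, hv.trans h⟩

-- From a vertex that is not left out, a left-out subtree can be entered only at its top. So the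
-- tour only has to compare the next child with the two registers that hold these tops.
variable {L y q} in
theorem Barred.eq_of_parent {c u : Fin n} (h : Barred L y q c) (hc : L.parent c = some u)
    (hu : ¬ Barred L y q u) : y = some c ∨ q = some c := by
  rcases h with ⟨a, ha, h⟩ | ⟨a, ha, h⟩
  · by_cases hne : c = a
    · subst hne; exact .inl ha
    · exact absurd (.inl ⟨a, ha, h.parent hc hne⟩) hu
  · by_cases hne : c = a
    · subst hne; exact .inr ha
    · exact absurd (.inr ⟨a, ha, h.parent hc hne⟩) hu

/-- The registers that describe a tour. -/
structure TourRegs (x : Fin n) (σ : ℕ → ℕ) : Prop where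
  x_eq : σ rX = word x
  y_eq : σ rY = vertexWord y
  q_eq : σ rQ = vertexWord q
  on : σ rM = 1

open Classical in
/-- The vertices of the subtrees of the vertices of `l` that are not left out. -/
noncomputable def unbarred (l : List (Fin n)) : Finset (Fin n) :=
  Finset.univ.filter fun v => (∃ c ∈ l, L.Desc v c) ∧ ¬ Barred L y q v

variable {L y q}

theorem mem_unbarred {l : List (Fin n)} {v : Fin n} :
    v ∈ unbarred L y q l ↔ (∃ c ∈ l, L.Desc v c) ∧ ¬ Barred L y q v := by simp [unbarred]

/-- How many of the vertices are tops of subtrees that are left out. -/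
def barCount (y q : Option (Fin n)) (l : List (Fin n)) : ℕ :=
  y.elim 0 (l.count ·) + q.elim 0 (l.count ·)

/-- This bounds the number of skipping steps at one vertex, which is half of the budget of four
steps per visited vertex. -/
theorem barCount_le {l : List (Fin n)} (h : l.Nodup) : barCount y q l ≤ 2 := by
  have : ∀ o : Option (Fin n), o.elim 0 (l.count ·) ≤ 1 := fun o => by
    cases o with
    | none => simp
    | some a => exact List.nodup_iff_count_le_one.1 h a
  have h1 := this y
  have h2 := this q
  unfold barCount
  omega

theorem barCount_cons (c : Fin n) (l : List (Fin n)) :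
    barCount y q l ≤ barCount y q (c :: l) ∧
      (y = some c ∨ q = some c → barCount y q l + 1 ≤ barCount y q (c :: l)) := by
  have h1 : ∀ o : Option (Fin n), o.elim 0 (l.count ·) ≤ o.elim 0 ((c :: l).count ·) := fun o => by
    cases o with
    | none => simp
    | some a => simp only [Option.elim_some, List.count_cons]; omega
  have h2 : ∀ o : Option (Fin n), o = some c →
      o.elim 0 (l.count ·) + 1 = o.elim 0 ((c :: l).count ·) := by
    rintro _ rfl
    simp
  have h3 := h1 y
  have h4 := h1 q
  unfold barCount
  refine ⟨by omega, ?_⟩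
  rintro (h | h)
  · have := h2 y h; omega
  · have := h2 q h; omega

variable {W : ℕ} {visit : Cmd TreeQuery} {x : Fin n} {I : Finset (Fin n) → (ℕ → ℕ) → Prop}

/-- What a tour needs to know about the command that is run at each vertex. -/
structure Visits (L : T.Layout) (W : ℕ) (visit : Cmd TreeQuery) (x : Fin n) (y q : Option (Fin n))
    (I : Finset (Fin n) → (ℕ → ℕ) → Prop) : Prop where
  le_n : n ≤ W
  depth_le : ∀ v, L.depth v ≤ W
  frame : ∀ i < 10, ¬ visit.Writes i
  congr : ∀ S σ σ', (∀ i, 4 ≤ i → σ' i = σ i) → I S σ → I S σ'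
  runs : ∀ u S σ, L.Desc u x → ¬ Barred L y q u → σ rV = word u → σ rDep = L.depth u →
    TourRegs y q x σ → I S σ → Runs L.memory W visit σ 0 (I (insert u S))

theorem TourRegs.congr {σ σ' : ℕ → ℕ} (h : TourRegs y q x σ)
    (hσ : ∀ i, 3 ≤ i → i < 10 → σ' i = σ i) : TourRegs y q x σ' :=
  ⟨(hσ _ (by simp) (by simp)).trans h.1, (hσ _ (by simp) (by simp)).trans h.2,
    (hσ _ (by simp) (by simp)).trans h.3, (hσ _ (by simp) (by simp)).trans h.4⟩

theorem card_le_union (S U : Finset (Fin n)) : S.card ≤ (S ∪ U).card :=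
  Finset.card_le_card Finset.subset_union_left

variable (L y q W visit x I) in
/-- A stage of a tour: the vertices of `S` have been visited, the tour is at `v` and goes on with
the vertex stored as `c`. -/
def TourAt (S : Finset (Fin n)) (c : ℕ) (v : Fin n) (σ : ℕ → ℕ) : Prop :=
  TourRegs y q x σ ∧ I S σ ∧ σ rC = c ∧ σ rV = word v ∧ σ rDep = L.depth v

variable (L y q W visit x I) in
/-- The tour of the subtree of `c` works. -/
def ToursSubtree (c : Fin n) : Prop :=
  ∀ (S : Finset (Fin n)) (σ : ℕ → ℕ), ¬ Barred L y q c → Disjoint S (unbarred L y q [c]) →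
    TourRegs y q x σ → I S σ → σ rC = word c → σ rDep + L.len c = L.depth c →
    Iterates L.memory W (.lit 0) (.reg rM) (tourStep visit) σ
      (4 * (S ∪ unbarred L y q [c]).card - 4 * S.card - 1)
      (TourAt L y q x I (S ∪ unbarred L y q [c]) 0 c)

theorem getElem?_idxOf_add_one {α : Type*} [DecidableEq α] {pre l : List α} {c : α}
    (h : (pre ++ c :: l).Nodup) :
    (pre ++ c :: l)[(pre ++ c :: l).idxOf c + 1]? = l[0]? := by
  have hcp : c ∉ pre := fun h' => (List.nodup_append.1 h).2.2 c h' c (by simp) rfl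
  rw [List.idxOf_append_of_notMem hcp]
  simp [List.getElem?_append_right]

theorem Visits.skip (hv : Visits L W visit x y q I) {u c : Fin n} {pre l : List (Fin n)}
    (hu : ¬ Barred L y q u) (hbar : Barred L y q c) (hl : L.children u = pre ++ c :: l)
    {S : Finset (Fin n)} {σ : ℕ → ℕ} (h : TourAt L y q x I S (word c) u σ) :
    Iterates L.memory W (.lit 0) (.reg rM) (tourStep visit) σ 1
      (TourAt L y q x I S (vertexWord l[0]?) u) := by
  obtain ⟨hT, hI, hC, hV, hD⟩ := h
  have hc : L.parent c = some u := (L.mem_children u c).1 (by simp [hl])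
  have hyc := hbar.eq_of_parent hc hu
  have hnext : L.memory .nextChild (σ rV) (σ rC) = vertexWord l[0]? := by
    have hnd := L.nodup_children u
    rw [hl] at hnd
    rw [hV, hC, memory_nextChild, hl, getElem?_idxOf_add_one hnd]
  have hw : vertexWord l[0]? ≤ W := (vertexWord_le _).trans hv.le_n
  have hfin : TourAt L y q x I S (vertexWord l[0]?) u
      (Function.update σ rC (vertexWord l[0]?)) := by
    refine ⟨hT.congr fun i h1 _ => ?_, hv.congr S σ _ (fun i h1 => ?_) hI, ?_, ?_, ?_⟩
    · rw [Function.update_of_ne]; simp only [rC]; omega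
    · rw [Function.update_of_ne]; simp only [rC]; omega
    · simp
    · simpa using hV
    · simpa using hD
  have hset : (Cmd.set rC (.nextChild (.reg rV) (.reg rC))).wp L.memory W
      (TourAt L y q x I S (vertexWord l[0]?) u) σ := by
    simp only [Cmd.wp, WExpr.eval_query, WExpr.eval_reg, hnext]
    exact ⟨hw, hfin⟩
  refine .of_runs (by simp only [WExpr.eval_lit, WExpr.eval_reg, hT.on]; omega)
    (.ite (fun h => ?_) fun _ => .of_wp ?_)
  · simp only [WExpr.eval_lit, WExpr.eval_reg, hC] at h
    exact absurd (word_pos c) (by omega)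
  · rw [Cmd.wp_ifEq, Cmd.wp_ifEq]
    refine ⟨fun _ => hset, fun h1 => ⟨fun _ => hset, fun h2 => ?_⟩⟩
    simp only [WExpr.eval_reg, hC, hT.y_eq, hT.q_eq] at h1 h2
    rcases hyc with h | h
    · exact absurd (by rw [h, vertexWord_some]) h1
    · exact absurd (by rw [h, vertexWord_some]) h2

theorem Visits.ascend (hv : Visits L W visit x y q I) {u c : Fin n} {pre l : List (Fin n)}
    (hux : L.Desc u x) (hl : L.children u = pre ++ c :: l)
    {S : Finset (Fin n)} {σ : ℕ → ℕ} (h : TourAt L y q x I S 0 c σ) :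
    Iterates L.memory W (.lit 0) (.reg rM) (tourStep visit) σ 1
      (TourAt L y q x I S (vertexWord l[0]?) u) := by
  obtain ⟨hT, hI, hC, hV, hD⟩ := h
  have hc : L.parent c = some u := (L.mem_children u c).1 (by simp [hl])
  have hnd := L.nodup_children u
  rw [hl] at hnd
  have hw : ∀ o : Option (Fin n), vertexWord o ≤ W := fun o => (vertexWord_le o).trans hv.le_n
  have hcx : c ≠ x := by
    rintro rfl
    exact not_desc_parent hc hux
  have hdep := depth_parent hc
  have hdu := hv.depth_le u
  have hD' : σ 2 = L.depth c := hD
  have hV' : σ 0 = word c := hV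
  refine .of_runs (by simp only [WExpr.eval_lit, WExpr.eval_reg, hT.on]; omega)
    (.ite (fun _ => .of_wp ?_) fun h => absurd hC (by simp at h ⊢; omega))
  rw [Cmd.wp_ifEq]
  refine ⟨fun h => ?_, fun _ => ?_⟩
  · simp only [WExpr.eval_reg, hV, hT.x_eq, word_inj] at h
    exact absurd h hcx
  · simp [Cmd.wp, hV', hc, vertexWord_some, hl, getElem?_idxOf_add_one hnd, hw, hD']
    refine ⟨by omega, (word_le u).trans hv.le_n,
      hT.congr fun i h1 _ => ?_, hv.congr S σ _ (fun i h1 => ?_) hI, ?_, ?_, ?_⟩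
    · rw [Function.update_of_ne, Function.update_of_ne, Function.update_of_ne] <;> omega
    · rw [Function.update_of_ne, Function.update_of_ne, Function.update_of_ne] <;> omega
    · simp
    · simp
    · simp; omega

theorem Visits.descend (hv : Visits L W visit x y q I) {u : Fin n} (hux : L.Desc u x)
    (hu : ¬ Barred L y q u) {S : Finset (Fin n)} {σ : ℕ → ℕ} (hT : TourRegs y q x σ)
    (hI : I S σ) (hC : σ rC = word u) (hD : σ rDep + L.len u = L.depth u) :
    Iterates L.memory W (.lit 0) (.reg rM) (tourStep visit) σ 1
      (TourAt L y q x I (insert u S) (vertexWord (L.children u)[0]?) u) := by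
  have hw : ∀ o : Option (Fin n), vertexWord o ≤ W := fun o => (vertexWord_le o).trans hv.le_n
  have hD' : σ 2 + L.len u = L.depth u := hD
  have hC' : σ 1 = word u := hC
  have hdu := hv.depth_le u
  refine .of_runs (by simp only [WExpr.eval_lit, WExpr.eval_reg, hT.on]; omega)
    (.ite (fun h => ?_) fun _ => ?_)
  · simp only [WExpr.eval_lit, WExpr.eval_reg, hC] at h
    exact absurd (word_pos u) (by omega)
  refine .ite (fun h => ?_) fun _ => .ite (fun h => ?_) fun _ => ?_
  · simp only [WExpr.eval_add, WExpr.eval_sub, WExpr.eval_lit, WExpr.eval_reg] at h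
    have h : σ rC = σ rY := by omega
    rw [hC, hT.y_eq, eq_comm, vertexWord_eq_word] at h
    exact absurd (.inl ⟨u, h, .rfl⟩) hu
  · simp only [WExpr.eval_add, WExpr.eval_sub, WExpr.eval_lit, WExpr.eval_reg] at h
    have h : σ rC = σ rQ := by omega
    rw [hC, hT.q_eq, eq_comm, vertexWord_eq_word] at h
    exact absurd (.inr ⟨u, h, .rfl⟩) hu
  have h1 : Runs L.memory W ((Cmd.set rV (.reg rC) ;; .set rDep (.reg rDep + .len (.reg rV))))
      σ 0 fun σ' => TourRegs y q x σ' ∧ I S σ' ∧ σ' rV = word u ∧ σ' rDep = L.depth u := by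
    refine .of_wp ?_
    simp [Cmd.wp, hC', hD']
    refine ⟨(word_le u).trans hv.le_n, hdu, hT.congr fun i h1 _ => ?_,
      hv.congr S σ _ (fun i h1 => ?_) hI⟩ <;>
    · rw [Function.update_of_ne, Function.update_of_ne] <;> omega
  refine (h1.seq (t' := 0) fun σ₁ ⟨hT1, hI1, hV1, hD1⟩ => ?_).mono (by simp) fun _ h => h
  refine ((hv.runs u S σ₁ hux hu hV1 hD1 hT1 hI1).frame.seq (t' := 0) fun σ₂ ⟨hI2, hf⟩ => ?_).mono
    (by simp) fun _ h => h
  have hfr : ∀ i < 10, σ₂ i = σ₁ i := fun i hi => hf i (hv.frame i hi)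
  have hV2 : σ₂ 0 = word u := (hfr 0 (by omega)).trans hV1
  have hD2 : σ₂ 2 = L.depth u := (hfr 2 (by omega)).trans hD1
  refine .of_wp ?_
  simp only [Cmd.wp, WExpr.eval_query, WExpr.eval_reg, WExpr.eval_lit, hV2, rV, memory_firstChild]
  refine ⟨hw _, hT1.congr fun i h1 h2 => ?_, hv.congr _ σ₂ _ (fun i h1 => ?_) hI2, ?_, ?_, ?_⟩
  · rw [Function.update_of_ne, hfr i h2]; simp only [rC]; omega
  · rw [Function.update_of_ne]; simp only [rC]; omega
  · simp
  · simpa using hV2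
  · simpa using hD2

/-- A left-out child costs one skipping step, charged to `barCount`. Any other child costs one less
than four times the number of vertices visited below it, and the missing step is its ascent to `u`.
-/
theorem Visits.children (hv : Visits L W visit x y q I) {u : Fin n}
    (hux : L.Desc u x) (hu : ¬ Barred L y q u)
    (ih : ∀ c, L.parent c = some u → ToursSubtree L y q W visit x I c) :
    ∀ (l pre : List (Fin n)) (S : Finset (Fin n)) (σ : ℕ → ℕ), L.children u = pre ++ l →
      (∀ c ∈ l, Disjoint S (unbarred L y q [c])) → TourAt L y q x I S (vertexWord l[0]?) u σ →
      Iterates L.memory W (.lit 0) (.reg rM) (tourStep visit) σ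
        (4 * (S ∪ unbarred L y q l).card + barCount y q l - 4 * S.card)
        (TourAt L y q x I (S ∪ unbarred L y q l) 0 u) := by
  intro l
  induction l with
  | nil =>
    intro pre S σ hl hd h
    have h0 : S ∪ unbarred L y q [] = S := by
      ext v; simp [mem_unbarred]
    rw [h0]
    exact (Iterates.refl h).mono (by omega) fun _ h => h
  | cons c l ihl =>
    intro pre S σ hl hd h
    have hc : L.parent c = some u := (L.mem_children u c).1 (by simp [hl])
    have hl' : L.children u = (pre ++ [c]) ++ l := by simp [hl]
    have h' : TourAt L y q x I S (word c) u σ := by simpa [vertexWord_some] using h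
    obtain ⟨hb1, hb2⟩ := barCount_cons (y := y) (q := q) c l
    by_cases hbar : Barred L y q c
    · have hset : unbarred L y q (c :: l) = unbarred L y q l := by
        ext v
        simp only [mem_unbarred, List.mem_cons, exists_eq_or_imp]
        exact ⟨fun ⟨h, h'⟩ => ⟨h.resolve_left fun h => h' (hbar.of_desc h), h'⟩,
          fun ⟨h, h'⟩ => ⟨.inr h, h'⟩⟩
      rw [hset]
      refine ((hv.skip hu hbar hl h').trans fun σ' h1 => ihl (pre ++ [c]) S σ' hl'
        (fun c' hc' => hd c' (by simp [hc'])) h1).mono ?_ fun _ h => h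
      have := hb2 (hbar.eq_of_parent hc hu)
      have := card_le_union S (unbarred L y q l)
      omega
    · have hset : unbarred L y q (c :: l) = unbarred L y q [c] ∪ unbarred L y q l := by
        ext v
        simp only [mem_unbarred, List.mem_cons, exists_eq_or_imp, Finset.mem_union]
        simp
        tauto
      obtain ⟨hT, hI, hC, hV, hD⟩ := h'
      rw [hset, ← Finset.union_assoc]
      refine (((ih c hc S σ hbar (hd c (by simp)) hT hI hC
        (by rw [hD, depth_parent hc])).trans fun σ' h1 => hv.ascend hux hl h1).trans
        fun σ' h1 => ihl (pre ++ [c]) (S ∪ unbarred L y q [c]) σ' hl' (fun c' hc' => ?_) h1).mono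
        ?_ fun _ h => h
      · refine Finset.disjoint_union_left.2 ⟨hd c' (by simp [hc']), ?_⟩
        rw [Finset.disjoint_left]
        intro v hv1 hv2
        obtain ⟨⟨c'', hc'', hv3⟩, -⟩ := mem_unbarred.1 hv1
        obtain rfl := List.mem_singleton.1 hc''
        obtain ⟨⟨d, hd', hv4⟩, -⟩ := mem_unbarred.1 hv2
        obtain rfl := List.mem_singleton.1 hd'
        have hpar := (L.mem_children u d).1 (by simp [hl, hc'])
        have heq := eq_of_siblings hc hpar hv3 hv4
        have hnd := L.nodup_children u
        rw [hl] at hnd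
        exact (List.nodup_cons.1 (List.nodup_append.1 hnd).2.1).1 (heq ▸ hc')
      · have h1 := card_le_union (S ∪ unbarred L y q [c]) (unbarred L y q l)
        have h2 : S.card + 1 ≤ (S ∪ unbarred L y q [c]).card := by
          have : c ∉ S := fun h => Finset.disjoint_left.1 (hd c (by simp)) h
            (mem_unbarred.2 ⟨⟨c, by simp, .rfl⟩, hbar⟩)
          rw [← Finset.card_insert_of_notMem this]
          refine Finset.card_le_card (Finset.insert_subset ?_ Finset.subset_union_left)
          exact Finset.mem_union_right _ (mem_unbarred.2 ⟨⟨c, by simp, .rfl⟩, hbar⟩)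
        omega

/-- Induction from the leaves upwards. The budget of four steps per vertex consists of one to enter
it, at most two to skip children, and one to leave it. Leaving `u` itself is charged to the parent,
hence the subtracted 1. -/
theorem Visits.toursSubtree (hv : Visits L W visit x y q I) {u : Fin n} (hux : L.Desc u x) :
    ToursSubtree L y q W visit x I u := by
  induction hk : n - L.hop u using Nat.strong_induction_on generalizing u with
  | _ k ih =>
    intro S σ hu hd hT hI hC hD
    have huS : u ∉ S := fun h => Finset.disjoint_left.1 hd h
      (mem_unbarred.2 ⟨⟨u, by simp, .rfl⟩, hu⟩)
    have hset : S ∪ unbarred L y q [u] = insert u S ∪ unbarred L y q (L.children u) := by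
      ext v
      simp only [Finset.mem_union, mem_unbarred, Finset.mem_insert, List.mem_singleton,
        exists_eq_left, L.mem_children]
      constructor
      · rintro (h | ⟨h, h'⟩)
        · exact .inl (.inr h)
        · rcases h.eq_or_child with h | h
          · exact .inl (.inl h)
          · exact .inr ⟨h, h'⟩
      · rintro ((rfl | h) | ⟨⟨c, hc, h⟩, h'⟩)
        · exact .inr ⟨.rfl, hu⟩
        · exact .inl h
        · exact .inr ⟨h.trans (.of_parent hc), h'⟩
    rw [hset]
    refine ((hv.descend hux hu hT hI hC hD).trans fun σ' h => hv.children hux hu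
      (fun c hc => ih _ ?_ ((Desc.of_parent hc).trans hux) rfl) (L.children u) [] _ σ' rfl
      (fun c hc => ?_) h).mono ?_ fun _ h => h
    · have := hop_parent hc
      have := hop_lt (L := L) u
      omega
    · have hc := (L.mem_children u c).1 hc
      refine Finset.disjoint_left.2 fun v hvS hvc => ?_
      obtain ⟨⟨c', hc', hvd⟩, hvb⟩ := mem_unbarred.1 hvc
      obtain rfl := List.mem_singleton.1 hc'
      rcases Finset.mem_insert.1 hvS with rfl | hvS
      · exact not_desc_parent hc hvd
      · exact Finset.disjoint_left.1 hd hvS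
          (mem_unbarred.2 ⟨⟨u, by simp, hvd.trans (.of_parent hc)⟩, hvb⟩)
    · have h1 := barCount_le (y := y) (q := q) (L.nodup_children u)
      have h2 := card_le_union (insert u S) (unbarred L y q (L.children u))
      rw [Finset.card_insert_of_notMem huS] at h2 ⊢
      omega

/-- The tour visits the vertices of the subtree of `x` that are not left out. -/
theorem Visits.tour (hv : Visits L W visit x y q I) {S : Finset (Fin n)} {σ : ℕ → ℕ}
    (hx : ¬ Barred L y q x) (hd : Disjoint S (unbarred L y q [x])) (hxx : σ rX = word x)
    (hy : σ rY = vertexWord y) (hq : σ rQ = vertexWord q) (hI : I S σ)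
    (hD : σ rDep + L.len x = L.depth x) (hW : 1 ≤ W) :
    Runs L.memory W (tour visit) σ (4 * (S ∪ unbarred L y q [x]).card - 4 * S.card)
      fun σ' => I (S ∪ unbarred L y q [x]) σ' ∧ σ' rDep = L.depth x := by
  have h1 : Runs L.memory W ((Cmd.set rC (.reg rX) ;; .set rM (.lit 1))) σ 0 fun σ' =>
      TourRegs y q x σ' ∧ I S σ' ∧ σ' rC = word x ∧ σ' rDep + L.len x = L.depth x := by
    refine .of_wp ?_
    have hxx' : σ 4 = word x := hxx
    simp [Cmd.wp, hxx']
    refine ⟨(word_le x).trans hv.le_n, hW, ⟨?_, ?_, ?_, ?_⟩, hv.congr S σ _ (fun i h1 => ?_) hI, ?_⟩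
    · simpa using hxx
    · simpa using hy
    · simpa using hq
    · simp
    · rw [Function.update_of_ne, Function.update_of_ne] <;> omega
    · exact hD
  refine (h1.seq (t' := 4 * (S ∪ unbarred L y q [x]).card - 4 * S.card)
    fun σ₁ ⟨hT, hI, hC, hD⟩ => ?_).mono (by simp) fun _ h => h
  have h2 := hv.toursSubtree .rfl S σ₁ hx hd hT hI hC hD
  have h3 : S.card + 1 ≤ (S ∪ unbarred L y q [x]).card := by
    have : x ∉ S := fun h => Finset.disjoint_left.1 hd h (mem_unbarred.2 ⟨⟨x, by simp, .rfl⟩, hx⟩)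
    rw [← Finset.card_insert_of_notMem this]
    refine Finset.card_le_card (Finset.insert_subset ?_ Finset.subset_union_left)
    exact Finset.mem_union_right _ (mem_unbarred.2 ⟨⟨x, by simp, .rfl⟩, hx⟩)
  -- The step saved by `toursSubtree` is spent here: at `x` with no child left, the tour clears `rM`
  -- instead of ascending.
  refine ((h2.trans (t' := 1) (post' := fun σ' => σ' rM = 0 ∧ I (S ∪ unbarred L y q [x]) σ' ∧
    σ' rDep = L.depth x) fun σ' ⟨hT, hI, hC, hV, hD⟩ => ?_).runs fun σ' h => ?_).mono (by omega)
    fun _ h => h.2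
  · refine .of_runs (by simp only [WExpr.eval_lit, WExpr.eval_reg, hT.on]; omega)
      (.of_wp ⟨fun _ => ?_, fun h => absurd hC (by simp at h ⊢; omega)⟩)
    rw [Cmd.wp_ifEq]
    refine ⟨fun _ => ?_, fun h => absurd (by simp only [WExpr.eval_reg, hV, hT.x_eq]) h⟩
    refine ⟨Nat.zero_le _, by simp, hv.congr _ σ' _ (fun i h1 => ?_) hI, by simpa using hD⟩
    rw [Function.update_of_ne]; simp only [rM]; omega
  · simp only [WExpr.eval_lit, WExpr.eval_reg, h.1]; omega

end tour

/-! ### Touring the whole tree from a point -/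

/-- Depth of `rX`. -/
@[simp] abbrev rDepX : ℕ := 6
/-- Distance from the point to `rX`, in units of `1 / rSd`. -/
@[simp] abbrev rDx : ℕ := 7
@[simp] abbrev rSd : ℕ := 9

def climbStep : Cmd TreeQuery :=
  .ite (.reg rY) (.lit 1) (.set rDx (.len (.reg rX) * .reg rSd - .reg rDx))
      (.set rDx (.reg rDx + .len (.reg rX) * .reg rSd)) ;;
    .set rDepX (.reg rDepX - .len (.reg rX)) ;; .set rY (.reg rX) ;; .set rX (.parent (.reg rX))

/-- Tour the tree without the subtree of `rQ`, starting below the point at distance `rDx / rSd`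
above the vertex `rX` and climbing to the root. -/
def climbTour (visit : Cmd TreeQuery) : Cmd TreeQuery :=
  .set rY (.lit 0) ;; .loop (.lit 0) (.reg rX)
    (.set rDep (.reg rDepX - .len (.reg rX)) ;; tour visit ;; climbStep)

/-! ### Correctness and cost of the tour from a point -/

section

variable {n : ℕ} {T : WeightedTree n} (L : T.Layout)

open Classical in
/-- The distance to `v` from the point at distance `sn / sd` above `a`, in units of `1 / sd`. -/
noncomputable def scaledDist (a : Fin n) (sn sd : ℕ) (v : Fin n) : ℕ :=
  if L.Desc v a then sn + sd * T.vdist a v else L.len a * sd - sn + sd * (T.vdist a v - L.len a)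

/-- The climb from `a` has reached `x`, after `y`. -/
def ClimbStage (a : Fin n) (y x : Option (Fin n)) : Prop :=
  y = none ∧ x = some a ∨ ∃ y', y = some y' ∧ L.parent y' = x ∧ L.Desc a y'

variable {L} {a x v : Fin n} {y : Option (Fin n)} {sn sd : ℕ}

theorem vdist_via_parent {c u : Fin n} (hc : L.parent c = some u) (ha : L.Desc a c)
    (hv : ¬ L.Desc v c) : T.vdist a v = T.vdist a u + T.vdist u v := by
  rw [T.vdist_comm a v, vdist_into (.inl hv) ha, vdist_top hc hv, T.vdist_comm a u,
    vdist_parent_of_desc hc ha, T.vdist_comm u v]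
  omega

theorem scaledDist_self : scaledDist L a sn sd a = sn := by simp [scaledDist, Desc.rfl]

theorem ClimbStage.desc (h : ClimbStage L a y (some x)) : L.Desc a x := by
  rcases h with ⟨-, h⟩ | ⟨y', -, h, h'⟩
  · cases h; exact .rfl
  · exact h'.trans (.of_parent h)

theorem ClimbStage.not_desc (h : ClimbStage L a y (some x)) : ¬ ∃ u ∈ y, L.Desc x u := by
  rcases h with ⟨rfl, h⟩ | ⟨y', rfl, h, h'⟩
  · simp
  · rintro ⟨u, hu, hxu⟩
    cases hu
    exact not_desc_parent h hxu

theorem ClimbStage.scaledDist_eq (h : ClimbStage L a y (some x)) (hv : L.Desc v x)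
    (hvy : ¬ ∃ u ∈ y, L.Desc v u) :
    scaledDist L a sn sd v = scaledDist L a sn sd x + sd * T.vdist x v := by
  rcases h with ⟨rfl, h⟩ | ⟨y', rfl, h, h'⟩
  · cases h
    rw [scaledDist_self]
    simp [scaledDist, hv]
  · have hvy' : ¬ L.Desc v y' := fun h => hvy ⟨y', rfl, h⟩
    have hxa : ¬ L.Desc x a := fun h1 => not_desc_parent h (h1.trans h')
    have hva : ¬ L.Desc v a := fun h1 => hvy' (h1.trans h')
    have h1 := vdist_via_parent h h' hvy'
    obtain ⟨p, hp⟩ : ∃ p, L.parent a = some p := by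
      rcases h'.eq_or_parent with rfl | ⟨p, hp, -⟩
      exacts [⟨x, h⟩, ⟨p, hp⟩]
    have h2 := vdist_of_not_desc hp hxa
    simp only [scaledDist, hxa, hva, if_false, h1, h2]
    rw [show L.len a + T.vdist p x + T.vdist x v - L.len a = T.vdist p x + T.vdist x v by omega,
      Nat.add_sub_cancel_left]
    ring

/-- The point lies on the edge above `a`, so the first climb passes the rest of that edge and moves
on from the point, whereas later climbs add whole edges. The first climb is recognized by `y =
none`. -/
theorem ClimbStage.scaledDist_parent {p : Fin n} (h : ClimbStage L a y (some x))
    (hp : L.parent x = some p) : scaledDist L a sn sd p =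
      if y = none then L.len x * sd - sn else scaledDist L a sn sd x + L.len x * sd := by
  have hpa : ¬ L.Desc p a := fun h1 => not_desc_parent hp (h1.trans h.desc)
  rcases h with ⟨rfl, h⟩ | ⟨y', rfl, h, h'⟩
  · cases h
    have h1 := vdist_of_not_desc hp hpa
    simp [scaledDist, hpa, h1]
  · have hxa : ¬ L.Desc x a := fun h1 => not_desc_parent h (h1.trans h')
    have hpy : ¬ L.Desc p y' := fun h1 => not_desc_parent hp (h1.trans (.of_parent h))
    have h1 := vdist_via_parent h h' hpy
    have h2 : L.len a ≤ T.vdist a x := by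
      obtain ⟨p', hp'⟩ : ∃ p, L.parent a = some p := by
        rcases h'.eq_or_parent with rfl | ⟨p, hp, -⟩
        exacts [⟨x, h⟩, ⟨p, hp⟩]
      rw [vdist_of_not_desc hp' hxa]
      omega
    rw [T.vdist_comm x p, vdist_parent hp] at h1
    simp only [scaledDist, hpa, hxa, if_false, h1, reduceCtorEq]
    rw [show T.vdist a x + L.len x - L.len a = (T.vdist a x - L.len a) + L.len x by omega]
    ring

variable (L) in
open Classical in
/-- The vertices below `y` that are not below `q`. -/
noncomputable def climbed (y q : Option (Fin n)) : Finset (Fin n) :=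
  Finset.univ.filter fun v => (∃ u ∈ y, L.Desc v u) ∧ ¬ ∃ u ∈ q, L.Desc v u

theorem mem_climbed {y q : Option (Fin n)} :
    v ∈ climbed L y q ↔ (∃ u ∈ y, L.Desc v u) ∧ ¬ ∃ u ∈ q, L.Desc v u := by simp [climbed]

/-- What a tour from a point needs to know about the command that is run at each vertex. -/
structure ClimbVisits (L : T.Layout) (W : ℕ) (visit : Cmd TreeQuery) (a : Fin n) (sn sd : ℕ)
    (q : Option (Fin n)) (I : Finset (Fin n) → (ℕ → ℕ) → Prop) : Prop where
  le_n : n ≤ W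
  one_le : 1 ≤ W
  depth_le : ∀ v, L.depth v ≤ W
  dist_le : ∀ v, scaledDist L a sn sd v ≤ W
  len_le : L.len a * sd ≤ W
  frame : ∀ i < 10, ¬ visit.Writes i
  congr : ∀ S σ σ', (∀ i, 8 ≤ i → σ' i = σ i) → I S σ → I S σ'
  runs : ∀ u S σ x y, ClimbStage L a y (some x) → L.Desc u x → (¬ ∃ b ∈ y, L.Desc u b) →
    (¬ ∃ b ∈ q, L.Desc u b) → climbed L y q ⊆ S → σ rV = word u → σ rDep = L.depth u →
    σ rY = vertexWord y → (σ rDep - σ rDepX) * σ rSd + σ rDx = scaledDist L a sn sd u →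
    σ rSd = sd → I S σ → Runs L.memory W visit σ 0 (I (insert u S))

variable {W : ℕ} {visit : Cmd TreeQuery} {q : Option (Fin n)}
  {I : Finset (Fin n) → (ℕ → ℕ) → Prop}

theorem ClimbVisits.visits (hv : ClimbVisits L W visit a sn sd q I)
    (hs : ClimbStage L a y (some x)) : Visits L W visit x y q fun S σ => I S σ ∧
      climbed L y q ⊆ S ∧ σ rDepX = L.depth x ∧ σ rDx = scaledDist L a sn sd x ∧ σ rSd = sd where
  le_n := hv.le_n
  depth_le := hv.depth_le
  frame := hv.frame
  congr S σ σ' hσ := fun ⟨h1, h2, h3, h4, h5⟩ => ⟨hv.congr S σ σ' (fun i hi => hσ i (by omega)) h1,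
    h2, by rw [hσ _ (by simp), h3], by rw [hσ _ (by simp), h4], by rw [hσ _ (by simp), h5]⟩
  runs u S σ hux hu hV hD hT := fun ⟨h1, h2, h3, h4, h5⟩ => by
    have hu1 : ¬ ∃ b ∈ y, L.Desc u b := fun h => hu (.inl h)
    refine (hv.runs u S σ x y hs hux hu1 (fun h => hu (.inr h)) h2 hV hD hT.y_eq ?_ h5
      h1).frame.mono le_rfl fun σ' ⟨h, hf⟩ => ⟨h, h2.trans (Finset.subset_insert _ _), ?_, ?_, ?_⟩
    · rw [hD, h3, h4, h5, depth_of_desc hux, hs.scaledDist_eq hux hu1, Nat.add_sub_cancel_left]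
      ring
    · rw [hf _ (hv.frame _ (by simp)), h3]
    · rw [hf _ (hv.frame _ (by simp)), h4]
    · rw [hf _ (hv.frame _ (by simp)), h5]

theorem climbed_union (hs : ClimbStage L a y (some x)) :
    climbed L y q ∪ unbarred L y q [x] = climbed L (some x) q := by
  ext v
  have hyx : (∃ u ∈ y, L.Desc v u) → L.Desc v x := by
    rcases hs with ⟨rfl, h⟩ | ⟨y', rfl, h, h'⟩
    · simp
    · rintro ⟨u, hu, hvu⟩
      cases hu
      exact hvu.trans (.of_parent h)
  simp only [Finset.mem_union, mem_climbed, mem_unbarred, List.mem_singleton, exists_eq_left,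
    Barred, Option.mem_def, Option.some.injEq, exists_eq_left']
  simp only [Option.mem_def] at hyx
  have key : ∀ A B C : Prop, (A → C) → ((A ∧ ¬ B) ∨ C ∧ ¬ (A ∨ B) ↔ C ∧ ¬ B) := by tauto
  exact key _ _ _ hyx

theorem runs_climbStep (hn : n ≤ W) (hdep : ∀ v, L.depth v ≤ W)
    (hdist : ∀ v, scaledDist L a sn sd v ≤ W) (hlen : L.len a * sd ≤ W)
    (hs : ClimbStage L a y (some x)) {σ : ℕ → ℕ} (hX : σ rX = word x) (hY : σ rY = vertexWord y)
    (h3 : σ rDepX = L.depth x) (h4 : σ rDx = scaledDist L a sn sd x) (h5 : σ rSd = sd) :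
    Runs L.memory W climbStep σ 0 fun σ' => σ' rX = vertexWord (L.parent x) ∧
      σ' rY = word x ∧ (∀ p ∈ L.parent x, σ' rDepX = L.depth p ∧
      σ' rDx = scaledDist L a sn sd p) ∧ ∀ i, 8 ≤ i → σ' i = σ i := by
  have hX' : σ 4 = word x := hX
  have hY' : σ 5 = vertexWord y := hY
  have h3' : σ 6 = L.depth x := h3
  have h4' : σ 7 = scaledDist L a sn sd x := h4
  have h5' : σ 9 = sd := h5
  have hw : ∀ o : Option (Fin n), vertexWord o ≤ W := fun o => (vertexWord_le o).trans hn
  have hwx : word x ≤ W := (word_le x).trans hn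
  have hdx := hdep x
  have hyn : vertexWord y = 0 ↔ y = none := by cases y <;> simp [vertexWord_some]
  -- The new word is again a distance from the point if `x` has a parent; at the root the length 0
  -- is added.
  have hbound : scaledDist L a sn sd x + L.len x * sd ≤ W ∨ y = none := by
    by_cases hy : y = none
    · exact .inr hy
    · left
      cases hp : L.parent x with
      | none =>
        have : L.len x = 0 := by simp [len, hp]
        simpa [this] using hdist x
      | some p =>
        have := hdist p
        rwa [hs.scaledDist_parent hp, if_neg hy] at this
  have hbound' : y = none → L.len x * sd - scaledDist L a sn sd x ≤ W := by
    rintro rfl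
    rcases hs with ⟨-, h⟩ | ⟨y', h, -⟩
    · cases h; omega
    · cases h
  have hdepp : ∀ p, L.parent x = some p → L.depth x - L.len x = L.depth p := fun p hp => by
    rw [depth_parent hp]; omega
  refine .of_wp ?_
  simp [Cmd.wp, climbStep, hX', hY', h3', h4', h5', hw, hwx, hyn]
  constructor
  · intro hy
    have := hbound' hy
    refine ⟨by omega, by omega, fun p hp => ⟨hdepp p hp, ?_⟩, fun i hi => ?_⟩
    · rw [hs.scaledDist_parent hp, if_pos hy]
      subst hy
      rcases hs with ⟨-, h⟩ | ⟨y', h, -⟩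
      · cases h; rw [scaledDist_self]
      · cases h
    · rw [Function.update_of_ne, Function.update_of_ne, Function.update_of_ne,
        Function.update_of_ne] <;> omega
  · intro hy
    have := hbound.resolve_right hy
    refine ⟨by omega, by omega, fun p hp => ⟨hdepp p hp, ?_⟩, fun i hi => ?_⟩
    · rw [hs.scaledDist_parent hp, if_neg hy]
    · rw [Function.update_of_ne, Function.update_of_ne, Function.update_of_ne,
        Function.update_of_ne] <;> omega

/-- The tour from a point visits all vertices that are not below `q`. -/
theorem ClimbVisits.climbTour (hv : ClimbVisits L W visit a sn sd q I) {σ : ℕ → ℕ}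
    (hX : σ rX = word a) (hDX : σ rDepX = L.depth a) (hDx : σ rDx = sn) (hS : σ rSd = sd)
    (hQ : σ rQ = vertexWord q) (hq : ¬ ∃ b ∈ q, L.Desc a b) (hI : I ∅ σ) :
    Runs L.memory W (climbTour visit) σ (5 * n) (I (climbed L (some L.root) q)) := by
  have h0 : climbed L none q = ∅ := by ext v; simp [mem_climbed]
  -- Five units per vertex: four for the tours, and one for the iteration of the climb, which always
  -- visits at least the new vertex `x`.
  let J : ℕ → (ℕ → ℕ) → Prop := fun k σ => ∃ y x, ClimbStage L a y x ∧ σ rX = vertexWord x ∧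
    σ rY = vertexWord y ∧ (∀ x' ∈ x, σ rDepX = L.depth x' ∧ σ rDx = scaledDist L a sn sd x') ∧
    σ rSd = sd ∧ σ rQ = vertexWord q ∧ I (climbed L y q) σ ∧ k + 5 * (climbed L y q).card = 5 * n
  have h1 : Runs L.memory W (.set rY (.lit 0)) σ 0 (J (5 * n)) := by
    refine .of_wp ⟨Nat.zero_le _, none, some a, .inl ⟨rfl, rfl⟩, ?_, ?_, ?_, ?_, ?_, ?_, by simp [h0]⟩
    · simpa [vertexWord_some] using hX
    · simp
    · rintro x' hx'
      cases hx'
      rw [scaledDist_self]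
      exact ⟨by simpa using hDX, by simpa using hDx⟩
    · simpa using hS
    · simpa using hQ
    · rw [h0]
      refine hv.congr _ σ _ (fun i hi => ?_) hI
      rw [Function.update_of_ne]; simp only [rY]; omega
  refine (h1.seq fun σ₁ hJ => (Runs.loop (I := J) ?_ hJ)).mono (by omega) ?_
  · rintro k σ ⟨y, x, hs, hX, hY, hx, hS, hQ, hI, hk⟩ hlt
    cases x with
    | none => simp only [WExpr.eval_lit, WExpr.eval_reg, hX, vertexWord_none] at hlt; omega
    | some x =>
    obtain ⟨hx1, hx2⟩ := hx x rfl
    have hX' : σ 4 = word x := hX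
    have hDX' : σ 6 = L.depth x := hx1
    have hxq : ¬ ∃ b ∈ q, L.Desc x b := fun ⟨b, hb, h⟩ => hq ⟨b, hb, hs.desc.trans h⟩
    have hxb : ¬ Barred L y q x := fun h => h.elim hs.not_desc hxq
    have hcard : (climbed L y q).card + 1 ≤ (climbed L (some x) q).card := by
      have hxc : x ∉ climbed L y q := fun h => hs.not_desc (mem_climbed.1 h).1
      rw [← Finset.card_insert_of_notMem hxc, ← climbed_union hs]
      refine Finset.card_le_card (Finset.insert_subset ?_ Finset.subset_union_left)
      exact Finset.mem_union_right _ (mem_unbarred.2 ⟨⟨x, by simp, .rfl⟩, hxb⟩)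
    have hcard' : (climbed L (some x) q).card ≤ n := by
      simpa using Finset.card_le_univ (climbed L (some x) q)
    have h2 : Runs L.memory W (.set rDep (.reg rDepX - .len (.reg rX))) σ 0 fun σ' =>
        σ' rDep + L.len x = L.depth x ∧ ∀ i, 3 ≤ i → σ' i = σ i := by
      refine .of_wp ?_
      have := hv.depth_le x
      have := len_le_depth (L := L) x
      simp [Cmd.wp, hX', hDX']
      refine ⟨by omega, by omega, fun i hi => ?_⟩
      rw [Function.update_of_ne]; omega
    refine ⟨4 * (climbed L (some x) q).card - 4 * (climbed L y q).card,
      5 * n - 5 * (climbed L (some x) q).card, by omega, ?_⟩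
    refine (h2.seq fun σ₁ ⟨hd, hσ₁⟩ => ?_).mono (Nat.zero_add _).le fun _ h => h
    have h3 := (hv.visits hs).tour (σ := σ₁) (S := climbed L y q) hxb ?_
      ((hσ₁ _ (by simp)).trans hX) ((hσ₁ _ (by simp)).trans hY) ((hσ₁ _ (by simp)).trans hQ)
      ⟨hv.congr _ σ _ (fun i hi => hσ₁ i (by omega)) hI, subset_rfl,
        (hσ₁ _ (by simp)).trans hx1, (hσ₁ _ (by simp)).trans hx2, (hσ₁ _ (by simp)).trans hS⟩ hd
      hv.one_le
    · rw [climbed_union hs] at h3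
      refine (h3.frame.seq (t' := 0) fun σ₂ hσ₂ => ?_).mono
        (Nat.add_zero _).le fun _ h => h
      obtain ⟨⟨⟨hI2, -, hx1', hx2', hS'⟩, -⟩, hf⟩ := hσ₂
      have hfr : ∀ i, 4 ≤ i → i < 10 → σ₂ i = σ i := fun i h4 hi => by
        rw [hf i, hσ₁ i (by omega)]
        have := hv.frame i hi
        simp only [tour, tourStep, Cmd.Writes, Cmd.writes_ifEq]
        simp only [rV, rC, rDep, rM, this, false_or]
        omega
      refine (runs_climbStep hv.le_n hv.depth_le hv.dist_le hv.len_le hs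
        ((hfr _ (by simp) (by simp)).trans hX) ((hfr _ (by simp) (by simp)).trans hY) hx1' hx2'
        hS').mono le_rfl fun σ₃ ⟨hX3, hY3, hp3, hf3⟩ => ?_
      refine ⟨some x, L.parent x, .inr ⟨x, rfl, rfl, hs.desc⟩, hX3, hY3, hp3, ?_, ?_,
        hv.congr _ σ₂ _ hf3 hI2, by omega⟩
      · rw [hf3 _ (by simp), hS']
      · rw [hf3 _ (by simp), hfr _ (by simp) (by simp), hQ]
    · refine Finset.disjoint_left.2 fun v hv1 hv2 => ?_
      obtain ⟨⟨c, hc, -⟩, hvb⟩ := mem_unbarred.1 hv2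
      exact hvb (.inl (mem_climbed.1 hv1).1)
  · rintro σ' ⟨⟨k, y, x, hs, hX, hY, hx, hS, hQ, hI, hk⟩, hlt⟩
    cases x with
    | some x =>
      simp only [WExpr.eval_lit, WExpr.eval_reg, hX, vertexWord_some] at hlt
      exact absurd (word_pos x) hlt
    | none =>
      -- The loop ends when there is no vertex to climb to, so the last subtree toured was that of
      -- the root.
      rcases hs with ⟨-, h⟩ | ⟨y', rfl, h, h'⟩
      · cases h
      · have : y' = L.root := by
          by_contra hne
          obtain ⟨p, hp⟩ := exists_parent hne
          rw [hp] at h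
          cases h
        rwa [this] at hI

end

/-! ### Locating a point at a given distance above a vertex -/

/-- The value `rP / rS` that is tested. -/
@[simp] abbrev rP : ℕ := 10
@[simp] abbrev rS : ℕ := 11
/-- The vertex whose ball has the deepest top, with the depth `rTn / (rTd * rS)` of this top. -/
@[simp] abbrev rTn : ℕ := 12
@[simp] abbrev rTd : ℕ := 13
@[simp] abbrev rTv : ℕ := 14
@[simp] abbrev rTdep : ℕ := 15

/-- Find the top of the ball of `rTv`; it is the root if there is no such vertex. -/
def locate : Cmd TreeQuery :=
  .ite (.reg rTv) (.lit 1)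
    (.set rX .root ;; .set rDepX (.lit 0) ;; .set rDx (.lit 0) ;; .set rSd (.lit 1))
    ((.set rX (.reg rTv) ;; .set rDepX (.reg rTdep) ;; .set rDx (.reg rP) ;;
        .set rSd (.reg rS * .weight (.reg rTv))) ;;
      .loop (.len (.reg rX) * .reg rSd) (.reg rDx + .lit 1)
        (.set rDx (.reg rDx - .len (.reg rX) * .reg rSd) ;;
          .set rDepX (.reg rDepX - .len (.reg rX)) ;; .set rX (.parent (.reg rX))))

section

variable {n : ℕ} {T : WeightedTree n} {L : T.Layout} {W : ℕ}

theorem WeightedTree.Layout.Desc.depth_lt {i j : Fin n} (h : L.Desc i j) (hne : i ≠ j) : L.depth j < L.depth i := by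
  rcases h.eq_or_parent with h | ⟨p, hp, h⟩
  · exact absurd h hne
  · have h1 := depth_parent hp
    have h2 := len_pos hp
    have h3 := depth_of_desc h
    omega

theorem exists_firstChild_root (L : T.Layout) (hn : 2 ≤ n) :
    ∃ c, (L.children L.root)[0]? = some c ∧ L.parent c = some L.root := by
  obtain ⟨v, hv⟩ : ∃ v : Fin n, v ≠ L.root := by
    have : Nontrivial (Fin n) := Fin.nontrivial_iff_two_le.2 hn
    exact exists_ne _
  rcases (desc_root (L := L) v).eq_or_child with h | ⟨c, hc, -⟩
  · exact absurd h hv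
  · have hm := (L.mem_children _ _).2 hc
    cases hl : L.children L.root with
    | nil => simp [hl] at hm
    | cons c' l => exact ⟨c', by simp, (L.mem_children _ _).1 (by simp [hl])⟩

theorem runs_locate_root (hn : n ≤ W) (h1 : 1 ≤ W) {σ : ℕ → ℕ} (hv : σ rTv = 0) :
    Runs L.memory W locate σ 0 fun σ' => σ' rX = word L.root ∧ σ' rDepX = 0 ∧
      σ' rDx = 0 ∧ σ' rSd = 1 := by
  refine .ite (fun _ => .of_wp ?_) fun h => absurd hv (by simp at h ⊢; omega)
  simp [Cmd.wp, h1]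
  exact (word_le _).trans hn

/-- In units of `1 / (s * w(v))` the radius `(p / s) / w(v)` is the integer `p`, so the climb needs
no fractions. The hypothesis `hpos` says that the ball does not reach the root. -/
theorem runs_locate (hn : n ≤ W) (hdep : ∀ v, L.depth v ≤ W) {v : Fin n} {p s : ℕ}
    (hpos : p < L.depth v * (s * T.weight v)) (hpW : p ≤ W) (hsW : s * T.weight v ≤ W)
    {σ : ℕ → ℕ} (hv : σ rTv = word v) (hd : σ rTdep = L.depth v) (hp : σ rP = p) (hs : σ rS = s) :
    Runs L.memory W locate σ n fun σ' => ∃ a, L.Desc v a ∧ a ≠ L.root ∧ σ' rX = word a ∧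
      σ' rDepX = L.depth a ∧ σ' rSd = s * T.weight v ∧ σ' rDx < L.len a * (s * T.weight v) ∧
      σ' rDx + s * T.weight v * T.vdist a v = p := by
  have hv' : σ 14 = word v := hv
  have hd' : σ 15 = L.depth v := hd
  have hp' : σ 10 = p := hp
  have hs' : σ 11 = s := hs
  set sd := s * T.weight v with hsd
  let J : ℕ → (ℕ → ℕ) → Prop := fun k σ => ∃ a, L.Desc v a ∧ σ rX = word a ∧
    σ rDepX = L.depth a ∧ σ rSd = sd ∧ σ rDx + sd * T.vdist a v = p ∧ k = L.hop a
  have h1 : Runs L.memory W (.set rX (.reg rTv) ;; .set rDepX (.reg rTdep) ;; .set rDx (.reg rP) ;;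
        .set rSd (.reg rS * .weight (.reg rTv))) σ 0 (J (L.hop v)) := by
    refine .of_wp ?_
    simp [Cmd.wp, hv', hd', hp', hs', ← hsd, hsW, hpW, hdep]
    exact ⟨(word_le v).trans hn, v, .rfl, by simp, by simp, by simp, by simp, rfl⟩
  refine .ite (fun h => ?_) fun _ => (h1.seq fun σ₁ hJ => Runs.loop (I := J) ?_ hJ).mono
    (by have := hop_lt (L := L) v; omega) ?_
  · simp only [WExpr.eval_reg, WExpr.eval_lit, hv] at h
    exact absurd (word_pos v) (by omega)
  · rintro k σ ⟨a, ha, hX, hDX, hS, hDx, rfl⟩ hlt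
    have hX' : σ 4 = word a := hX
    have hDX' : σ 6 = L.depth a := hDX
    have hS' : σ 9 = sd := hS
    simp [hX', hS'] at hlt
    have hda := depth_of_desc ha
    -- At the root the loop condition would hold forever, because the length stored there is 0; `p`
    -- is too small for the climb to get that far.
    have hne : a ≠ L.root := by
      rintro rfl
      rw [depth_root] at hda
      rw [show L.depth v = T.vdist L.root v by omega, mul_comm] at hpos
      omega
    obtain ⟨q, hq⟩ := exists_parent hne
    have hdq := depth_parent hq
    have hdw := hdep a
    have hvq := vdist_parent_of_desc hq ha
    have hhop := hop_parent hq
    simp only [rDx] at hDx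
    refine ⟨0, L.hop q, by omega, .of_wp ?_⟩
    simp [Cmd.wp, hX', hDX', hS', hq, vertexWord_some]
    refine ⟨by omega, by omega, (word_le q).trans hn, q, ha.trans (.of_parent hq), by simp, ?_,
      by simpa using hS', ?_, rfl⟩
    · simp; omega
    · simp [hvq]
      rw [mul_add, mul_comm sd (L.len a)]
      omega
  · rintro σ' ⟨⟨k, a, ha, hX, hDX, hS, hDx, rfl⟩, hlt⟩
    have hX' : σ' 4 = word a := hX
    have hS' : σ' 9 = sd := hS
    simp [hX', hS'] at hlt
    refine ⟨a, ha, ?_, hX, hDX, hS, by simp only [rDx]; omega, hDx⟩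
    rintro rfl
    simp [len_root] at hlt

/-! ### The value of a pair of vertices -/

@[simp] abbrev rE : ℕ := 46
@[simp] abbrev rEd : ℕ := 47
@[simp] abbrev rF : ℕ := 48
@[simp] abbrev rFd : ℕ := 49
@[simp] abbrev rI : ℕ := 33
@[simp] abbrev rJ : ℕ := 34
@[simp] abbrev rDi : ℕ := 35
@[simp] abbrev rDj : ℕ := 36
@[simp] abbrev rCn : ℕ := 37
@[simp] abbrev rCd : ℕ := 38

/-- Climb from `rI` and `rJ` to their lowest common ancestor. -/
def meet : Cmd TreeQuery :=
  (.set rI (.reg rE) ;; .set rJ (.reg rF) ;; .set rDi (.reg rEd) ;; .set rDj (.reg rFd)) ;;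
    .loop (.lit 0) ((.reg rI - .reg rJ) + (.reg rJ - .reg rI))
      (.ite (.reg rDj) (.reg rDi)
        (.set rDi (.reg rDi - .len (.reg rI)) ;; .set rI (.parent (.reg rI)))
        (.set rDj (.reg rDj - .len (.reg rJ)) ;; .set rJ (.parent (.reg rJ))))

/-- The least value at which the balls of `rE` and `rF` meet, as a quotient. -/
def pairValue : Cmd TreeQuery :=
  meet ;; .set rCn (((.reg rEd - .reg rDi) + (.reg rFd - .reg rDi)) *
      (.weight (.reg rE) * .weight (.reg rF))) ;;
    .set rCd (.weight (.reg rE) + .weight (.reg rF))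

/-- Edge lengths are positive, so of two different vertices one that is at least as deep as the
other is not an ancestor of it. Replacing it by its parent shortens the remaining distance by
exactly the edge climbed. -/
theorem runs_meet (hn : n ≤ W) (hdep : ∀ v, L.depth v ≤ W) {u v : Fin n} {σ : ℕ → ℕ}
    (hE : σ rE = word u) (hEd : σ rEd = L.depth u) (hF : σ rF = word v) (hFd : σ rFd = L.depth v) :
    Runs L.memory W meet σ (2 * n) fun σ' =>
      (L.depth u - σ' rDi) + (L.depth v - σ' rDi) = T.vdist u v := by
  have hE' : σ 46 = word u := hE
  have hEd' : σ 47 = L.depth u := hEd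
  have hF' : σ 48 = word v := hF
  have hFd' : σ 49 = L.depth v := hFd
  let J : ℕ → (ℕ → ℕ) → Prop := fun k σ => ∃ i j, σ rI = word i ∧ σ rJ = word j ∧
    σ rDi = L.depth i ∧ σ rDj = L.depth j ∧ L.depth i ≤ L.depth u ∧ L.depth j ≤ L.depth v ∧
    (L.depth u - L.depth i) + T.vdist i j + (L.depth v - L.depth j) = T.vdist u v ∧
    k = L.hop i + L.hop j
  have h1 : Runs L.memory W
      (.set rI (.reg rE) ;; .set rJ (.reg rF) ;; .set rDi (.reg rEd) ;; .set rDj (.reg rFd)) σ 0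
      (J (L.hop u + L.hop v)) := by
    refine .of_wp ?_
    simp [Cmd.wp, hE', hEd', hF', hFd', hdep]
    exact ⟨(word_le u).trans hn, (word_le v).trans hn, u, v, by simp, by simp, by simp, by simp,
      le_rfl, le_rfl, by simp, rfl⟩
  refine (h1.seq fun σ₁ hJ => Runs.loop (I := J) ?_ hJ).mono ?_ ?_
  · rintro k σ ⟨i, j, hi, hj, hdi, hdj, hiu, hjv, heq, rfl⟩ hlt
    have hi' : σ 33 = word i := hi
    have hj' : σ 34 = word j := hj
    have hdi' : σ 35 = L.depth i := hdi
    have hdj' : σ 36 = L.depth j := hdj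
    have hne : i ≠ j := by
      rintro rfl
      simp [hi', hj'] at hlt
    have hWi := hdep i
    have hWj := hdep j
    by_cases hlt : L.depth j < L.depth i
    · have hir : i ≠ L.root := by rintro rfl; simp at hlt
      obtain ⟨q, hq⟩ := exists_parent hir
      have h1 := depth_parent hq
      have h2 := hop_parent hq
      have hji : ¬ L.Desc j i := fun h => by have := depth_of_desc h; omega
      have h3 := vdist_of_not_desc hq hji
      refine ⟨0, L.hop q + L.hop j, by omega, .of_wp ?_⟩
      simp [Cmd.wp, hi', hdi', hdj', hq, vertexWord_some, hlt]
      refine ⟨by omega, (word_le q).trans hn, q, j, by simp, by simpa using hj', ?_,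
        by simpa using hdj', by omega, hjv, by omega, rfl⟩
      simp; omega
    · have hij : ¬ L.Desc i j := fun h => hlt (h.depth_lt hne)
      have hjr : j ≠ L.root := by rintro rfl; exact hij (desc_root i)
      obtain ⟨q, hq⟩ := exists_parent hjr
      have h1 := depth_parent hq
      have h2 := hop_parent hq
      have h3 := vdist_of_not_desc hq hij
      rw [T.vdist_comm j, T.vdist_comm q] at h3
      refine ⟨0, L.hop i + L.hop q, by omega, .of_wp ?_⟩
      simp [Cmd.wp, hj', hdi', hdj', hq, vertexWord_some, hlt]
      refine ⟨by omega, (word_le q).trans hn, i, q, by simpa using hi', by simp,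
        by simpa using hdi', ?_, hiu, by omega, by omega, rfl⟩
      simp; omega
  · have := hop_lt (L := L) u
    have := hop_lt (L := L) v
    omega
  · rintro σ' ⟨⟨k, i, j, hi, hj, hdi, hdj, hiu, hjv, heq, rfl⟩, hlt⟩
    simp only [WExpr.eval_lit, WExpr.eval_add, WExpr.eval_sub, WExpr.eval_reg, hi, hj] at hlt
    have hij : i = j := word_inj.1 (by omega)
    subst hij
    rw [hdi]
    simpa using heq

theorem runs_pairValue (hn : n ≤ W) (hdep : ∀ v, L.depth v ≤ W) {u v : Fin n}
    (hW : T.vdist u v * (T.weight u * T.weight v) ≤ W) (hW' : T.weight u + T.weight v ≤ W)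
    {σ : ℕ → ℕ} (hE : σ rE = word u) (hEd : σ rEd = L.depth u) (hF : σ rF = word v)
    (hFd : σ rFd = L.depth v) :
    Runs L.memory W pairValue σ (2 * n) fun σ' =>
      σ' rCn = T.vdist u v * (T.weight u * T.weight v) ∧ σ' rCd = T.weight u + T.weight v := by
  refine ((runs_meet hn hdep hE hEd hF hFd).frame.seq (t' := 0) fun σ₁ ⟨h, hf⟩ => .of_wp ?_).mono
    (by simp) fun _ h => h
  have hfr : ∀ i, 40 ≤ i → σ₁ i = σ i := fun i hi => hf i (by
    simp only [meet, Cmd.Writes, rI, rJ, rDi, rDj]; omega)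
  have hE' : σ₁ 46 = word u := (hfr _ (by simp)).trans hE
  have hEd' : σ₁ 47 = L.depth u := (hfr _ (by simp)).trans hEd
  have hF' : σ₁ 48 = word v := (hfr _ (by simp)).trans hF
  have hFd' : σ₁ 49 = L.depth v := (hfr _ (by simp)).trans hFd
  simp only [rDi] at h
  simp [Cmd.wp, hE', hEd', hF', hFd', h, hW, hW']

end

/-! ### Points of the tree, balls, and the greedy choice -/

section

variable {n : ℕ} {T : WeightedTree n} {L : T.Layout}

variable (L) in
open Classical in
/-- The distance to `v` from the point at distance `t` above `a`. -/
noncomputable def pdist (a : Fin n) (t : ℝ) (v : Fin n) : ℝ :=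
  if L.Desc v a then t + T.vdist a v else T.vdist a v - t

theorem len_le_vdist {a v : Fin n} (hv : ¬ L.Desc v a) : L.len a ≤ T.vdist a v := by
  have hne : a ≠ L.root := by rintro rfl; exact hv (desc_root v)
  obtain ⟨p, hp⟩ := exists_parent hne
  rw [vdist_of_not_desc hp hv]
  omega

theorem cast_scaledDist {a : Fin n} {sn sd : ℕ} (hsd : 0 < sd) (h : sn ≤ L.len a * sd)
    (v : Fin n) : (scaledDist L a sn sd v : ℝ) = sd * pdist L a (sn / sd) v := by
  have hsd' : (sd : ℝ) ≠ 0 := by positivity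
  unfold scaledDist pdist
  split_ifs with hv
  · push_cast
    field_simp
  · rw [Nat.cast_add, Nat.cast_sub h, Nat.cast_mul, Nat.cast_mul, Nat.cast_sub (len_le_vdist hv)]
    field_simp
    ring

theorem pdist_triangle {b : Fin n} {t : ℝ} (h0 : 0 ≤ t) (h1 : t ≤ L.len b) (z v : Fin n) :
    pdist L b t v ≤ pdist L b t z + T.vdist z v := by
  have htri : (T.vdist b v : ℝ) ≤ T.vdist b z + T.vdist z v := by
    exact_mod_cast T.vdist_triangle b z v
  unfold pdist
  split_ifs with hv hz hz
  · linarith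
  · have h2 : (L.len b : ℝ) ≤ T.vdist b z := by exact_mod_cast len_le_vdist hz
    have h3 : (T.vdist z v : ℝ) = T.vdist b z + T.vdist b v := by
      rw [T.vdist_comm b z]; exact_mod_cast vdist_into (.inl hz) hv
    linarith
  · linarith
  · linarith

/-- If the top of the ball of `v₁` is at least as deep as the top of the ball of `v`, and the
ball of `v` does not contain it, then the two balls are disjoint. -/
theorem greedy_disjoint {a v₁ v : Fin n} {t r : ℝ} (h1 : L.Desc v₁ a) (hw1 : 0 < T.weight v₁)
    (htop : T.weight v₁ * (t + T.vdist a v₁) = r)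
    (hdeep : (L.depth v * T.weight v - r) * T.weight v₁ ≤
      (L.depth v₁ * T.weight v₁ - r) * T.weight v)
    (hv : r < T.weight v * pdist L a t v) :
    ¬ L.Desc v a ∧ r * (T.weight v₁ + T.weight v) <
      T.vdist v₁ v * (T.weight v₁ * T.weight v) := by
  have hw1' : (0 : ℝ) < T.weight v₁ := by exact_mod_cast hw1
  have hd1 : (L.depth v₁ : ℝ) = L.depth a + T.vdist a v₁ := by exact_mod_cast depth_of_desc h1
  -- Were `v` below `a`, the top of its ball, being no deeper than the chosen point, would lie at
  -- that point or above it, and the ball would contain the point.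
  have hva : ¬ L.Desc v a := by
    intro hva
    have hd : (L.depth v : ℝ) = L.depth a + T.vdist a v := by exact_mod_cast depth_of_desc hva
    rw [pdist, if_pos hva] at hv
    rw [hd1, hd] at hdeep
    have : T.weight v₁ * (T.weight v * (t + T.vdist a v)) ≤ T.weight v₁ * r := by
      nlinarith [htop]
    have := le_of_mul_le_mul_left this hw1'
    linarith
  refine ⟨hva, ?_⟩
  rw [pdist, if_neg hva] at hv
  -- The path from `v₁` to `v` leaves the subtree of `a` upwards and so passes through the point: it
  -- is a radius of the ball of `v₁` followed by more than a radius of the ball of `v`.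
  have h2 : (T.vdist v₁ v : ℝ) = T.vdist a v + T.vdist a v₁ := by
    rw [T.vdist_comm v₁, T.vdist_comm a v]; exact_mod_cast vdist_into (.inl hva) h1
  rw [h2]
  nlinarith

/-- Let the subtree of `q`, with parent `x`, contain the point above `a`, let `u` below `x` be
too far from this point, and let the point above `b`, which is not deeper and not below `q`, be
close to `u`. Then outside the subtree of `q` the second point covers all that the first does. -/
theorem covered_of_covered {a b q x u v : Fin n} {t t' r : ℝ} (hq : L.parent q = some x)
    (haq : L.Desc a q) (hux : L.Desc u x) (huq : ¬ L.Desc u q)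
    (hr : 0 ≤ r) (hu : r < T.weight u * pdist L a t u) (h0 : 0 ≤ t') (h1 : t' ≤ L.len b)
    (hdeep : L.depth b - t' ≤ L.depth a - t)
    (hub : T.weight u * pdist L b t' u ≤ r) (hvq : ¬ L.Desc v q)
    (hv : T.weight v * pdist L a t v ≤ r) : T.weight v * pdist L b t' v ≤ r := by
  have hax : L.Desc a x := haq.trans (.of_parent hq)
  have hdax : (T.vdist a x : ℝ) = L.depth a - L.depth x := by
    have := depth_of_desc hax
    rw [T.vdist_comm a x, this]
    push_cast; ring
  -- From the first point, everything outside the subtree of `q` is reached through `x`. It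
  -- therefore suffices that the second point is not farther from `x` than the first.
  have hout : ∀ z, ¬ L.Desc z q → pdist L a t z = L.depth a - L.depth x - t + T.vdist x z := by
    intro z hz
    have h2 : (T.vdist a z : ℝ) = T.vdist a x + T.vdist x z := by
      exact_mod_cast vdist_via_parent hq haq hz
    rw [pdist, if_neg fun h => hz (h.trans haq), h2, hdax]
    ring
  have hwu : (0 : ℝ) < T.weight u := by
    rcases (Nat.cast_nonneg (T.weight u) : (0 : ℝ) ≤ T.weight u).eq_or_lt with h | h
    · rw [← h] at hu; linarith
    · exact h
  suffices hsuff : pdist L b t' v ≤ pdist L a t v from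
    (mul_le_mul_of_nonneg_left hsuff (Nat.cast_nonneg _)).trans hv
  rw [hout v hvq]
  rw [hout u huq] at hu
  -- If `b` is strictly below `x`, both points lie below `x` (possibly at `x`), and the one that is
  -- not deeper is not farther from `x`.
  by_cases hb : L.Desc b x ∧ b ≠ x
  · obtain ⟨hbx, hne⟩ := hb
    have hdb : (L.depth b : ℝ) = L.depth x + T.vdist x b := by exact_mod_cast depth_of_desc hbx
    have hlen : (L.len b : ℝ) ≤ L.depth b - L.depth x := by
      rcases hbx.eq_or_parent with h | ⟨p, hp, h⟩
      · exact absurd h hne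
      · have h3 := depth_parent hp
        have h4 := depth_of_desc h
        rw [h3, h4]
        push_cast
        linarith [(Nat.cast_nonneg (T.vdist x p) : (0 : ℝ) ≤ T.vdist x p)]
    unfold pdist
    split_ifs with hvb
    · have h3 : (T.vdist x v : ℝ) = T.vdist x b + T.vdist b v := by
        exact_mod_cast vdist_into (.inl fun h => hne (hbx.antisymm h.hop_le)) hvb
      linarith
    · have h3 : (T.vdist b v : ℝ) ≤ T.vdist x b + T.vdist x v := by
        rw [T.vdist_comm x b]; exact_mod_cast T.vdist_triangle b x v
      linarith
  · have hb' : ¬ L.Desc b x ∨ b = x := by tauto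
    -- Otherwise the path from the second point to `u` passes through `x`. As the second point
    -- covers `u` and the first does not, the second is nearer to `u` and hence to `x`.
    have hbu : pdist L b t' u = pdist L b t' x + T.vdist x u := by
      have h3 : (T.vdist b u : ℝ) = T.vdist b x + T.vdist x u := by
        exact_mod_cast vdist_into hb' hux
      unfold pdist
      by_cases hxb : L.Desc x b
      · rw [if_pos (hux.trans hxb), if_pos hxb, h3]; ring
      · have hub : ¬ L.Desc u b := by
          intro hub
          rcases hub.total hux with h | h
          · rcases hb' with hb' | rfl
            exacts [hb' h, hxb h]
          · exact hxb h
        rw [if_neg hub, if_neg hxb, h3]; ring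
    have h4 := lt_of_mul_lt_mul_left (hub.trans_lt hu) hwu.le
    have h5 := pdist_triangle h0 h1 x v
    linarith

/-- The point at distance `t` above the vertex `a`, which is not the root. -/
def edgePointAbove (a p : Fin n) (hp : L.parent a = some p) (t : ℝ) (h0 : 0 ≤ t)
    (h1 : t ≤ L.len a) : T.EdgePoint where
  u := a
  v := p
  adj := (adj_of_parent hp).symm
  offset := t
  offset_nonneg := h0
  offset_le := by rwa [← len_of_parent hp]

theorem dist_edgePointAbove {a p : Fin n} (hp : L.parent a = some p) {t : ℝ} (h0 : 0 ≤ t)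
    (h1 : t ≤ L.len a) (v : Fin n) : (edgePointAbove a p hp t h0 h1).dist v = pdist L a t v := by
  simp only [EdgePoint.dist, edgePointAbove, ← len_of_parent hp, pdist]
  split_ifs with hv
  · have h2 : (T.vdist p v : ℝ) = L.len a + T.vdist a v := by
      exact_mod_cast vdist_parent_of_desc hp hv
    rw [h2]
    exact min_eq_left (by linarith)
  · have h2 : (T.vdist a v : ℝ) = L.len a + T.vdist p v := by
      exact_mod_cast vdist_of_not_desc hp hv
    rw [h2, min_eq_right (by linarith)]
    ring

/-! ### The cost of a set of points -/

theorem vdist_le_dist_add_dist (α : T.Point) (u v : Fin n) :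
    (T.vdist u v : ℝ) ≤ α.dist u + α.dist v := by
  induction α using Quotient.ind with
  | _ e =>
    change (T.vdist u v : ℝ) ≤ e.dist u + e.dist v
    have htri : ∀ x, (T.vdist u v : ℝ) ≤ T.vdist x u + T.vdist x v := fun x => by
      rw [T.vdist_comm x u]; exact_mod_cast T.vdist_triangle u x v
    have hl : (T.vdist e.u e.v : ℝ) ≤ T.length s(e.u, e.v) := by
      exact_mod_cast T.vdist_le_length e.adj
    have h1 : (T.vdist u v : ℝ) ≤ T.vdist e.u u + T.vdist e.u e.v + T.vdist e.v v := by
      rw [T.vdist_comm e.u u]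
      exact_mod_cast (T.vdist_triangle u e.v v).trans
        (Nat.add_le_add_right (T.vdist_triangle u e.u e.v) _)
    have h2 : (T.vdist u v : ℝ) ≤ T.vdist e.v u + T.vdist e.u e.v + T.vdist e.u v := by
      rw [T.vdist_comm e.v u, T.vdist_comm e.u e.v]
      exact_mod_cast (T.vdist_triangle u e.u v).trans
        (Nat.add_le_add_right (T.vdist_triangle u e.v e.u) _)
    have h3 := htri e.u
    have h4 := htri e.v
    have h5 := e.offset_nonneg
    have h6 := e.offset_le
    unfold EdgePoint.dist
    rcases min_cases (e.offset + T.vdist e.u u)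
      ((T.length s(e.u, e.v) - e.offset) + T.vdist e.v u) with ⟨h, -⟩ | ⟨h, -⟩ <;>
    rcases min_cases (e.offset + T.vdist e.u v)
      ((T.length s(e.u, e.v) - e.offset) + T.vdist e.v v) with ⟨h', -⟩ | ⟨h', -⟩ <;>
    rw [h, h'] <;> linarith

theorem exists_dist_le_cost {X : Finset T.Point} (hX : X.Nonempty) (v : Fin n) :
    ∃ α ∈ X, α.dist v * T.weight v ≤ T.cost X := by
  have : Nonempty X := hX.to_subtype
  obtain ⟨α, hα⟩ := exists_eq_ciInf_of_finite (f := fun α : X => α.1.dist v)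
  refine ⟨α.1, α.2, ?_⟩
  have := le_ciSup (f := fun v : Fin n => (⨅ α : X, α.1.dist v) * (T.weight v : ℝ))
    (Set.finite_range _).bddAbove v
  simp only [← hα] at this
  exact this

/-- The balls of radius `f / weight` of two vertices have at most one point in common. -/
def Apart (T : WeightedTree n) (f : ℝ) (u v : Fin n) : Prop :=
  0 < T.weight u ∧ f * (T.weight u + T.weight v) ≤ T.vdist u v * (T.weight u * T.weight v)

/-- A point within `c / w(u)` of `u` and within `c / w(v)` of `v` forces `d(u,v) ≤ c / w(u) + c /
w(v)`. Everything is multiplied out so that the weight of `v` may vanish. -/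
theorem Apart.le {f c : ℝ} {u v : Fin n} (h : Apart T f u v) {α : T.Point}
    (hu : α.dist u * T.weight u ≤ c) (hv : α.dist v * T.weight v ≤ c) : f ≤ c := by
  obtain ⟨hw, h⟩ := h
  have hw' : (0 : ℝ) < T.weight u := by exact_mod_cast hw
  have hv' : (0 : ℝ) ≤ T.weight v := Nat.cast_nonneg _
  have h1 := mul_le_mul_of_nonneg_right (vdist_le_dist_add_dist α u v)
    (mul_nonneg hw'.le hv')
  have h2 : f * (T.weight u + T.weight v) ≤ c * (T.weight u + T.weight v) := by
    nlinarith [mul_le_mul_of_nonneg_right hu hv', mul_le_mul_of_nonneg_right hv hw'.le]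
  exact le_of_mul_le_mul_right h2 (by positivity)

/-- Pigeonhole: with two points, two of the three vertices are served by the same one. -/
theorem le_cost_of_apart {f : ℝ} {u v w : Fin n} (h1 : Apart T f u v) (h2 : Apart T f u w)
    (h3 : Apart T f v w) {X : Finset T.Point} (hX : X.card = 2) : f ≤ T.cost X := by
  have hne : X.Nonempty := Finset.card_pos.1 (by omega)
  obtain ⟨α, hα, ha⟩ := exists_dist_le_cost hne u
  obtain ⟨β, hβ, hb⟩ := exists_dist_le_cost hne v
  obtain ⟨γ, hγ, hc⟩ := exists_dist_le_cost hne w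
  by_cases hab : α = β
  · subst hab; exact h1.le ha hb
  by_cases hac : α = γ
  · subst hac; exact h2.le ha hc
  by_cases hbc : β = γ
  · subst hbc; exact h3.le hb hc
  have hle : ({α, β, γ} : Set T.Point).ncard ≤ (X : Set T.Point).ncard :=
    Set.ncard_le_ncard (by
      rintro x (rfl | rfl | rfl)
      exacts [hα, hβ, hγ]) X.finite_toSet
  rw [Set.ncard_coe_finset, hX, Set.ncard_eq_three.2 ⟨α, β, γ, hab, hac, hbc, rfl⟩] at hle
  omega

theorem cost_le_of_covered {r : ℝ} (hn : 0 < n) {X : Finset T.Point} {α β : T.Point}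
    (hα : α ∈ X) (hβ : β ∈ X)
    (h : ∀ v, T.weight v * α.dist v ≤ r ∨ T.weight v * β.dist v ≤ r) : T.cost X ≤ r := by
  have : Nonempty (Fin n) := ⟨⟨0, hn⟩⟩
  refine ciSup_le fun v => ?_
  have hle : ∀ γ ∈ X, (⨅ α : X, α.1.dist v) ≤ γ.dist v := fun γ hγ =>
    ciInf_le (f := fun α : X => α.1.dist v) (Set.finite_range _).bddBelow ⟨γ, hγ⟩
  rcases h v with h | h
  · exact (mul_le_mul_of_nonneg_right (hle α hα) (Nat.cast_nonneg _)).trans (by linarith)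
  · exact (mul_le_mul_of_nonneg_right (hle β hβ) (Nat.cast_nonneg _)).trans (by linarith)

end

/-! ### Testing a value: the first point -/

/-- The first vertex that is not covered by the first point, and where the climb was then. -/
@[simp] abbrev rU : ℕ := 16
@[simp] abbrev rQs : ℕ := 17
@[simp] abbrev rV3 : ℕ := 18
@[simp] abbrev rDep3 : ℕ := 19
/-- The two points. -/
@[simp] abbrev rA : ℕ := 20
@[simp] abbrev rAn : ℕ := 21
@[simp] abbrev rAd : ℕ := 22
@[simp] abbrev rB : ℕ := 23
@[simp] abbrev rBn : ℕ := 24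
@[simp] abbrev rBd : ℕ := 25
/-- Three vertices that need three points. -/
@[simp] abbrev rV1 : ℕ := 26
@[simp] abbrev rDep1 : ℕ := 27
@[simp] abbrev rV2 : ℕ := 28
@[simp] abbrev rDep2 : ℕ := 29
/-- The result of the test, and a lower bound for all costs if it fails. -/
@[simp] abbrev rFail : ℕ := 30
@[simp] abbrev rNp : ℕ := 31
@[simp] abbrev rNd : ℕ := 32

/-- Update the vertex whose ball has the deepest top. -/
def best : Cmd TreeQuery :=
  .ite (.reg rTn * .weight (.reg rV))
    ((.reg rDep * .weight (.reg rV) * .reg rS - .reg rP) * .reg rTd)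
    (.set rTn (.reg rDep * .weight (.reg rV) * .reg rS - .reg rP) ;;
      .set rTd (.weight (.reg rV)) ;; .set rTv (.reg rV) ;; .set rTdep (.reg rDep)) .skip

def resetBest : Cmd TreeQuery :=
  .set rTn (.lit 0) ;; .set rTd (.lit 1) ;; .set rTv (.lit 0) ;; .set rTdep (.lit 0)

def firstPoint : Cmd TreeQuery :=
  (resetBest ;; .set rX .root ;; .set rY (.lit 0) ;; .set rQ (.lit 0) ;; .set rDep (.lit 0)) ;;
    tour best ;; (.set rV1 (.reg rTv) ;; .set rDep1 (.reg rTdep)) ;; locate ;;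
    .set rA (.reg rX) ;; .set rAn (.reg rDx) ;; .set rAd (.reg rSd)

/-! ### Word bounds, and the choice of the ball with the deepest top -/

section

variable {n : ℕ} {T : WeightedTree n} {L : T.Layout} {W N P p s : ℕ}

/-- Bounds for the words of the input and for the tested value. -/
structure Bounds (L : T.Layout) (W N P : ℕ) : Prop where
  two_le : 2 ≤ n
  n_le : n ≤ N
  weight_le : ∀ v, T.weight v ≤ N
  depth_le : ∀ v, L.depth v ≤ N
  one_le : 1 ≤ P
  le_W : 3 * (N * N * N * P) ≤ W

theorem Bounds.le_of_le (h : Bounds L W N P) {x : ℕ} (hx : x ≤ N * N * P) : 3 * (N * x) ≤ W := by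
  refine le_trans ?_ h.le_W
  have := Nat.mul_le_mul_left N hx
  linarith

theorem Bounds.one_le_N (h : Bounds L W N P) : 1 ≤ N := by
  have := h.two_le
  have := h.n_le
  omega

theorem Bounds.mul_le (h : Bounds L W N P) {x : ℕ} (hx : x ≤ N * N * P) : x ≤ W := by
  have h1 := h.le_of_le hx
  have h2 := Nat.mul_le_mul_right x h.one_le_N
  omega

theorem Bounds.P_le (h : Bounds L W N P) : P ≤ N * N * P := by
  have := Nat.mul_le_mul_right P (Nat.mul_le_mul h.one_le_N h.one_le_N)
  omega

theorem Bounds.NP_le (h : Bounds L W N P) : N * P ≤ N * N * P := by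
  have := Nat.mul_le_mul_right (N * P) h.one_le_N
  rw [one_mul, ← mul_assoc] at this
  exact this

theorem Bounds.N_le (h : Bounds L W N P) : N ≤ N * N * P := by
  have := Nat.mul_le_mul_left N h.one_le
  have := h.NP_le
  omega

theorem Bounds.depth_le_W (h : Bounds L W N P) (v : Fin n) : L.depth v ≤ W :=
  h.mul_le ((h.depth_le v).trans h.N_le)

theorem Bounds.weight_le_W (h : Bounds L W N P) (v : Fin n) : T.weight v ≤ W :=
  h.mul_le ((h.weight_le v).trans h.N_le)

theorem Bounds.n_le_W (h : Bounds L W N P) : n ≤ W := h.mul_le (h.n_le.trans h.N_le)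

theorem Bounds.one_le_W (h : Bounds L W N P) : 1 ≤ W := h.mul_le (h.one_le_N.trans h.N_le)

theorem Bounds.vdist_le (h : Bounds L W N P) (u v : Fin n) : T.vdist u v ≤ 2 * N := by
  have h1 := T.vdist_triangle u L.root v
  rw [T.vdist_comm u L.root] at h1
  have h2 := h.depth_le u
  have h3 := h.depth_le v
  unfold depth at h2 h3
  omega

variable (L p s) in
/-- Among the vertices of `S`, the ball of the vertex `o` has the deepest top, at depth
`tn / (td * s)`; there is no such vertex if all balls contain the root. -/
structure IsBest (S : Finset (Fin n)) (o : Option (Fin n)) (tn td : ℕ) : Prop where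
  none : o = none → tn = 0 ∧ td = 1
  some : ∀ v ∈ o, v ∈ S ∧ tn = L.depth v * T.weight v * s - p ∧ 0 < tn ∧ td = T.weight v
  le : ∀ v ∈ S, (L.depth v * T.weight v * s - p) * td ≤ tn * T.weight v

variable (L p s) in
def Best (S : Finset (Fin n)) (σ : ℕ → ℕ) : Prop :=
  ∃ o, σ rTv = vertexWord o ∧ σ rTdep = o.elim 0 L.depth ∧ IsBest L p s S o (σ rTn) (σ rTd)

theorem IsBest.weight_pos {S : Finset (Fin n)} {o : Option (Fin n)} {tn td : ℕ}
    (h : IsBest L p s S o tn td) {v : Fin n} (hv : v ∈ o) : 0 < T.weight v := by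
  obtain ⟨-, h1, h2, -⟩ := h.some v hv
  by_contra h0
  simp [Nat.eq_zero_of_not_pos h0] at h1
  omega

theorem IsBest.td_pos {S : Finset (Fin n)} {o : Option (Fin n)} {tn td : ℕ}
    (h : IsBest L p s S o tn td) : 0 < td := by
  cases ho : o with
  | none => have := (h.none ho).2; omega
  | some v => have := h.weight_pos ho; have := (h.some v ho).2.2.2; omega

theorem Best.congr {S : Finset (Fin n)} {σ σ' : ℕ → ℕ} (h : Best L p s S σ)
    (hσ : ∀ i, 12 ≤ i → i < 16 → σ' i = σ i) : Best L p s S σ' := by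
  obtain ⟨o, h1, h2, h3⟩ := h
  refine ⟨o, (hσ _ (by simp) (by simp)).trans h1, (hσ _ (by simp) (by simp)).trans h2, ?_⟩
  rwa [hσ rTn (by simp) (by simp), hσ rTd (by simp) (by simp)]

theorem runs_best (hb : Bounds L W N P) (hs : s ≤ P) {S : Finset (Fin n)} {u : Fin n} {σ : ℕ → ℕ}
    (hV : σ rV = word u) (hD : σ rDep = L.depth u) (hP : σ rP = p) (hS : σ rS = s)
    (h : Best L p s S σ) : Runs L.memory W best σ 0 (Best L p s (insert u S)) := by
  have hV' : σ 0 = word u := hV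
  have hD' : σ 2 = L.depth u := hD
  have hP' : σ 10 = p := hP
  have hS' : σ 11 = s := hS
  obtain ⟨o, h1, h2, h3⟩ := h
  simp only [rTv, rTdep, rTn, rTd] at h1 h2 h3
  have hle : L.depth u * T.weight u * s - p ≤ W := by
    refine hb.mul_le ((Nat.sub_le _ _).trans ?_)
    exact Nat.mul_le_mul (Nat.mul_le_mul (hb.depth_le u) (hb.weight_le u)) hs
  refine .of_wp ?_
  simp only [Cmd.wp, best, WExpr.eval_mul, WExpr.eval_sub, WExpr.eval_query, WExpr.eval_reg,
    WExpr.eval_lit, rV, rDep, rP, rS, rTn, rTd, rTv, rTdep, hV', hD', hP', hS', memory_weight]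
  constructor
  · intro hlt
    simp [hV', hD', hle, hb.weight_le_W, hb.depth_le_W]
    refine ⟨(word_le u).trans hb.n_le_W, some u, rfl, rfl, ?_⟩
    -- The comparison in `best` is strict, so an accepted vertex has a positive truncated
    -- difference: its weight is positive and its ball misses the root.
    have hpos : 0 < L.depth u * T.weight u * s - p := by
      by_contra h0
      rw [Nat.eq_zero_of_not_pos h0] at hlt
      omega
    refine ⟨by simp, ?_, ?_⟩
    · rintro v hv
      obtain rfl : u = v := by simpa using hv
      exact ⟨Finset.mem_insert_self _ _, rfl, hpos, rfl⟩
    · intro v hv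
      change (L.depth v * T.weight v * s - p) * T.weight u ≤
        (L.depth u * T.weight u * s - p) * T.weight v
      rcases Finset.mem_insert.1 hv with rfl | hv
      · exact le_rfl
      · have h4 := h3.le v hv
        have h5 := h3.td_pos
        -- Comparing quotients by cross-multiplication is transitive because the denominator in the
        -- middle is positive.
        refine le_of_mul_le_mul_right ?_ h5
        calc (L.depth v * T.weight v * s - p) * T.weight u * σ 13
            = (L.depth v * T.weight v * s - p) * σ 13 * T.weight u := by ring
          _ ≤ σ 12 * T.weight v * T.weight u := Nat.mul_le_mul_right _ h4
          _ = σ 12 * T.weight u * T.weight v := by ring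
          _ ≤ (L.depth u * T.weight u * s - p) * σ 13 * T.weight v :=
            Nat.mul_le_mul_right _ hlt.le
          _ = _ := by ring
  · intro hlt
    refine ⟨o, h1, h2, h3.none, fun v hv => ?_, fun v hv => ?_⟩
    · obtain ⟨h4, h5⟩ := h3.some v hv
      exact ⟨Finset.mem_insert_of_mem h4, h5⟩
    · rcases Finset.mem_insert.1 hv with rfl | hv
      · exact not_lt.1 hlt
      · exact h3.le v hv

theorem writes_best {i : ℕ} (h : best.Writes i) : 12 ≤ i ∧ i < 16 := by
  simp [best, Cmd.Writes] at h
  omega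

theorem writes_resetBest {i : ℕ} (h : resetBest.Writes i) : 12 ≤ i ∧ i < 16 := by
  simp [resetBest, Cmd.Writes] at h
  omega

theorem writes_tour {visit : Cmd TreeQuery} {i : ℕ} (h : (tour visit).Writes i) :
    i < 4 ∨ visit.Writes i := by
  by_cases hv : visit.Writes i
  · exact .inr hv
  · simp [tour, tourStep, Cmd.Writes, Cmd.writes_ifEq, hv] at h
    omega

theorem writes_climbTour {visit : Cmd TreeQuery} {i : ℕ} (h : (climbTour visit).Writes i) :
    i < 8 ∨ visit.Writes i := by
  simp only [climbTour, climbStep, Cmd.Writes, rY, rX, rDx, rDepX, rDep] at h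
  rcases h with h | h | h | h
  · omega
  · omega
  · rcases writes_tour h with h | h
    · omega
    · exact .inr h
  · omega

theorem writes_locate {i : ℕ} (h : locate.Writes i) : 4 ≤ i ∧ i < 10 := by
  simp [locate, Cmd.Writes] at h
  omega

theorem Bounds.runs_resetBest (hb : Bounds L W N P) (σ : ℕ → ℕ) :
    Runs L.memory W resetBest σ 0 (Best L p s ∅) := by
  refine .of_wp ?_
  simp [Cmd.wp, resetBest, hb.one_le_W]
  exact ⟨none, by simp, by simp, by simp, by simp, by simp⟩

variable (L p s) in
/-- The point at distance `dx / sd` above `a` is the top of the ball of `o`, or the root. -/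
structure Located (o : Option (Fin n)) (a : Fin n) (dx sd : ℕ) : Prop where
  pos : 0 < sd
  le : dx ≤ L.len a * sd
  sd_le : sd ≤ N * P
  none : o = none → a = L.root
  some : ∀ v ∈ o, L.Desc v a ∧ a ≠ L.root ∧ dx < L.len a * sd ∧ sd = s * T.weight v ∧
    dx + sd * T.vdist a v = p

theorem runs_locate_of_best (hb : Bounds L W N P) (hp : p ≤ P) (hs : s ≤ P) (hs0 : 0 < s)
    {S : Finset (Fin n)} {o : Option (Fin n)} {σ : ℕ → ℕ} {tn td : ℕ}
    (h : IsBest L p s S o tn td) (hv : σ rTv = vertexWord o)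
    (hd : σ rTdep = o.elim 0 L.depth) (hP : σ rP = p) (hS : σ rS = s) :
    Runs L.memory W locate σ n fun σ' => ∃ a, σ' rX = word a ∧ σ' rDepX = L.depth a ∧
      Located L (N := N) (P := P) p s o a (σ' rDx) (σ' rSd) := by
  cases ho : o with
  | none =>
    rw [ho] at hv
    refine (runs_locate_root hb.n_le_W hb.one_le_W hv).mono (Nat.zero_le _)
      fun σ' ⟨h1, h2, h3, h4⟩ => ⟨L.root, h1, by rw [h2, depth_root], ?_⟩
    rw [h3, h4]
    refine ⟨one_pos, Nat.zero_le _, ?_, fun _ => rfl, by simp⟩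
    simpa using Nat.mul_le_mul hb.one_le_N hb.one_le
  | some v =>
    obtain ⟨-, h1, h2, h3⟩ := h.some v ho
    have hw := h.weight_pos ho
    have hNP : s * T.weight v ≤ N * P := by
      rw [mul_comm]; exact Nat.mul_le_mul (hb.weight_le v) hs
    rw [ho] at hv hd
    refine (runs_locate hb.n_le_W hb.depth_le_W (v := v) (p := p) (s := s) ?_
      (hb.mul_le (hp.trans hb.P_le)) (hb.mul_le (hNP.trans hb.NP_le)) hv hd hP hS).mono le_rfl
      fun σ' ⟨a, h1, h2, h3, h4, h5, h6, h7⟩ => ⟨a, h3, h4, ?_⟩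
    · rw [mul_comm s, ← mul_assoc]; omega
    · rw [h5]
      refine ⟨Nat.mul_pos hs0 hw, h6.le, hNP, by simp, fun v' hv' => ?_⟩
      obtain rfl : v = v' := by simpa using hv'
      exact ⟨h1, h2, h6, rfl, h7⟩

theorem unbarred_root : unbarred L none none [L.root] = Finset.univ := by
  ext v
  simp [mem_unbarred, Barred, desc_root]

theorem runs_firstPoint (hb : Bounds L W N P) (hp : p ≤ P) (hs : s ≤ P) (hs0 : 0 < s)
    {σ : ℕ → ℕ} (hP : σ rP = p) (hS : σ rS = s) :
    Runs L.memory W firstPoint σ (5 * n) fun σ' => σ' rP = p ∧ σ' rS = s ∧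
      ∃ o a tn td, IsBest L p s Finset.univ o tn td ∧
      Located L (N := N) (P := P) p s o a (σ' rDx) (σ' rSd) ∧ σ' rX = word a ∧
      σ' rDepX = L.depth a ∧ σ' rV1 = vertexWord o ∧ σ' rDep1 = o.elim 0 L.depth ∧
      σ' rA = word a ∧ σ' rAn = σ' rDx ∧ σ' rAd = σ' rSd := by
  let I : Finset (Fin n) → (ℕ → ℕ) → Prop := fun S σ => σ rP = p ∧ σ rS = s ∧ Best L p s S σ
  have hv : Visits L W best L.root none none I := by
    refine ⟨hb.n_le_W, hb.depth_le_W, fun i hi h => ?_, fun S σ σ' hσ ⟨h1, h2, h3⟩ =>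
      ⟨(hσ _ (by simp)).trans h1, (hσ _ (by simp)).trans h2, h3.congr fun i hi _ =>
        hσ i (by omega)⟩, fun u S σ _ _ hV hD _ ⟨h1, h2, h3⟩ => ?_⟩
    · have := writes_best h; omega
    · refine (runs_best hb hs hV hD h1 h2 h3).frame.mono le_rfl fun σ' ⟨h, hf⟩ =>
        ⟨(hf _ ?_).trans h1, (hf _ ?_).trans h2, h⟩ <;>
      · intro h; have := writes_best h; simp at this
  have h1 : Runs L.memory W (resetBest ;; .set rX .root ;; .set rY (.lit 0) ;; .set rQ (.lit 0) ;;
      .set rDep (.lit 0)) σ 0 fun σ' => σ' rX = word L.root ∧ σ' rY = 0 ∧ σ' rQ = 0 ∧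
      σ' rDep = 0 ∧ I ∅ σ' := by
    refine ((hb.runs_resetBest σ (p := p) (s := s)).frame.seq (t' := 0) fun σ₁ ⟨h, hf⟩ =>
      .of_wp ?_).mono le_rfl fun _ h => h
    have hf' : ∀ i < 12, σ₁ i = σ i := fun i hi => hf i fun h => by
      have := writes_resetBest h; omega
    have h10 : σ₁ 10 = p := (hf' 10 (by omega)).trans hP
    have h11 : σ₁ 11 = s := (hf' 11 (by omega)).trans hS
    simp [Cmd.wp, I, h10, h11]
    refine ⟨(word_le _).trans hb.n_le_W, h.congr fun i hi _ => ?_⟩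
    rw [Function.update_of_ne, Function.update_of_ne, Function.update_of_ne,
      Function.update_of_ne] <;> omega
  refine (h1.seq (t' := 4 * n + n) fun σ₁ ⟨hX, hY, hQ, hD, hI⟩ => ?_).mono (by omega)
    fun _ h => h
  have h2 := hv.tour (S := ∅) (σ := σ₁) (by simp [Barred]) (Finset.disjoint_empty_left _) hX hY hQ
    hI (by rw [hD, len_root, depth_root]) hb.one_le_W
  rw [unbarred_root, Finset.empty_union] at h2
  refine (h2.seq (t' := n) fun σ₂ ⟨⟨hP2, hS2, o, ho, hod, hbest⟩, _⟩ => ?_).mono (by simp)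
    fun _ h => h
  have h3 : Runs L.memory W (.set rV1 (.reg rTv) ;; .set rDep1 (.reg rTdep)) σ₂ 0 fun σ' =>
      σ' rV1 = vertexWord o ∧ σ' rDep1 = o.elim 0 L.depth ∧ ∀ i < 26, σ' i = σ₂ i := by
    have ho' : σ₂ 14 = vertexWord o := ho
    refine .of_wp ?_
    have hod' : σ₂ 15 = o.elim 0 L.depth := hod
    simp [Cmd.wp, ho', hod']
    refine ⟨?_, ?_, fun i hi => ?_⟩
    · cases o with
      | none => simp
      | some v => exact (word_le v).trans hb.n_le_W
    · cases o with
      | none => simp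
      | some v => exact hb.depth_le_W v
    · rw [Function.update_of_ne, Function.update_of_ne] <;> omega
  refine (h3.seq (t' := n) fun σ₃ ⟨hV1, hD1, hf3⟩ => ?_).mono (by omega) fun _ h => h
  refine ((runs_locate_of_best hb hp hs hs0 hbest ((hf3 _ (by simp)).trans ho)
    ((hf3 _ (by simp)).trans hod) ((hf3 _ (by simp)).trans hP2)
    ((hf3 _ (by simp)).trans hS2)).frame.seq (t' := 0) fun σ₄ ⟨⟨a, hX4, hDX4, hloc⟩, hf4⟩ =>
      .of_wp ?_).mono (by omega) fun _ h => h
  have hf4' : ∀ i, 10 ≤ i → σ₄ i = σ₃ i := fun i hi => hf4 i fun h => by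
    have := writes_locate h; omega
  have hV1' : σ₄ 26 = vertexWord o := (hf4' _ (by simp)).trans hV1
  have hD1' : σ₄ 27 = o.elim 0 L.depth := (hf4' _ (by simp)).trans hD1
  have hP4 : σ₄ 10 = p := (hf4' _ (by simp)).trans ((hf3 _ (by simp)).trans hP2)
  have hS4 : σ₄ 11 = s := (hf4' _ (by simp)).trans ((hf3 _ (by simp)).trans hS2)
  have hX4' : σ₄ 4 = word a := hX4
  have hDX4' : σ₄ 6 = L.depth a := hDX4
  have hsd : σ₄ 9 ≤ W := hb.mul_le (hloc.sd_le.trans hb.NP_le)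
  have hdx : σ₄ 7 ≤ W := by
    refine hloc.le.trans (hb.mul_le ?_)
    rw [mul_assoc]
    exact Nat.mul_le_mul ((len_le_depth a).trans (hb.depth_le a)) hloc.sd_le
  simp [Cmd.wp, hX4', hDX4', hV1', hP4, hS4, hsd, hdx]
  exact ⟨(word_le a).trans hb.n_le_W, o, ⟨_, _, hbest⟩, hloc, rfl, hD1'⟩

end

/-! ### Testing a value: three vertices that need three points -/

section

variable {n : ℕ} {T : WeightedTree n} {L : T.Layout} {W N P p s : ℕ}

variable (L p s) in
/-- The point at distance `sn / sd` above `a` does not cover `v`. -/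
def Uncovered (a : Fin n) (sn sd : ℕ) (v : Fin n) : Prop :=
  p * sd < T.weight v * s * scaledDist L a sn sd v

/-- Clearing the denominators `s` and `sd` links the comparison of words made by the program with
the geometric condition on real distances. -/
theorem uncovered_iff {a : Fin n} {sn sd : ℕ} (hs : 0 < s) (hsd : 0 < sd) (h : sn ≤ L.len a * sd)
    {v : Fin n} : Uncovered L p s a sn sd v ↔
      (p / s : ℝ) < T.weight v * pdist L a (sn / sd) v := by
  have hs' : (0 : ℝ) < s := by exact_mod_cast hs
  have hsd' : (0 : ℝ) < sd := by exact_mod_cast hsd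
  rw [Uncovered, ← Nat.cast_lt (α := ℝ), div_lt_iff₀ hs']
  push_cast
  rw [cast_scaledDist hsd h, show (T.weight v * s * (sd * pdist L a (sn / sd) v) : ℝ) =
    T.weight v * pdist L a (sn / sd) v * s * sd by ring]
  exact mul_lt_mul_iff_left₀ hsd'

theorem not_uncovered_iff {a : Fin n} {sn sd : ℕ} (hs : 0 < s) (hsd : 0 < sd)
    (h : sn ≤ L.len a * sd) {v : Fin n} : ¬ Uncovered L p s a sn sd v ↔
      T.weight v * pdist L a (sn / sd) v ≤ (p / s : ℝ) := by
  rw [uncovered_iff hs hsd h, not_lt]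

theorem pdist_root (v : Fin n) : pdist L L.root 0 v = L.depth v := by
  simp [pdist, desc_root, depth]

namespace Located

variable {o : Option (Fin n)} {a : Fin n} {sn sd : ℕ} (h : Located L (N := N) (P := P) p s o a sn sd)

include h

theorem le_len : (sn / sd : ℝ) ≤ L.len a := by
  have := h.pos
  rw [div_le_iff₀ (by exact_mod_cast this)]
  exact_mod_cast h.le

theorem eq_zero (ho : o = Option.none) : a = L.root ∧ (sn / sd : ℝ) = 0 := by
  have h1 := h.le
  rw [h.none ho, len_root] at h1
  refine ⟨h.none ho, ?_⟩
  rw [show sn = 0 by omega]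
  simp

theorem top {v : Fin n} (hs : 0 < s) (hv : v ∈ o) :
    (T.weight v * (sn / sd + T.vdist a v) : ℝ) = p / s := by
  obtain ⟨-, -, -, h1, h2⟩ := h.some v hv
  have hsd := h.pos
  have hw : 0 < T.weight v := by
    by_contra h0
    rw [Nat.eq_zero_of_not_pos h0] at h1
    omega
  have hw' : (0 : ℝ) < T.weight v := by exact_mod_cast hw
  have hs' : (0 : ℝ) < s := by exact_mod_cast hs
  rw [← h2, h1]
  push_cast
  field_simp

theorem depth_eq {v : Fin n} (hs : 0 < s) (hv : v ∈ o) :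
    ((L.depth a - sn / sd) * T.weight v : ℝ) = L.depth v * T.weight v - p / s := by
  have h1 : (L.depth v : ℝ) = L.depth a + T.vdist a v := by
    exact_mod_cast depth_of_desc (h.some v hv).1
  rw [← h.top hs hv, h1]
  ring

theorem depth_nonneg : (0 : ℝ) ≤ L.depth a - sn / sd := by
  have h1 : (L.len a : ℝ) ≤ L.depth a := by exact_mod_cast len_le_depth a
  linarith [h.le_len]

end Located

theorem IsBest.depth_le {S : Finset (Fin n)} {o : Option (Fin n)} {tn td : ℕ} (hs : 0 < s)
    (h : IsBest L p s S o tn td) (ho : o = Option.none) {v : Fin n} (hv : v ∈ S) :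
    (L.depth v * T.weight v : ℝ) ≤ p / s := by
  have h1 := h.le v hv
  rw [(h.none ho).1, (h.none ho).2] at h1
  rw [le_div_iff₀ (by exact_mod_cast hs)]
  have : L.depth v * T.weight v * s ≤ p := by omega
  exact_mod_cast this

/-- Truncated subtraction does no harm: on the left it can only enlarge the difference, and for `v₁`
it is exact because the result is positive. -/
theorem IsBest.deepest {S : Finset (Fin n)} {o : Option (Fin n)} {tn td : ℕ} (hs : 0 < s)
    (h : IsBest L p s S o tn td) {v₁ : Fin n} (ho : v₁ ∈ o) {v : Fin n} (hv : v ∈ S) :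
    ((L.depth v * T.weight v - p / s) * T.weight v₁ : ℝ) ≤
      (L.depth v₁ * T.weight v₁ - p / s) * T.weight v := by
  obtain ⟨-, h1, h2, h3⟩ := h.some v₁ ho
  have h4 := h.le v hv
  rw [h1] at h2
  rw [h1, h3] at h4
  have hs' : (0 : ℝ) < s := by exact_mod_cast hs
  have h5 : (L.depth v * T.weight v * s - p : ℝ) ≤ ((L.depth v * T.weight v * s - p : ℕ) : ℝ) := by
    rw [sub_le_iff_le_add]
    have : L.depth v * T.weight v * s ≤ L.depth v * T.weight v * s - p + p := by omega
    exact_mod_cast this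
  have h6 : ((L.depth v * T.weight v * s - p : ℕ) * T.weight v₁ : ℝ) ≤
      (L.depth v₁ * T.weight v₁ * s - p) * T.weight v := by
    have h7 : ((L.depth v₁ * T.weight v₁ * s - p : ℕ) : ℝ) = L.depth v₁ * T.weight v₁ * s - p := by
      rw [Nat.cast_sub (by omega)]; push_cast; ring
    rw [← h7]
    exact_mod_cast h4
  have h8 := (mul_le_mul_of_nonneg_right h5 (Nat.cast_nonneg (T.weight v₁))).trans h6
  rw [← mul_le_mul_iff_left₀ hs']
  calc _ = (L.depth v * T.weight v * s - p : ℝ) * T.weight v₁ := by field_simp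
    _ ≤ _ := h8
    _ = _ := by field_simp

variable (L p s) in
/-- The vertex `u` is the first one that the point above `a` does not cover, and the climb has
come there from `q`. -/
structure FirstUncovered (a : Fin n) (sn sd : ℕ) (u : Fin n) (q : Option (Fin n)) : Prop where
  uncovered : Uncovered L p s a sn sd u
  not_desc : ¬ ∃ c ∈ q, L.Desc u c
  stage : ∃ x, ClimbStage L a q (some x) ∧ L.Desc u x
  covered : ∀ v, (∃ c ∈ q, L.Desc v c) → ¬ Uncovered L p s a sn sd v

/-- What the first two tours of a test have found. -/
structure TwoPoints (L : T.Layout) (N P p s : ℕ) (o : Option (Fin n)) (a : Fin n) (sn sd : ℕ)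
    (u : Fin n) (q : Option (Fin n)) (o' : Option (Fin n)) (b : Fin n) (sn' sd' : ℕ) : Prop where
  s_pos : 0 < s
  best : ∃ tn td, IsBest L p s Finset.univ o tn td
  located : Located L (N := N) (P := P) p s o a sn sd
  first : FirstUncovered L p s a sn sd u q
  best' : ∃ tn td S, IsBest L p s S o' tn td ∧ ∀ v, v ∈ S ↔ Uncovered L p s a sn sd v
  located' : Located L (N := N) (P := P) p s o' b sn' sd'

namespace TwoPoints

variable {o : Option (Fin n)} {a : Fin n} {sn sd : ℕ}
    {u : Fin n} {q : Option (Fin n)} {o' : Option (Fin n)} {b : Fin n} {sn' sd' : ℕ}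
    (h : TwoPoints L N P p s o a sn sd u q o' b sn' sd')

include h

theorem uncovered_iff {v : Fin n} : Uncovered L p s a sn sd v ↔
    (p / s : ℝ) < T.weight v * pdist L a (sn / sd) v :=
  ConstantWorkSpace.uncovered_iff h.s_pos h.located.pos h.located.le

theorem uncovered_iff' {v : Fin n} : Uncovered L p s b sn' sd' v ↔
    (p / s : ℝ) < T.weight v * pdist L b (sn' / sd') v :=
  ConstantWorkSpace.uncovered_iff h.s_pos h.located'.pos h.located'.le

/-- Without a first vertex all balls contain the root, so the first point, which is then the root,
would cover `u`. -/
theorem exists_first : ∃ v, v ∈ o ∧ 0 < T.weight v := by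
  obtain ⟨tn, td, hb⟩ := h.best
  cases ho : o with
  | some v => exact ⟨v, rfl, hb.weight_pos ho⟩
  | none =>
    have h1 := h.uncovered_iff.1 h.first.uncovered
    obtain ⟨h2, h3⟩ := h.located.eq_zero ho
    rw [h2, h3, pdist_root] at h1
    have h4 := hb.depth_le h.s_pos ho (Finset.mem_univ u)
    linarith

theorem apart {v₁ v : Fin n} (h1 : v₁ ∈ o) (hv : Uncovered L p s a sn sd v) : ¬ L.Desc v a ∧
    (p / s : ℝ) * (T.weight v₁ + T.weight v) < T.vdist v₁ v * (T.weight v₁ * T.weight v) := by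
  obtain ⟨tn, td, hb⟩ := h.best
  exact greedy_disjoint (h.located.some v₁ h1).1 (hb.weight_pos h1) (h.located.top h.s_pos h1)
    (hb.deepest h.s_pos h1 (Finset.mem_univ v)) (h.uncovered_iff.1 hv)

theorem apart' {v₂ v : Fin n} (h1 : v₂ ∈ o') (hv : Uncovered L p s a sn sd v)
    (hv' : Uncovered L p s b sn' sd' v) :
    (p / s : ℝ) * (T.weight v₂ + T.weight v) < T.vdist v₂ v * (T.weight v₂ * T.weight v) := by
  obtain ⟨tn, td, S, hb, hS⟩ := h.best'
  exact (greedy_disjoint (h.located'.some v₂ h1).1 (hb.weight_pos h1) (h.located'.top h.s_pos h1)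
    (hb.deepest h.s_pos h1 ((hS v).2 hv)) (h.uncovered_iff'.1 hv')).2

theorem uncovered_of_mem {v₂ : Fin n} (h1 : v₂ ∈ o') : Uncovered L p s a sn sd v₂ := by
  obtain ⟨tn, td, S, hb, hS⟩ := h.best'
  exact (hS _).1 (hb.some v₂ h1).1

/-- The greedy choice covers everything below `a`, so the tour can have met `u` only after at least
one climb. -/
theorem exists_parent : ∃ c x, q = some c ∧ L.parent c = some x ∧ L.Desc a c ∧ L.Desc u x := by
  obtain ⟨x, hx, hux⟩ := h.first.stage
  rcases hx with ⟨rfl, hx⟩ | ⟨c, hc, hcx, hac⟩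
  · cases hx
    obtain ⟨v₁, hv₁, -⟩ := h.exists_first
    exact absurd hux (h.apart hv₁ h.first.uncovered).1
  · exact ⟨c, x, hc, hcx, hac, hux⟩

/-- If `b` lay below the top given by `q`, so would `v₂`, which lies below `b`; but there the first
point covers everything. If there is no `v₂`, then `b` is the root, which lies below no vertex that
has a parent. -/
theorem not_desc : ¬ ∃ c ∈ q, L.Desc b c := by
  rintro ⟨c, hc, hbc⟩
  cases ho : o' with
  | some v =>
    exact h.first.covered v ⟨c, hc, (h.located'.some v ho).1.trans hbc⟩ (h.uncovered_of_mem ho)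
  | none =>
    obtain ⟨c', x, hc', hx, -⟩ := h.exists_parent
    obtain rfl : c = c' := by rw [hc'] at hc; exact (Option.some.inj hc).symm
    rw [h.located'.none ho] at hbc
    exact not_desc_parent hx ((desc_root x).trans hbc)

theorem uncovered_of_eq_none (ho : o' = none) {v : Fin n} (hv : Uncovered L p s a sn sd v) :
    ¬ Uncovered L p s b sn' sd' v := by
  obtain ⟨tn, td, S, hb, hS⟩ := h.best'
  have h1 := hb.depth_le h.s_pos ho ((hS v).2 hv)
  obtain ⟨h2, h3⟩ := h.located'.eq_zero ho
  rw [h.uncovered_iff', h2, h3, pdist_root]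
  linarith

/-- The vertex `v₂` took part in the first choice as well, so the top of its ball is not deeper than
that of `v₁`. -/
theorem depth_le : (L.depth b - sn' / sd' : ℝ) ≤ L.depth a - sn / sd := by
  cases ho : o' with
  | none =>
    obtain ⟨h2, h3⟩ := h.located'.eq_zero ho
    rw [h2, h3, depth_root]
    simpa using h.located.depth_nonneg
  | some v₂ =>
    obtain ⟨v₁, hv₁, hw⟩ := h.exists_first
    obtain ⟨tn, td, hb⟩ := h.best
    obtain ⟨tn', td', S, hb', -⟩ := h.best'
    have hw' : (0 : ℝ) < T.weight v₁ := by exact_mod_cast hw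
    have hw₂ : (0 : ℝ) < T.weight v₂ := by exact_mod_cast hb'.weight_pos ho
    have h1 := hb.deepest h.s_pos hv₁ (Finset.mem_univ v₂)
    rw [← h.located.depth_eq h.s_pos hv₁, ← h.located'.depth_eq h.s_pos ho] at h1
    refine le_of_mul_le_mul_right ?_ (mul_pos hw' hw₂)
    linarith

/-- A vertex that the second point does not cover is not covered by the first point either. -/
theorem uncovered {w : Fin n} (hw : Uncovered L p s b sn' sd' w) (hq : ¬ ∃ c ∈ q, L.Desc w c)
    (hu : Uncovered L p s b sn' sd' u → w = u) : Uncovered L p s a sn sd w := by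
  by_contra hwa
  -- If the second point misses `u`, the recorded vertex is `u` itself, which the first point
  -- misses. Otherwise `covered_of_covered` would let the second point cover `w`.
  by_cases hub : Uncovered L p s b sn' sd' u
  · rw [hu hub] at hwa
    exact hwa h.first.uncovered
  · obtain ⟨c, x, hc, hx, hac, hux⟩ := h.exists_parent
    have h1 := h.first.not_desc
    simp only [hc, Option.mem_some_iff, exists_eq_left'] at h1 hq
    rw [h.uncovered_iff, not_lt] at hwa
    rw [h.uncovered_iff', not_lt] at hub
    have := covered_of_covered hx hac hux h1 (by positivity) (h.uncovered_iff.1 h.first.uncovered)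
      (by positivity) h.located'.le_len h.depth_le hub hq hwa
    rw [h.uncovered_iff'] at hw
    linarith

/-- The three balls are disjoint. -/
theorem three_apart {w : Fin n} (hw : Uncovered L p s b sn' sd' w) (hq : ¬ ∃ c ∈ q, L.Desc w c)
    (hu : Uncovered L p s b sn' sd' u → w = u) : ∃ v₁ ∈ o, ∃ v₂ ∈ o', 0 < T.weight v₁ ∧
      0 < T.weight v₂ ∧
      (p / s : ℝ) * (T.weight v₁ + T.weight v₂) < T.vdist v₁ v₂ * (T.weight v₁ * T.weight v₂) ∧
      (p / s : ℝ) * (T.weight v₁ + T.weight w) < T.vdist v₁ w * (T.weight v₁ * T.weight w) ∧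
      (p / s : ℝ) * (T.weight v₂ + T.weight w) < T.vdist v₂ w * (T.weight v₂ * T.weight w) := by
  have hwa := h.uncovered hw hq hu
  obtain ⟨v₁, hv₁, hw₁⟩ := h.exists_first
  cases ho : o' with
  | none => exact absurd hw (h.uncovered_of_eq_none ho hwa)
  | some v₂ =>
    obtain ⟨tn', td', S, hb', -⟩ := h.best'
    exact ⟨v₁, hv₁, v₂, rfl, hw₁, hb'.weight_pos ho, (h.apart hv₁ (h.uncovered_of_mem ho)).2,
      (h.apart hv₁ hwa).2, h.apart' ho hwa hw⟩

/-- A 2-center must consist of different points. The second one covers a vertex that the first does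
not: `v₂`, or `u` if all balls missed by the first point contain the root. -/
theorem exists_pdist_ne : ∃ z, pdist L a (sn / sd) z ≠ pdist L b (sn' / sd') z := by
  cases ho : o' with
  | none =>
    refine ⟨u, fun he => h.uncovered_of_eq_none ho h.first.uncovered ?_⟩
    rw [h.uncovered_iff', ← he]
    exact h.uncovered_iff.1 h.first.uncovered
  | some v₂ =>
    refine ⟨v₂, fun he => ?_⟩
    have h1 := h.uncovered_iff.1 (h.uncovered_of_mem ho)
    have h2 := h.located'.top h.s_pos ho
    rw [he] at h1
    simp only [pdist, (h.located'.some v₂ ho).1, if_true] at h1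
    linarith

end TwoPoints

end

/-! ### Testing a value: the tours from the two points -/

/-- Run `c` if the point of the tour does not cover the visited vertex. -/
def ifUncovered (c : Cmd TreeQuery) : Cmd TreeQuery :=
  .ite (.reg rP * .reg rSd)
    (.weight (.reg rV) * .reg rS * ((.reg rDep - .reg rDepX) * .reg rSd + .reg rDx)) c .skip

def markFirst : Cmd TreeQuery :=
  .ite (.reg rU) (.lit 1) (.set rU (.reg rV) ;; .set rQs (.reg rY)) .skip

/-- Look at the vertices that the first point does not cover. -/
def visitFirst : Cmd TreeQuery := ifUncovered (markFirst ;; best)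

/-- Look for a vertex that is not covered by the second point, and prefer `rU`. -/
def visitSecond : Cmd TreeQuery :=
  ifUncovered (.ifEq (.reg rV3) (.reg rU) .skip (.set rV3 (.reg rV) ;; .set rDep3 (.reg rDep)))

def tourFirst : Cmd TreeQuery :=
  resetBest ;; (.set rU (.lit 0) ;; .set rQs (.lit 0) ;; .set rQ (.lit 0)) ;;
    climbTour visitFirst ;; .set rV2 (.reg rTv) ;; .set rDep2 (.reg rTdep)

def tourSecond : Cmd TreeQuery :=
  (.set rB (.reg rX) ;; .set rBn (.reg rDx) ;; .set rBd (.reg rSd) ;; .set rV3 (.lit 0) ;;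
    .set rDep3 (.lit 0) ;; .set rQ (.reg rQs)) ;; climbTour visitSecond

/-! ### Correctness of the tours from the two points -/

section

variable {n : ℕ} {T : WeightedTree n} {L : T.Layout} {W N P p s : ℕ}
  {a : Fin n} {sn sd : ℕ}

theorem Bounds.sn_le (hb : Bounds L W N P) (h : sn ≤ L.len a * sd) (hsd : sd ≤ N * P) :
    sn ≤ N * (N * P) :=
  h.trans (Nat.mul_le_mul ((len_le_depth a).trans (hb.depth_le a)) hsd)

theorem Bounds.scaledDist_le (hb : Bounds L W N P) (h : sn ≤ L.len a * sd) (hsd : sd ≤ N * P)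
    (v : Fin n) : scaledDist L a sn sd v ≤ W := by
  have h1 := hb.sn_le h hsd
  have h2 := hb.vdist_le a v
  have h3 := Nat.mul_le_mul hsd h2
  have h4 : L.len a * sd ≤ N * (N * P) := hb.sn_le le_rfl hsd
  have h5 := hb.le_of_le hb.NP_le
  have h6 : 3 * (N * (N * P)) = N * (N * P) + N * P * (2 * N) := by ring
  unfold scaledDist
  split_ifs
  · have := Nat.mul_le_mul_left sd h2
    omega
  · have := Nat.mul_le_mul_left sd ((Nat.sub_le (T.vdist a v) (L.len a)).trans h2)
    have := Nat.mul_le_mul_right (2 * N) hsd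
    omega

theorem runs_ifUncovered {c : Cmd TreeQuery} {u : Fin n} {σ : ℕ → ℕ} {post : (ℕ → ℕ) → Prop}
    (hV : σ rV = word u) (hD : (σ rDep - σ rDepX) * σ rSd + σ rDx = scaledDist L a sn sd u)
    (hsd : σ rSd = sd) (hP : σ rP = p) (hS : σ rS = s)
    (h1 : Uncovered L p s a sn sd u → Runs L.memory W c σ 0 post)
    (h2 : ¬ Uncovered L p s a sn sd u → post σ) : Runs L.memory W (ifUncovered c) σ 0 post := by
  have key : (WExpr.reg rP * WExpr.reg rSd : WExpr TreeQuery).eval L.memory σ <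
      (WExpr.weight (.reg rV) * .reg rS * ((.reg rDep - .reg rDepX) * .reg rSd + .reg rDx) :
        WExpr TreeQuery).eval L.memory σ ↔ Uncovered L p s a sn sd u := by
    rw [hsd] at hD
    simp only [WExpr.eval_mul, WExpr.eval_add, WExpr.eval_sub, WExpr.eval_reg, WExpr.eval_query,
      hV, hD, hP, hS, hsd, memory_weight, Uncovered]
  exact .ite (fun h => h1 (key.1 h)) fun h => .of_wp (h2 fun h' => h (key.2 h'))

variable (L p s) in
/-- The state of the first tour after the vertices of `S` have been visited. -/
def FirstTour (a : Fin n) (sn sd : ℕ) (S : Finset (Fin n)) (σ : ℕ → ℕ) : Prop :=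
  σ rP = p ∧ σ rS = s ∧
    (∃ S', Best L p s S' σ ∧ ∀ v, v ∈ S' ↔ v ∈ S ∧ Uncovered L p s a sn sd v) ∧
    ((σ rU = 0 ∧ ∀ v ∈ S, ¬ Uncovered L p s a sn sd v) ∨
      ∃ u q, σ rU = word u ∧ σ rQs = vertexWord q ∧ FirstUncovered L p s a sn sd u q)

theorem writes_markFirst {i : ℕ} (h : markFirst.Writes i) : 16 ≤ i ∧ i < 18 := by
  simp [markFirst, Cmd.Writes] at h
  omega

theorem writes_visitFirst {i : ℕ} (h : visitFirst.Writes i) : 12 ≤ i ∧ i < 18 := by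
  simp only [visitFirst, ifUncovered, Cmd.Writes, or_false] at h
  rcases h with h | h
  · have := writes_markFirst h; omega
  · have := writes_best h; omega

theorem writes_visitSecond {i : ℕ} (h : visitSecond.Writes i) : 18 ≤ i ∧ i < 20 := by
  simp [visitSecond, ifUncovered, Cmd.Writes, Cmd.writes_ifEq] at h
  omega

theorem climbVisits_first (hb : Bounds L W N P) (hs : s ≤ P) (hsn : sn ≤ L.len a * sd)
    (hsd : sd ≤ N * P) :
    ClimbVisits L W visitFirst a sn sd none (FirstTour L p s a sn sd) where
  le_n := hb.n_le_W
  one_le := hb.one_le_W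
  depth_le := hb.depth_le_W
  dist_le := hb.scaledDist_le hsn hsd
  len_le := hb.mul_le (by rw [mul_assoc]; exact hb.sn_le le_rfl hsd)
  frame i hi h := by have := writes_visitFirst h; omega
  congr S σ σ' hσ := fun ⟨h1, h2, ⟨S', h3, h4⟩, h5⟩ => by
    refine ⟨(hσ _ (by simp)).trans h1, (hσ _ (by simp)).trans h2,
      ⟨S', h3.congr fun i hi _ => hσ i (by omega), h4⟩, ?_⟩
    rwa [hσ rU (by simp), hσ rQs (by simp)]
  runs u S σ x y hs' hux huy _ hcl hV hD hY hdist hsd' := fun ⟨h1, h2, ⟨S', h3, h4⟩, h5⟩ => by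
    refine runs_ifUncovered hV hdist hsd' h1 h2 (fun hu => ?_) fun hu => ⟨h1, h2, ⟨S', h3, ?_⟩, ?_⟩
    · have hm : Runs L.memory W markFirst σ 0 fun σ' => ∃ u q, σ' rU = word u ∧
          σ' rQs = vertexWord q ∧ FirstUncovered L p s a sn sd u q := by
        have hV' : σ 0 = word u := hV
        have hY' : σ 5 = vertexWord y := hY
        have hw : ∀ o : Option (Fin n), vertexWord o ≤ W := fun o =>
          (vertexWord_le o).trans hb.n_le_W
        refine .ite (fun _ => .of_wp ?_) fun h => .of_wp ?_
        · simp only [WExpr.eval_reg, WExpr.eval_lit] at *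
          -- As `rU` is still 0, no vertex visited so far was uncovered. All vertices below the
          -- previous stop `y` have been visited, so `y` can be recorded as `q`.
          have h6 : ∀ v ∈ S, ¬ Uncovered L p s a sn sd v := by
            rcases h5 with ⟨-, h⟩ | ⟨u', q, h, -⟩
            · exact h
            · have := word_pos u'; omega
          simp [Cmd.wp, hV', hY', hw]
          refine ⟨(word_le u).trans hb.n_le_W, y, rfl, hu, huy, ⟨x, hs', hux⟩,
            fun v hv => h6 v (hcl (mem_climbed.2 ⟨hv, by simp⟩))⟩
        · rcases h5 with ⟨h, -⟩ | h
          · simp only [WExpr.eval_reg, WExpr.eval_lit] at *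
            omega
          · exact h
      refine (hm.frame.seq (t' := 0) fun σ₁ ⟨⟨u', q, h6, h7, h8⟩, hf⟩ => ?_).mono le_rfl
        fun _ h => h
      have hf' : ∀ i, i < 16 → σ₁ i = σ i := fun i hi => hf i fun h => by
        have := writes_markFirst h; omega
      refine (runs_best hb hs (S := S') ((hf' _ (by simp)).trans hV) ((hf' _ (by simp)).trans hD)
        ((hf' _ (by simp)).trans h1) ((hf' _ (by simp)).trans h2)
        (h3.congr fun i _ hi => hf' i hi)).frame.mono le_rfl fun σ₂ ⟨h9, hf2⟩ => ?_
      have hf2' : ∀ i, i < 12 ∨ 16 ≤ i → σ₂ i = σ₁ i := fun i hi => hf2 i fun h => by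
        have := writes_best h; omega
      refine ⟨?_, ?_, ⟨_, h9, fun v => ?_⟩, .inr ⟨u', q, ?_, ?_, h8⟩⟩
      · rw [hf2' _ (by simp), hf' _ (by simp), h1]
      · rw [hf2' _ (by simp), hf' _ (by simp), h2]
      · rw [Finset.mem_insert, Finset.mem_insert, h4]
        constructor
        · rintro (rfl | ⟨h, h'⟩)
          exacts [⟨.inl rfl, hu⟩, ⟨.inr h, h'⟩]
        · rintro ⟨rfl | h, h'⟩
          exacts [.inl rfl, .inr ⟨h, h'⟩]
      · rw [hf2' _ (by simp), h6]
      · rw [hf2' _ (by simp), h7]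
    · intro v
      rw [h4, Finset.mem_insert]
      constructor
      · rintro ⟨h, h'⟩
        exact ⟨.inr h, h'⟩
      · rintro ⟨rfl | h, h'⟩
        exacts [absurd h' hu, ⟨h, h'⟩]
    · refine h5.imp_left fun ⟨h, h'⟩ => ⟨h, fun v hv => ?_⟩
      rcases Finset.mem_insert.1 hv with rfl | hv
      exacts [hu, h' v hv]

theorem climbed_root_none : climbed L (some L.root) none = Finset.univ := by
  ext v
  simp [mem_climbed, desc_root]

theorem runs_tourFirst (hb : Bounds L W N P) (hs : s ≤ P) (hsn : sn ≤ L.len a * sd)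
    (hsd : sd ≤ N * P) {σ : ℕ → ℕ} (hX : σ rX = word a) (hDX : σ rDepX = L.depth a)
    (hDx : σ rDx = sn) (hSd : σ rSd = sd) (hP : σ rP = p) (hS : σ rS = s) :
    Runs L.memory W tourFirst σ (5 * n) fun σ' => ∃ o tn td S, IsBest L p s S o tn td ∧
      (∀ v, v ∈ S ↔ Uncovered L p s a sn sd v) ∧ σ' rTv = vertexWord o ∧
      σ' rTdep = o.elim 0 L.depth ∧ σ' rV2 = vertexWord o ∧ σ' rDep2 = o.elim 0 L.depth ∧
      ((σ' rU = 0 ∧ ∀ v, ¬ Uncovered L p s a sn sd v) ∨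
        ∃ u q, σ' rU = word u ∧ σ' rQs = vertexWord q ∧ FirstUncovered L p s a sn sd u q) := by
  refine ((hb.runs_resetBest σ (p := p) (s := s)).frame.seq (t' := 5 * n) fun σ₁ ⟨hB, hf⟩ =>
    ?_).mono (by omega) fun _ h => h
  have hf' : ∀ i < 12, σ₁ i = σ i := fun i hi => hf i fun h => by
    have := writes_resetBest h; omega
  have h2 : Runs L.memory W (.set rU (.lit 0) ;; .set rQs (.lit 0) ;; .set rQ (.lit 0)) σ₁ 0
      fun σ' => σ' rU = 0 ∧ σ' rQ = 0 ∧ (∀ i < 8, σ' i = σ₁ i) ∧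
        ∀ i, 9 ≤ i → i < 16 → σ' i = σ₁ i := by
    refine .of_wp ?_
    simp [Cmd.wp]
    refine ⟨fun i hi => ?_, fun i hi hi' => ?_⟩ <;>
    · rw [Function.update_of_ne, Function.update_of_ne, Function.update_of_ne] <;> omega
  refine (h2.seq (t' := 5 * n) fun σ₂ ⟨hU, hQ, hf2, hf3⟩ => ?_).mono (by omega) fun _ h => h
  refine ((climbVisits_first hb hs hsn hsd (p := p)).climbTour (σ := σ₂) ?_ ?_ ?_ ?_ hQ (by simp)
    ⟨?_, ?_, ⟨∅, ?_, by simp⟩, .inl ⟨hU, by simp⟩⟩).seq (t' := 0) (fun σ₃ h => .of_wp ?_)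
      |>.mono (by omega) fun _ h => h
  · rw [hf2 _ (by simp), hf' _ (by simp), hX]
  · rw [hf2 _ (by simp), hf' _ (by simp), hDX]
  · rw [hf2 _ (by simp), hf' _ (by simp), hDx]
  · rw [hf3 _ (by simp) (by simp), hf' _ (by simp), hSd]
  · rw [hf3 _ (by simp) (by simp), hf' _ (by simp), hP]
  · rw [hf3 _ (by simp) (by simp), hf' _ (by simp), hS]
  · exact hB.congr fun i hi hi' => hf3 i (by omega) hi'
  · obtain ⟨-, -, ⟨S, ⟨o, h3, h4, h5⟩, h6⟩, h7⟩ := h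
    rw [climbed_root_none] at h6 h7
    have h3' : σ₃ 14 = vertexWord o := h3
    have h4' : σ₃ 15 = o.elim 0 L.depth := h4
    simp [Cmd.wp, h3', h4']
    refine ⟨(vertexWord_le o).trans hb.n_le_W, ?_, o, _, _, S, h5, by simpa using h6, rfl, rfl,
      rfl, rfl, by simpa using h7⟩
    cases o with
    | none => simp
    | some v => exact hb.depth_le_W v

variable (L p s) in
/-- The state of the second tour after the vertices of `S` have been visited. -/
def SecondTour (a : Fin n) (sn sd : ℕ) (q : Option (Fin n)) (u : Fin n) (S : Finset (Fin n))
    (σ : ℕ → ℕ) : Prop :=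
  σ rP = p ∧ σ rS = s ∧ σ rU = word u ∧
    ((σ rV3 = 0 ∧ ∀ v ∈ S, ¬ Uncovered L p s a sn sd v) ∨
      ∃ w, σ rV3 = word w ∧ σ rDep3 = L.depth w ∧ Uncovered L p s a sn sd w ∧
        (¬ ∃ c ∈ q, L.Desc w c) ∧ (u ∈ S → Uncovered L p s a sn sd u → w = u))

theorem climbVisits_second (hb : Bounds L W N P) (hsn : sn ≤ L.len a * sd) (hsd : sd ≤ N * P)
    {u : Fin n} {q : Option (Fin n)} :
    ClimbVisits L W visitSecond a sn sd q (SecondTour L p s a sn sd q u) where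
  le_n := hb.n_le_W
  one_le := hb.one_le_W
  depth_le := hb.depth_le_W
  dist_le := hb.scaledDist_le hsn hsd
  len_le := hb.mul_le (by rw [mul_assoc]; exact hb.sn_le le_rfl hsd)
  frame i hi h := by have := writes_visitSecond h; omega
  congr S σ σ' hσ := fun ⟨h1, h2, h3, h4⟩ => by
    refine ⟨(hσ _ (by simp)).trans h1, (hσ _ (by simp)).trans h2, (hσ _ (by simp)).trans h3, ?_⟩
    rwa [hσ rV3 (by simp), hσ rDep3 (by simp)]
  runs v S σ x y _ _ _ hvq _ hV hD _ hdist hsd' := fun ⟨h1, h2, h3, h4⟩ => by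
    refine runs_ifUncovered hV hdist hsd' h1 h2 (fun hv => .of_wp ?_) fun hv => ⟨h1, h2, h3, ?_⟩
    · have hV' : σ 0 = word v := hV
      have hD' : σ 2 = L.depth v := hD
      have h1' : σ 10 = p := h1
      have h2' : σ 11 = s := h2
      have h3' : σ 16 = word u := h3
      rw [Cmd.wp_ifEq]
      -- Once `u` is recorded it is never overwritten, and any other record gives way to the next
      -- uncovered vertex. So `u`, if uncovered, is the final witness.
      refine ⟨fun he => ⟨h1, h2, h3, ?_⟩, fun hne => ?_⟩
      · simp only [WExpr.eval_reg] at he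
        rcases h4 with ⟨h4, -⟩ | ⟨w, h4, h5, h6, h7, -⟩
        · rw [he, h3] at h4
          exact absurd h4 (word_pos u).ne'
        · refine .inr ⟨w, h4, h5, h6, h7, fun _ _ => ?_⟩
          rw [h4, h3] at he
          exact word_inj.1 he
      · simp [Cmd.wp, hV', hD', hb.depth_le_W]
        refine ⟨(word_le v).trans hb.n_le_W, h1', h2', h3', .inr ⟨v, rfl, rfl, hv, ?_, ?_⟩⟩
        · simpa using hvq
        · intro h hu
          rcases Finset.mem_insert.1 h with h | h
          · exact h.symm
          · exfalso
            rcases h4 with ⟨-, h4⟩ | ⟨w, h4, -, -, -, h7⟩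
            · exact h4 u h hu
            · simp only [WExpr.eval_reg] at hne
              rw [h4, h3, h7 h hu] at hne
              exact hne rfl
    · rcases h4 with ⟨h4, h5⟩ | ⟨w, h4, h5, h6, h7, h8⟩
      · refine .inl ⟨h4, fun v' hv' => ?_⟩
        rcases Finset.mem_insert.1 hv' with rfl | hv'
        exacts [hv, h5 v' hv']
      · refine .inr ⟨w, h4, h5, h6, h7, fun hm hu => ?_⟩
        rcases Finset.mem_insert.1 hm with rfl | hm
        exacts [absurd hu hv, h8 hm hu]

theorem runs_tourSecond (hb : Bounds L W N P) (hsn : sn ≤ L.len a * sd)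
    (hsd : sd ≤ N * P) {q : Option (Fin n)} {u : Fin n} (hq : ¬ ∃ b ∈ q, L.Desc a b)
    (hu : ¬ ∃ b ∈ q, L.Desc u b) {σ : ℕ → ℕ} (hX : σ rX = word a) (hDX : σ rDepX = L.depth a)
    (hDx : σ rDx = sn) (hSd : σ rSd = sd) (hP : σ rP = p) (hS : σ rS = s) (hU : σ rU = word u)
    (hQ : σ rQs = vertexWord q) :
    Runs L.memory W tourSecond σ (5 * n) fun σ' =>
      σ' rB = word a ∧ σ' rBn = sn ∧ σ' rBd = sd ∧
      ((σ' rV3 = 0 ∧ ∀ v, (¬ ∃ c ∈ q, L.Desc v c) → ¬ Uncovered L p s a sn sd v) ∨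
        ∃ w, σ' rV3 = word w ∧ σ' rDep3 = L.depth w ∧ Uncovered L p s a sn sd w ∧
          (¬ ∃ c ∈ q, L.Desc w c) ∧ (Uncovered L p s a sn sd u → w = u)) := by
  have hX' : σ 4 = word a := hX
  have hDx' : σ 7 = sn := hDx
  have hSd' : σ 9 = sd := hSd
  have hQ' : σ 17 = vertexWord q := hQ
  have hW : sd ≤ W := hb.mul_le (hsd.trans hb.NP_le)
  have hW' : sn ≤ W := hb.mul_le (by rw [mul_assoc]; exact hb.sn_le hsn hsd)
  have h1 : Runs L.memory W (.set rB (.reg rX) ;; .set rBn (.reg rDx) ;; .set rBd (.reg rSd) ;;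
      .set rV3 (.lit 0) ;; .set rDep3 (.lit 0) ;; .set rQ (.reg rQs)) σ 0 fun σ' =>
      σ' rB = word a ∧ σ' rBn = sn ∧ σ' rBd = sd ∧ σ' rV3 = 0 ∧ σ' rQ = vertexWord q ∧
      (∀ i < 8, σ' i = σ i) ∧ ∀ i, 9 ≤ i → i < 18 → σ' i = σ i := by
    refine .of_wp ?_
    simp [Cmd.wp, hX', hDx', hSd', hQ', hW, hW']
    refine ⟨(word_le a).trans hb.n_le_W, (vertexWord_le q).trans hb.n_le_W, fun i hi => ?_,
      fun i hi hi' => ?_⟩ <;>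
    · rw [Function.update_of_ne, Function.update_of_ne, Function.update_of_ne,
        Function.update_of_ne, Function.update_of_ne, Function.update_of_ne] <;> omega
  refine (h1.seq (t' := 5 * n) fun σ₁ ⟨hB, hBn, hBd, hV3, hQ1, hf, hf'⟩ => ?_).mono (by omega)
    fun _ h => h
  refine ((climbVisits_second hb hsn hsd (p := p) (s := s) (u := u)).climbTour (σ := σ₁) ?_ ?_ ?_ ?_
    hQ1 hq ⟨?_, ?_, ?_, .inl ⟨hV3, by simp⟩⟩).frame.mono le_rfl
      fun σ₂ ⟨⟨_, _, _, h⟩, hf2⟩ => ?_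
  · rw [hf _ (by simp), hX]
  · rw [hf _ (by simp), hDX]
  · rw [hf _ (by simp), hDx]
  · rw [hf' _ (by simp) (by simp), hSd]
  · rw [hf' _ (by simp) (by simp), hP]
  · rw [hf' _ (by simp) (by simp), hS]
  · rw [hf' _ (by simp) (by simp), hU]
  · have hf2' : ∀ i, 20 ≤ i → σ₂ i = σ₁ i := fun i hi => hf2 i fun h => by
      rcases writes_climbTour h with h | h
      · omega
      · have := writes_visitSecond h; omega
    refine ⟨(hf2' _ (by simp)).trans hB, (hf2' _ (by simp)).trans hBn,
      (hf2' _ (by simp)).trans hBd, ?_⟩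
    have hm : ∀ v, (¬ ∃ c ∈ q, L.Desc v c) → v ∈ climbed L (some L.root) q := fun v hv =>
      mem_climbed.2 ⟨⟨_, rfl, desc_root v⟩, hv⟩
    refine h.imp (fun ⟨h1, h2⟩ => ⟨h1, fun v hv => h2 v (hm v hv)⟩)
      fun ⟨w, h1, h2, h3, h4, h5⟩ => ⟨w, h1, h2, h3, h4, h5 (hm u hu)⟩

end

/-! ### Testing a value: the whole test -/

def pairMin (rx rdx ry rdy : ℕ) : Cmd TreeQuery :=
  (.set rE (.reg rx) ;; .set rEd (.reg rdx) ;; .set rF (.reg ry) ;; .set rFd (.reg rdy)) ;;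
    pairValue ;; .ite (.reg rCn * .reg rNd) (.reg rNp * .reg rCd)
      (.set rNp (.reg rCn) ;; .set rNd (.reg rCd)) .skip

def triple : Cmd TreeQuery :=
  (.set rNp (.lit 1) ;; .set rNd (.lit 0)) ;; pairMin rV1 rDep1 rV2 rDep2 ;;
    pairMin rV1 rDep1 rV3 rDep3 ;; pairMin rV2 rDep2 rV3 rDep3

def test : Cmd TreeQuery :=
  firstPoint ;; tourFirst ;; .set rFail (.lit 0) ;;
    .ite (.lit 0) (.reg rU)
      (locate ;; tourSecond ;; .ite (.lit 0) (.reg rV3) (.set rFail (.lit 1) ;; triple) .skip)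
      (.ite (.reg rV1) (.lit 1) (.set rB (.firstChild .root)) (.set rB .root) ;;
        .set rBn (.lit 0) ;; .set rBd (.lit 1))

/-! ### Lower bounds from failed tests, and correctness of the whole test -/

section

variable {n : ℕ} {T : WeightedTree n} {L : T.Layout} {W N P p s : ℕ}

/-- A quotient that exceeds the tested value. -/
structure Exceeds (N p s np nd : ℕ) : Prop where
  pos : 0 < nd
  nd_le : nd ≤ 2 * N
  np_le : np ≤ 2 * N * N * N
  lt : p * nd < s * np

variable (T) in
/-- The balls of `u` and `v` do not meet below the value `np / nd`. -/
def PairAbove (np nd : ℕ) (u v : Fin n) : Prop :=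
  np * (T.weight u + T.weight v) ≤ T.vdist u v * (T.weight u * T.weight v) * nd

theorem PairAbove.apart {np nd : ℕ} {u v : Fin n} (h : PairAbove T np nd u v) (hnd : 0 < nd)
    (hu : 0 < T.weight u) : Apart T (np / nd) u v := by
  refine ⟨hu, ?_⟩
  rw [div_mul_eq_mul_div, div_le_iff₀ (by exact_mod_cast hnd)]
  exact_mod_cast h

/-- The initial quotient `1 / 0` plays the part of infinity and is replaced by the first pair value.
Afterwards the quotient only decreases, so the bounds for the pairs treated before persist. -/
theorem runs_pairMin (hb : Bounds L W N P) {rx rdx ry rdy : ℕ} {u v : Fin n} {σ : ℕ → ℕ}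
    (hrdx : rdx < 33) (hry : ry < 33) (hrdy : rdy < 33)
    (hu : σ rx = word u) (hdu : σ rdx = L.depth u) (hv : σ ry = word v) (hdv : σ rdy = L.depth v)
    (hw : 0 < T.weight u)
    (hlt : p * (T.weight u + T.weight v) < s * (T.vdist u v * (T.weight u * T.weight v)))
    (h : σ rNp = 1 ∧ σ rNd = 0 ∨ Exceeds N p s (σ rNp) (σ rNd)) :
    Runs L.memory W (pairMin rx rdx ry rdy) σ (2 * n) fun σ' =>
      Exceeds N p s (σ' rNp) (σ' rNd) ∧ PairAbove T (σ' rNp) (σ' rNd) u v ∧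
      (∀ x y, PairAbove T (σ rNp) (σ rNd) x y → PairAbove T (σ' rNp) (σ' rNd) x y) ∧
      ∀ i < 31, σ' i = σ i := by
  have hNN : N * N ≤ N * N * P := Nat.le_mul_of_pos_right _ hb.one_le
  have hww : T.weight u * T.weight v ≤ N * N := Nat.mul_le_mul (hb.weight_le u) (hb.weight_le v)
  have hcn : T.vdist u v * (T.weight u * T.weight v) ≤ 2 * N * (N * N) :=
    Nat.mul_le_mul (hb.vdist_le u v) hww
  have hW : T.vdist u v * (T.weight u * T.weight v) ≤ W := by
    have h1 := hb.le_of_le hNN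
    have h2 : 2 * N * (N * N) + N * (N * N) = 3 * (N * (N * N)) := by ring
    omega
  have hcd : T.weight u + T.weight v ≤ 2 * N := by
    have := hb.weight_le u
    have := hb.weight_le v
    omega
  have hW' : T.weight u + T.weight v ≤ W := by
    have h1 := hb.le_of_le (x := 1) (by
      have := hb.one_le_N.trans hb.N_le
      exact this)
    omega
  have h1 : Runs L.memory W (.set rE (.reg rx) ;; .set rEd (.reg rdx) ;; .set rF (.reg ry) ;;
      .set rFd (.reg rdy)) σ 0 fun σ' => σ' rE = word u ∧ σ' rEd = L.depth u ∧ σ' rF = word v ∧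
      σ' rFd = L.depth v ∧ ∀ i < 33, σ' i = σ i := by
    refine .of_wp ?_
    have e1 : rdx ≠ 46 := by omega
    have e2 : ry ≠ 46 := by omega
    have e3 : ry ≠ 47 := by omega
    have e4 : rdy ≠ 46 := by omega
    have e5 : rdy ≠ 47 := by omega
    have e6 : rdy ≠ 48 := by omega
    simp [Cmd.wp, hu, hdu, hv, hdv, hb.depth_le_W, e1, e2, e3, e4, e5, e6]
    refine ⟨(word_le u).trans hb.n_le_W, (word_le v).trans hb.n_le_W, fun i hi => ?_⟩
    rw [Function.update_of_ne, Function.update_of_ne, Function.update_of_ne,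
        Function.update_of_ne] <;> omega
  refine (h1.seq (t' := 2 * n) fun σ₁ ⟨hE, hEd, hF, hFd, hf⟩ => ?_).mono (by omega) fun _ h => h
  refine ((runs_pairValue hb.n_le_W hb.depth_le_W hW hW' hE hEd hF hFd).frame.seq (t' := 0)
    fun σ₂ ⟨⟨hC, hCd⟩, hf2⟩ => .of_wp ?_).mono (by omega) fun _ h => h
  have hf3 : ∀ i < 33, σ₂ i = σ i := fun i hi => (hf2 i fun h => by
    simp [pairValue, meet, Cmd.Writes] at h
    omega).trans (hf i hi)
  have hC' : σ₂ 37 = T.vdist u v * (T.weight u * T.weight v) := hC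
  have hCd' : σ₂ 38 = T.weight u + T.weight v := hCd
  have hNp : σ₂ 31 = σ 31 := hf3 _ (by simp)
  have hNd : σ₂ 32 = σ 32 := hf3 _ (by simp)
  have hf4 : ∀ i < 31, σ₂ i = σ i := fun i hi => hf3 i (by omega)
  simp only [rNp, rNd] at h
  simp only [Cmd.wp, WExpr.eval_mul, WExpr.eval_reg, rCn, rCd, rNp, rNd, hC', hCd', hNp, hNd]
  constructor
  · intro hlt'
    have hup : ∀ i < 31, Function.update (Function.update σ₂ 31
        (T.vdist u v * (T.weight u * T.weight v))) 32 (T.weight u + T.weight v) i = σ i := by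
      intro i hi
      rw [Function.update_of_ne, Function.update_of_ne, hf4 i hi] <;> omega
    refine ⟨hW, ?_⟩
    simp [hCd', hW']
    refine ⟨⟨by omega, hcd, by rw [mul_assoc (2 * N)]; exact hcn, hlt⟩, le_rfl, fun x y hxy => ?_,
      hup⟩
    unfold PairAbove at hxy ⊢
    rcases h with ⟨h1, h2⟩ | h
    -- For the quotient `1 / 0` the assumption leaves only pairs with both weights 0, and these
    -- satisfy the condition for any quotient.
    · rw [h1, h2, one_mul, mul_zero] at hxy
      rw [Nat.le_zero.1 hxy]
      simp
    · refine le_of_mul_le_mul_right ?_ h.pos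
      calc _ = T.vdist u v * (T.weight u * T.weight v) * σ 32 * (T.weight x + T.weight y) := by ring
        _ ≤ σ 31 * (T.weight u + T.weight v) * (T.weight x + T.weight y) :=
          Nat.mul_le_mul_right _ hlt'.le
        _ = σ 31 * (T.weight x + T.weight y) * (T.weight u + T.weight v) := by ring
        _ ≤ T.vdist x y * (T.weight x * T.weight y) * σ 32 * (T.weight u + T.weight v) :=
          Nat.mul_le_mul_right _ hxy
        _ = _ := by ring
  · intro hge
    refine ⟨h.resolve_left ?_, not_lt.1 hge, fun x y hxy => hxy, hf4⟩
    rintro ⟨h1, h2⟩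
    rw [h1, h2] at hge
    omega

/-- The minimum of the three pair values still exceeds `p / s` because each of them does, and it
makes all three pairs `Apart`. -/
theorem runs_triple (hb : Bounds L W N P) {u v w : Fin n} {σ : ℕ → ℕ}
    (hu : σ rV1 = word u) (hdu : σ rDep1 = L.depth u) (hv : σ rV2 = word v)
    (hdv : σ rDep2 = L.depth v) (hw : σ rV3 = word w) (hdw : σ rDep3 = L.depth w)
    (hu0 : 0 < T.weight u) (hv0 : 0 < T.weight v)
    (h1 : p * (T.weight u + T.weight v) < s * (T.vdist u v * (T.weight u * T.weight v)))
    (h2 : p * (T.weight u + T.weight w) < s * (T.vdist u w * (T.weight u * T.weight w)))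
    (h3 : p * (T.weight v + T.weight w) < s * (T.vdist v w * (T.weight v * T.weight w))) :
    Runs L.memory W triple σ (6 * n) fun σ' => Exceeds N p s (σ' rNp) (σ' rNd) ∧
      (∀ X : Finset T.Point, X.card = 2 → (σ' rNp / σ' rNd : ℝ) ≤ T.cost X) ∧
      ∀ i < 31, σ' i = σ i := by
  have hi : Runs L.memory W (.set rNp (.lit 1) ;; .set rNd (.lit 0)) σ 0 fun σ' =>
      σ' rNp = 1 ∧ σ' rNd = 0 ∧ ∀ i < 31, σ' i = σ i := by
    refine .of_wp ?_
    simp [Cmd.wp, hb.one_le_W]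
    intro i hi
    rw [Function.update_of_ne, Function.update_of_ne] <;> omega
  refine (hi.seq (t' := 6 * n) fun σ₁ ⟨hp1, hd1, hf⟩ => ?_).mono (by omega) fun _ h => h
  refine ((runs_pairMin hb (by simp) (by simp) (by simp) ((hf _ (by simp)).trans hu)
    ((hf _ (by simp)).trans hdu) ((hf _ (by simp)).trans hv) ((hf _ (by simp)).trans hdv) hu0 h1
    (.inl ⟨hp1, hd1⟩)).seq (t' := 4 * n) fun σ₂ ⟨hx2, ha2, _, hf2⟩ => ?_).mono (by omega)
    fun _ h => h
  have hf2' : ∀ i < 31, σ₂ i = σ i := fun i hi => (hf2 i hi).trans (hf i hi)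
  refine ((runs_pairMin hb (by simp) (by simp) (by simp) ((hf2' _ (by simp)).trans hu)
    ((hf2' _ (by simp)).trans hdu) ((hf2' _ (by simp)).trans hw) ((hf2' _ (by simp)).trans hdw) hu0
    h2 (.inr hx2)).seq (t' := 2 * n) fun σ₃ ⟨hx3, ha3, hk3, hf3⟩ => ?_).mono (by omega)
    fun _ h => h
  have hf3' : ∀ i < 31, σ₃ i = σ i := fun i hi => (hf3 i hi).trans (hf2' i hi)
  refine (runs_pairMin hb (by simp) (by simp) (by simp) ((hf3' _ (by simp)).trans hv)
    ((hf3' _ (by simp)).trans hdv) ((hf3' _ (by simp)).trans hw) ((hf3' _ (by simp)).trans hdw) hv0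
    h3 (.inr hx3)).mono le_rfl fun σ₄ ⟨hx4, ha4, hk4, hf4⟩ => ⟨hx4, fun X hX => ?_, fun i hi =>
      (hf4 i hi).trans (hf3' i hi)⟩
  exact le_cost_of_apart ((hk4 _ _ (hk3 _ _ ha2)).apart hx4.pos hu0)
    ((hk4 _ _ ha3).apart hx4.pos hu0) (ha4.apart hx4.pos hv0) hX

variable (L) in
/-- The points at distance `sn / sd` above `a` and `sn' / sd'` above `b` are different and cover
all vertices at the value `r`. -/
structure Covers (r : ℝ) (a : Fin n) (sn sd : ℕ) (b : Fin n) (sn' sd' : ℕ) : Prop where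
  pos : 0 < sd
  le : sn ≤ L.len a * sd
  pos' : 0 < sd'
  le' : sn' ≤ L.len b * sd'
  ne : ∃ z, pdist L a (sn / sd) z ≠ pdist L b (sn' / sd') z
  covers : ∀ v, T.weight v * pdist L a (sn / sd) v ≤ r ∨ T.weight v * pdist L b (sn' / sd') v ≤ r

variable (L) in
/-- The two points are in the registers. -/
def Found (r : ℝ) (σ : ℕ → ℕ) : Prop :=
  ∃ a b, σ rA = word a ∧ σ rB = word b ∧ Covers L r a (σ rAn) (σ rAd) b (σ rBn) (σ rBd)

variable (L N p s) in
/-- The result of the test of `p / s`. -/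
def Tested (σ : ℕ → ℕ) : Prop :=
  σ rFail = 0 ∧ Found L (p / s) σ ∨ σ rFail = 1 ∧ Exceeds N p s (σ rNp) (σ rNd) ∧
    ∀ X : Finset T.Point, X.card = 2 → (σ rNp / σ rNd : ℝ) ≤ T.cost X

/-- The first point alone covers everything, so the second has only to differ from it. A point
located above a vertex lies strictly below the parent of `a`, hence is not the root, which can then
be taken; if the first point is the root, a child of the root is taken. -/
theorem covers_root (hs : 0 < s) {o : Option (Fin n)} {a : Fin n} {sn sd : ℕ}
    (h : Located L (N := N) (P := P) p s o a sn sd) (hc : ∀ v, ¬ Uncovered L p s a sn sd v)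
    {b : Fin n} (hb : ∀ v ∈ o, b = L.root) (hb' : o = none → L.parent b = some L.root) :
    Covers L (p / s) a sn sd b 0 1 := by
  refine ⟨h.pos, h.le, one_pos, Nat.zero_le _, ⟨L.root, ?_⟩,
    fun v => .inl ((not_uncovered_iff hs h.pos h.le).1 (hc v))⟩
  have h0 : L.depth L.root = 0 := depth_root
  cases ho : o with
  | none =>
    obtain ⟨h1, h2⟩ := h.eq_zero ho
    have h3 := hb' ho
    rw [h1, h2, pdist_root, h0]
    simp only [pdist, not_desc_parent h3, if_false]
    have := len_pos h3
    have := len_le_vdist (not_desc_parent h3)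
    have h4 : (0 : ℝ) < T.vdist b L.root := by exact_mod_cast (by omega)
    simp
    linarith
  | some v =>
    obtain ⟨h1, h2, h3, -⟩ := h.some v ho
    rw [hb v ho]
    have h4 : ¬ L.Desc L.root a := fun h' => h2 (h'.antisymm (desc_root a).hop_le).symm
    have h5 : (L.len a : ℝ) ≤ T.vdist a L.root := by exact_mod_cast len_le_vdist h4
    have h6 : (sn / sd : ℝ) < L.len a := by
      rw [div_lt_iff₀ (by exact_mod_cast h.pos)]
      exact_mod_cast h3
    simp [pdist_root, h0]
    simp only [pdist, h4, if_false]
    intro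
    linarith

theorem writes_tourFirst {i : ℕ} (h : tourFirst.Writes i) :
    i < 9 ∨ 12 ≤ i ∧ i < 18 ∨ 28 ≤ i ∧ i < 30 := by
  simp only [tourFirst, Cmd.Writes, rU, rQs, rQ, rV2, rDep2] at h
  rcases h with h | h | h | h
  · have := writes_resetBest h; omega
  · omega
  · rcases writes_climbTour h with h | h
    · omega
    · have := writes_visitFirst h; omega
  · omega

theorem writes_tourSecond {i : ℕ} (h : tourSecond.Writes i) :
    i < 9 ∨ 18 ≤ i ∧ i < 20 ∨ 23 ≤ i ∧ i < 26 := by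
  simp only [tourSecond, Cmd.Writes, rB, rBn, rBd, rV3, rDep3, rQ] at h
  rcases h with h | h
  · omega
  · rcases writes_climbTour h with h | h
    · omega
    · have := writes_visitSecond h; omega

theorem runs_placeRoot (hb : Bounds L W N P) (hs0 : 0 < s) {o : Option (Fin n)} {a : Fin n}
    {σ : ℕ → ℕ} (h : Located L (N := N) (P := P) p s o a (σ rAn) (σ rAd))
    (hc : ∀ v, ¬ Uncovered L p s a (σ rAn) (σ rAd) v) (hA : σ rA = word a)
    (hV : σ rV1 = vertexWord o) (hF : σ rFail = 0) :
    Runs L.memory W (.ite (.reg rV1) (.lit 1) (.set rB (.firstChild .root)) (.set rB .root) ;;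
        .set rBn (.lit 0) ;; .set rBd (.lit 1)) σ 0 (Tested L N p s) := by
  have hA' : σ 20 = word a := hA
  have hF' : σ 30 = 0 := hF
  have h1 : Runs L.memory W (.ite (.reg rV1) (.lit 1) (.set rB (.firstChild .root))
      (.set rB .root)) σ 0 fun σ' => (∃ b, σ' rB = word b ∧ (∀ v ∈ o, b = L.root) ∧
        (o = none → L.parent b = some L.root)) ∧ ∀ i, i ≠ 23 → σ' i = σ i := by
    refine .ite (fun hlt => .of_wp ?_) fun hge => .of_wp ?_
    · simp only [WExpr.eval_reg, WExpr.eval_lit, hV] at hlt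
      have ho : o = none := by
        cases o with
        | none => rfl
        | some v => have := word_pos v; simp only [vertexWord_some] at hlt; omega
      obtain ⟨c, hc, hcp⟩ := exists_firstChild_root L hb.two_le
      simp [Cmd.wp, hc, vertexWord_some, ho]
      exact ⟨(word_le c).trans hb.n_le_W, hcp, fun i hi => Function.update_of_ne hi _ _⟩
    · simp only [WExpr.eval_reg, WExpr.eval_lit, hV] at hge
      have ho : o ≠ none := by
        rintro rfl
        simp at hge
      simp [Cmd.wp, ho]
      exact ⟨(word_le _).trans hb.n_le_W,
        fun i hi => Function.update_of_ne hi _ _⟩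
  refine (h1.seq (t' := 0) fun σ₁ ⟨⟨b, hB, hb1, hb2⟩, hf⟩ => .of_wp ?_).mono le_rfl fun _ h => h
  have hB' : σ₁ 23 = word b := hB
  have hn : σ₁ 21 = σ 21 := hf _ (by simp)
  have hd : σ₁ 22 = σ 22 := hf _ (by simp)
  have hA1 : σ₁ 20 = word a := (hf _ (by simp)).trans hA
  have hF1 : σ₁ 30 = 0 := (hf _ (by simp)).trans hF
  simp [Cmd.wp, Tested, Found, hb.one_le_W, hB', hn, hd, hA1, hF1]
  exact covers_root hs0 h hc hb1 hb2

theorem lt_of_div_mul_lt {p s c d : ℕ} {x y : ℝ} (hs : 0 < s) (hx : x = c) (hy : y = d)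
    (h : (p / s : ℝ) * x < y) : p * c < s * d := by
  have hs' : (0 : ℝ) < s := by exact_mod_cast hs
  rw [div_mul_eq_mul_div, div_lt_iff₀ hs', hx, hy] at h
  rw [mul_comm s]
  exact_mod_cast h

/-- The budget `22 * n` is `5 * n` for the first point, `5 * n` for each of the two tours from the
points, `n` for locating the second point, and `6 * n` for the three pair values. -/
theorem runs_test (hb : Bounds L W N P) (hp : p ≤ P) (hs : s ≤ P) (hs0 : 0 < s)
    {σ : ℕ → ℕ} (hP : σ rP = p) (hS : σ rS = s) :
    Runs L.memory W test σ (22 * n) (Tested L N p s) := by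
  refine ((runs_firstPoint hb hp hs hs0 hP hS).seq (t' := 17 * n) fun σ₁
    ⟨hP1, hS1, o, a, tn, td, hbest, hloc, hX1, hDX1, hV1, hD1, hA1, hAn1, hAd1⟩ => ?_).mono
    (by omega) fun _ h => h
  refine ((runs_tourFirst hb hs hloc.le hloc.sd_le hX1 hDX1 rfl rfl hP1 hS1).frame.seq
    (t' := 12 * n) fun σ₂ ⟨⟨o', tn', td', S, hbest', hS', hTv, hTd, hV2, hD2, hU⟩, hf2⟩ =>
    ?_).mono (by omega) fun _ h => h
  have hf2' : ∀ i, 9 ≤ i → i < 12 ∨ 18 ≤ i ∧ i < 28 → σ₂ i = σ₁ i := fun i hi hi' => hf2 i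
    fun h => by have := writes_tourFirst h; omega
  have hset : Runs L.memory W (.set rFail (.lit 0)) σ₂ 0 fun σ' => σ' rFail = 0 ∧
      ∀ i < 30, σ' i = σ₂ i := by
    refine .of_wp ?_
    simp [Cmd.wp]
    exact fun i hi => Function.update_of_ne (by omega) _ _
  refine (hset.seq (t' := 12 * n) fun σ₃ ⟨hF3, hf3⟩ => ?_).mono (by omega) fun _ h => h
  have hf3' : ∀ i, 9 ≤ i → i < 12 ∨ 18 ≤ i ∧ i < 28 → σ₃ i = σ₁ i := fun i hi hi' =>
    (hf3 i (by omega)).trans (hf2' i hi hi')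
  have hA3 : σ₃ rA = word a := (hf3' _ (by simp) (by simp)).trans hA1
  have hAn3 : σ₃ rAn = σ₁ rDx := (hf3' _ (by simp) (by simp)).trans hAn1
  have hAd3 : σ₃ rAd = σ₁ rSd := (hf3' _ (by simp) (by simp)).trans hAd1
  have hV3 : σ₃ rV1 = vertexWord o := (hf3' _ (by simp) (by simp)).trans hV1
  have hD3 : σ₃ rDep1 = o.elim 0 L.depth := (hf3' _ (by simp) (by simp)).trans hD1
  have hP3 : σ₃ rP = p := (hf3' _ (by simp) (by simp)).trans hP1
  have hS3 : σ₃ rS = s := (hf3' _ (by simp) (by simp)).trans hS1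
  rw [← hf3 rU (by simp), ← hf3 rQs (by simp)] at hU
  rw [← hf3 _ (by simp)] at hTv hTd hV2 hD2
  refine .ite (fun hlt => ?_) fun hge => ?_
  · obtain ⟨u, q, hU, hQ, hfirst⟩ := hU.resolve_left fun h => by
      simp only [WExpr.eval_reg, WExpr.eval_lit, h.1] at hlt
      omega
    refine ((runs_locate_of_best hb hp hs hs0 hbest' hTv hTd hP3 hS3).frame.seq (t' := 11 * n)
      fun σ₄ ⟨⟨b, hX4, hDX4, hloc'⟩, hf4⟩ => ?_).mono (by omega) fun _ h => h
    have hf4' : ∀ i, 10 ≤ i → σ₄ i = σ₃ i := fun i hi => hf4 i fun h => by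
      have := writes_locate h; omega
    have htwo : TwoPoints L N P p s o a (σ₁ rDx) (σ₁ rSd) u q o' b (σ₄ rDx) (σ₄ rSd) :=
      ⟨hs0, ⟨_, _, hbest⟩, hloc, hfirst, ⟨_, _, S, hbest', hS'⟩, hloc'⟩
    refine ((runs_tourSecond hb hloc'.le hloc'.sd_le htwo.not_desc hfirst.not_desc hX4 hDX4 rfl rfl
      ((hf4' _ (by simp)).trans hP3) ((hf4' _ (by simp)).trans hS3) ((hf4' _ (by simp)).trans hU)
      ((hf4' _ (by simp)).trans hQ)).frame.seq (t' := 6 * n) fun σ₅ ⟨⟨hB5, hBn5, hBd5, h5⟩, hf5⟩ =>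
        ?_).mono (by omega) fun _ h => h
    have hf5' : ∀ i, 20 ≤ i → i < 23 ∨ 26 ≤ i → σ₅ i = σ₃ i := fun i hi hi' => (hf5 i fun h => by
      have := writes_tourSecond h; omega).trans (hf4' i (by omega))
    have hV5 : σ₅ rV1 = vertexWord o := (hf5' _ (by simp) (by simp)).trans hV3
    have hD5 : σ₅ rDep1 = o.elim 0 L.depth := (hf5' _ (by simp) (by simp)).trans hD3
    have hV5' : σ₅ rV2 = vertexWord o' := (hf5' _ (by simp) (by simp)).trans hV2
    have hD5' : σ₅ rDep2 = o'.elim 0 L.depth := (hf5' _ (by simp) (by simp)).trans hD2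
    refine .ite (fun hlt => ?_) fun hge =>
      (Runs.of_wp (post := Tested L N p s) ?_).mono (Nat.zero_le _) fun _ h => h
    · obtain ⟨w, hw, hdw, hunc, hwq, hwu⟩ := h5.resolve_left fun h => by
        simp only [WExpr.eval_reg, WExpr.eval_lit, h.1] at hlt
        omega
      obtain ⟨v₁, hv₁, v₂, hv₂, hw₁, hw₂, h12, h13, h23⟩ := htwo.three_apart hunc hwq hwu
      rw [Option.mem_def] at hv₁ hv₂
      rw [hv₁] at hV5 hD5
      rw [hv₂] at hV5' hD5'
      have hset : Runs L.memory W (.set rFail (.lit 1)) σ₅ 0 fun σ' => σ' rFail = 1 ∧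
          ∀ i < 30, σ' i = σ₅ i := by
        refine .of_wp ?_
        simp [Cmd.wp, hb.one_le_W]
        exact fun i hi => Function.update_of_ne (by omega) _ _
      refine (hset.seq (t' := 6 * n) fun σ₆ ⟨hF6, hf6⟩ => ?_).mono (by omega) fun _ h => h
      refine (runs_triple hb ((hf6 _ (by simp)).trans hV5) ((hf6 _ (by simp)).trans hD5)
        ((hf6 _ (by simp)).trans hV5') ((hf6 _ (by simp)).trans hD5') ((hf6 _ (by simp)).trans hw)
        ((hf6 _ (by simp)).trans hdw) hw₁ hw₂ (lt_of_div_mul_lt hs0 (by simp) (by simp) h12)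
        (lt_of_div_mul_lt hs0 (by simp) (by simp) h13)
        (lt_of_div_mul_lt hs0 (by simp) (by simp) h23)).mono le_rfl
        fun σ₇ ⟨h1, h2, h3⟩ => .inr ⟨(h3 _ (by simp)).trans hF6, h1, h2⟩
    · have hc := (h5.resolve_right fun ⟨w, hw, _⟩ => by
        simp only [WExpr.eval_reg, WExpr.eval_lit, hw] at hge
        exact hge (word_pos w)).2
      refine .inl ⟨(hf5' _ (by simp) (by simp)).trans hF3, a, b,
        (hf5' _ (by simp) (by simp)).trans hA3, hB5, ?_⟩
      rw [hf5' rAn (by simp) (by simp), hf5' rAd (by simp) (by simp), hAn3, hAd3, hBn5, hBd5]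
      refine ⟨hloc.pos, hloc.le, hloc'.pos, hloc'.le, htwo.exists_pdist_ne, fun v => ?_⟩
      by_cases hv : ∃ c ∈ q, L.Desc v c
      · exact .inl ((not_uncovered_iff hs0 hloc.pos hloc.le).1 (hfirst.covered v hv))
      · exact .inr ((not_uncovered_iff hs0 hloc'.pos hloc'.le).1 (hc v hv))
  · have hc := (hU.resolve_right fun ⟨u, q, hu, _⟩ => by
      simp only [WExpr.eval_reg, WExpr.eval_lit, hu] at hge
      exact hge (word_pos u)).2
    rw [← hAn3, ← hAd3] at hloc hc
    exact (runs_placeRoot hb hs0 hloc hc hA3 hV3 hF3).mono (Nat.zero_le _) fun _ h => h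

theorem writes_test {i : ℕ} (h : test.Writes i) : i < 39 ∨ 46 ≤ i ∧ i < 50 := by
  simp only [test, Cmd.Writes, firstPoint] at h
  rcases h with (h | h | h | h | h) | h | h | (h | h | h) | h
  · simp only [rX, rY, rQ, rDep] at h
    rcases h with h | h
    · have := writes_resetBest h; omega
    · omega
  · rcases writes_tour h with h | h
    · omega
    · have := writes_best h; omega
  · simp only [rV1, rDep1] at h; omega
  · have := writes_locate h; omega
  · simp only [rA, rAn, rAd] at h; omega
  · have := writes_tourFirst h; omega
  · simp only [rFail] at h; omega
  · have := writes_locate h; omega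
  · have := writes_tourSecond h; omega
  · simp [triple, pairMin, pairValue, meet, Cmd.Writes] at h
    omega
  · simp only [rB, rBn, rBd] at h; omega

end

/-! ### The search for the optimal value -/

section

variable {n : ℕ} {T : WeightedTree n} {L : T.Layout} {W N P p s : ℕ}

variable (T) in
def LowerBound (r : ℝ) : Prop := ∀ X : Finset T.Point, X.card = 2 → r ≤ T.cost X

variable (T) in
def UpperBound (r : ℝ) : Prop := ∃ X : Finset T.Point, X.card = 2 ∧ T.cost X ≤ r

theorem dist_nonneg (α : T.Point) (v : Fin n) : 0 ≤ α.dist v := by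
  have := vdist_le_dist_add_dist α v v
  rw [T.vdist_self] at this
  push_cast at this
  linarith

theorem lowerBound_zero : LowerBound T 0 := fun _ _ =>
  Real.iSup_nonneg fun v => mul_nonneg (Real.iInf_nonneg fun α => dist_nonneg α.1 v)
    (Nat.cast_nonneg _)

theorem exists_point_of_parent {a q : Fin n} (hq : L.parent a = some q) {sn sd : ℕ} (hsd : 0 < sd)
    (h : sn ≤ L.len a * sd) : ∃ α : T.Point, (∀ v, α.dist v = pdist L a (sn / sd) v) ∧
      Describes T (word a) (word q) sn sd α := by
  have h0 : (0 : ℝ) ≤ sn / sd := by positivity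
  have h1 : (sn / sd : ℝ) ≤ L.len a := by
    rw [div_le_iff₀ (by exact_mod_cast hsd)]
    exact_mod_cast h
  exact ⟨Quotient.mk _ (edgePointAbove a q hq _ h0 h1), dist_edgePointAbove hq h0 h1,
    _, rfl, rfl, hsd, rfl, rfl⟩

/-- The root has no edge above it. Seen from a child, it is the upper end of the child's edge, and
in this way it becomes a point on an edge. -/
theorem pdist_len {c : Fin n} (hc : L.parent c = some L.root) (v : Fin n) :
    pdist L c (L.len c) v = pdist L L.root 0 v := by
  rw [pdist_root, depth]
  unfold pdist
  split_ifs with hv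
  · exact_mod_cast (vdist_parent_of_desc hc hv).symm
  · rw [sub_eq_iff_eq_add, add_comm]
    exact_mod_cast vdist_of_not_desc hc hv

theorem exists_point (hn : 2 ≤ n) {a : Fin n} {sn sd : ℕ} (hsd : 0 < sd)
    (h : sn ≤ L.len a * sd) : ∃ α : T.Point, ∀ v, α.dist v = pdist L a (sn / sd) v := by
  by_cases ha : a = L.root
  · obtain ⟨c, -, hc⟩ := exists_firstChild_root L hn
    obtain ⟨α, hα, -⟩ := exists_point_of_parent hc one_pos (mul_one (L.len c)).ge
    refine ⟨α, fun v => ?_⟩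
    rw [ha, len_root, zero_mul, Nat.le_zero] at h
    rw [hα, ha, h, Nat.cast_one, div_one, pdist_len hc, Nat.cast_zero, zero_div]
  · obtain ⟨q, hq⟩ := exists_parent ha
    obtain ⟨α, hα, -⟩ := exists_point_of_parent hq hsd h
    exact ⟨α, hα⟩

open Classical in
theorem Covers.cost_le {r : ℝ} {a b : Fin n} {sn sd sn' sd' : ℕ}
    (h : Covers L r a sn sd b sn' sd') (hn : 0 < n) {α β : T.Point}
    (hα : ∀ v, α.dist v = pdist L a (sn / sd) v) (hβ : ∀ v, β.dist v = pdist L b (sn' / sd') v) :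
    ({α, β} : Finset T.Point).card = 2 ∧ T.cost {α, β} ≤ r := by
  constructor
  · refine Finset.card_pair ?_
    rintro rfl
    obtain ⟨z, hz⟩ := h.ne
    exact hz (by rw [← hα, ← hβ])
  · refine cost_le_of_covered hn (α := α) (β := β) (by simp) (by simp) fun v => ?_
    rw [hα, hβ]
    exact h.covers v

theorem Found.upperBound {r : ℝ} {σ : ℕ → ℕ} (h : Found L r σ) (hn : 2 ≤ n) : UpperBound T r := by
  classical
  obtain ⟨a, b, -, -, h⟩ := h
  obtain ⟨α, hα⟩ := exists_point hn h.pos h.le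
  obtain ⟨β, hβ⟩ := exists_point hn h.pos' h.le'
  exact ⟨_, h.cost_le (by omega) hα hβ⟩

/-- The optimal value lies above `l / S`, and is at most `(l + H) / S` if `g = 0`; two different
quotients with small denominators lie between `l / S` and the optimal value. -/
structure Bracketed (T : WeightedTree n) (N l S H g : ℕ) : Prop where
  one_le : 1 ≤ H
  S_pos : 1 ≤ S
  H_le : H ≤ 4 * N ^ 3
  lower : ∃ a₁ b₁ a₂ b₂ : ℕ, 0 < b₁ ∧ b₁ ≤ 2 * N ∧ a₁ ≤ 2 * N ^ 3 ∧ 0 < b₂ ∧ b₂ ≤ 2 * N ∧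
    l * b₁ < S * a₁ ∧ a₁ * b₂ < b₁ * a₂ ∧ LowerBound T (a₂ / b₂)
  g_cases : g = 1 ∧ S = 1 ∧ H ≤ 2 * l + 1 ∨ g = 0 ∧ UpperBound T ((l + H : ℕ) / S)

namespace Bracketed

variable {l S H g : ℕ} (h : Bracketed T N l S H g)

include h

theorem l_lt : l < 2 * N ^ 3 * S := by
  obtain ⟨a₁, b₁, a₂, b₂, h1, h2, h3, h4, h5, h6, h7, h8⟩ := h.lower
  have h9 := Nat.le_mul_of_pos_right l h1
  have h10 := Nat.mul_le_mul_left S h3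
  rw [mul_comm]
  omega

/-- Two different quotients `a₁ / b₁` and `a₂ / b₂` differ by at least `1 / (b₁ * b₂)`, and both lie
in an interval of length `H / S`. One quotient would not do, since the end `l / S` has the large
denominator `S`. -/
theorem S_le : S ≤ 4 * N ^ 2 * H := by
  obtain ⟨a₁, b₁, a₂, b₂, h1, h2, h3, h4, h5, h6, h7, h8⟩ := h.lower
  have hN : 1 ≤ N := by omega
  rcases h.g_cases with ⟨-, h9, -⟩ | ⟨-, X, hX, h9⟩
  · rw [h9]
    have := h.one_le
    have : 1 ≤ N ^ 2 := Nat.one_le_pow _ _ hN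
    nlinarith
  · have h10 := (h8 X hX).trans h9
    have hS := h.S_pos
    rw [div_le_div_iff₀ (by exact_mod_cast h4) (by exact_mod_cast hS)] at h10
    have h11 : a₂ * S ≤ (l + H) * b₂ := by exact_mod_cast h10
    have h12 : S ≤ H * (b₁ * b₂) := by
      have e1 := Nat.mul_le_mul_right b₂ h6
      have e2 := Nat.mul_le_mul_right S h7
      have e3 := Nat.mul_le_mul_right b₁ h11
      simp only [Nat.succ_eq_add_one] at e1 e2
      nlinarith
    have h13 := Nat.mul_le_mul h2 h5
    have h14 := Nat.mul_le_mul_left H h13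
    calc S ≤ H * (2 * N * (2 * N)) := h12.trans h14
      _ = _ := by ring

theorem S_le' : S ≤ 16 * N ^ 5 := by
  refine h.S_le.trans ((Nat.mul_le_mul_left _ h.H_le).trans (le_of_eq ?_))
  ring

/-- The product `(H + 1) * S` measures the progress of the search: galloping doubles the first
factor, bisection the second. This bound makes the search end. -/
theorem mul_le : (H + 1) * S ≤ 128 * N ^ 8 := by
  have h1 : H + 1 ≤ 8 * N ^ 3 := by
    have := h.one_le
    have := h.H_le
    omega
  exact (Nat.mul_le_mul h1 h.S_le').trans (le_of_eq (by ring))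

theorem l_le : l ≤ 32 * N ^ 8 := by
  refine h.l_lt.le.trans ((Nat.mul_le_mul_left _ h.S_le').trans (le_of_eq ?_))
  ring

end Bracketed

/-- The search before it has begun, or later. -/
def Searching (T : WeightedTree n) (N l S H g : ℕ) : Prop :=
  l = 0 ∧ S = 1 ∧ H = 0 ∧ g = 1 ∨ Bracketed T N l S H g

/-- The factor `1 + (1 - g)` is 2 during bisection, where doubling the denominator turns the
midpoint into a grid point, and 1 during galloping, where the scale stays. -/
theorem Searching.ok {l S H g : ℕ} (h : Searching T N l S H g) (hH : 1 ≤ H)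
    (hu : UpperBound T (((1 + (1 - g)) * l + H : ℕ) / ((1 + (1 - g)) * S : ℕ))) :
    Bracketed T N ((1 + (1 - g)) * l) ((1 + (1 - g)) * S) H 0 := by
  rcases h with ⟨-, -, h, -⟩ | h
  · omega
  · refine ⟨hH, Nat.mul_pos (by omega) h.S_pos, h.H_le, ?_, .inr ⟨rfl, hu⟩⟩
    obtain ⟨a₁, b₁, a₂, b₂, h1, h2, h3, h4, h5, h6, h7, h8⟩ := h.lower
    refine ⟨a₁, b₁, a₂, b₂, h1, h2, h3, h4, h5, ?_, h7, h8⟩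
    rw [mul_assoc, mul_assoc]
    exact Nat.mul_lt_mul_of_pos_left h6 (by omega)

/-- Both tests of the step have failed, the first at the new lower end and the second at the lower
bound `a₁ / b₁` that it returned. They supply the two quotients that `Bracketed` asks for. -/
theorem Searching.fail {l S H g a₁ b₁ a₂ b₂ : ℕ} (h : Searching T N l S H g)
    (h1 : Exceeds N ((1 + (1 - g)) * l + H) ((1 + (1 - g)) * S) a₁ b₁)
    (h2 : Exceeds N a₁ b₁ a₂ b₂) (h3 : LowerBound T (a₂ / b₂)) :
    Bracketed T N ((1 + (1 - g)) * l + H) ((1 + (1 - g)) * S) (if 0 < g then 2 * H + 1 else H) g := by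
  have hN : 2 * N * N * N = 2 * N ^ 3 := by ring
  have hlow : ∃ a₁ b₁ a₂ b₂ : ℕ, 0 < b₁ ∧ b₁ ≤ 2 * N ∧ a₁ ≤ 2 * N ^ 3 ∧ 0 < b₂ ∧ b₂ ≤ 2 * N ∧
      ((1 + (1 - g)) * l + H) * b₁ < ((1 + (1 - g)) * S) * a₁ ∧ a₁ * b₂ < b₁ * a₂ ∧
      LowerBound T (a₂ / b₂) :=
    ⟨a₁, b₁, a₂, b₂, h1.pos, h1.nd_le, hN ▸ h1.np_le, h2.pos, h2.nd_le, h1.lt, h2.lt, h3⟩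
  have key : g = 1 ∧ S = 1 ∧ H ≤ 2 * l + 1 ∨ g = 0 ∧ Bracketed T N l S H 0 ∧
      UpperBound T ((l + H : ℕ) / S) := by
    rcases h with ⟨rfl, rfl, rfl, rfl⟩ | h
    · left; omega
    · rcases h.g_cases with h4 | ⟨rfl, h5⟩
      exacts [.inl h4, .inr ⟨rfl, h, h5⟩]
  rcases key with ⟨rfl, rfl, h4⟩ | ⟨rfl, h4, h5⟩
  · simp at hlow ⊢
    refine ⟨by omega, by omega, ?_, by simpa using hlow, .inl ⟨rfl, rfl, by omega⟩⟩
    -- The tested integer `l + H` lies below `a₁ / b₁`, which is at most `2 * N ^ 3`. Hence `2 * H +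
    -- 1` stays below `4 * N ^ 3`.
    have h5 := h1.lt
    have h6 := h1.np_le
    rw [hN] at h6
    simp at h5
    have := Nat.le_mul_of_pos_right (l + H) h1.pos
    omega
  · refine ⟨by simpa using h4.one_le, Nat.mul_pos (by omega) h4.S_pos, by simpa using h4.H_le, hlow,
      .inr ⟨rfl, ?_⟩⟩
    -- The upper end does not move: `(2 * l + H + H) / (2 * S) = (l + H) / S`.
    convert h5 using 1
    have : (S : ℝ) ≠ 0 := by
      have := h4.S_pos
      positivity
    simp
    field_simp
    ring

theorem Searching.bounds {l S H g : ℕ} (hN : 1 ≤ N) (h : Searching T N l S H g) :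
    (1 + (1 - g)) * l + H ≤ 68 * N ^ 8 ∧ (1 + (1 - g)) * S ≤ 68 * N ^ 8 ∧ 2 * H + 1 ≤ 68 * N ^ 8 ∧
      (H + 1) * S ≤ 128 * N ^ 8 ∧ 0 < (1 + (1 - g)) * S ∧ g ≤ 1 ∧ l ≤ 68 * N ^ 8 := by
  have h1 : 1 ≤ N ^ 8 := Nat.one_le_pow _ _ hN
  rcases h with ⟨rfl, rfl, rfl, rfl⟩ | h
  · refine ⟨?_, ?_, ?_, ?_, ?_, ?_, ?_⟩ <;> omega
  · have h3 : N ^ 3 ≤ N ^ 8 := Nat.pow_le_pow_right hN (by omega)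
    have h5 : N ^ 5 ≤ N ^ 8 := Nat.pow_le_pow_right hN (by omega)
    have e1 := h.H_le
    have e2 := h.S_le'
    have e3 := h.l_le
    have e4 := h.S_pos
    have hg : g = 0 ∨ g = 1 := by
      rcases h.g_cases with h | h <;> omega
    refine ⟨?_, ?_, by omega, h.mul_le, ?_, by omega, by omega⟩ <;> rcases hg with rfl | rfl <;> omega

end

/-! ### The program for the weighted 2-center -/

/-- The optimal value lies above `rL / rSc`; the next tested value is at distance `rH / rSc`. -/
@[simp] abbrev rL : ℕ := 39
@[simp] abbrev rSc : ℕ := 40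
@[simp] abbrev rH : ℕ := 41
/-- No upper bound is known yet. -/
@[simp] abbrev rG : ℕ := 42
@[simp] abbrev rRun : ℕ := 43

def refineScale : Cmd TreeQuery :=
  .ite (.reg rG) (.lit 1) (.set rSc (.reg rSc + .reg rSc) ;; .set rL (.reg rL + .reg rL)) .skip ;;
    .set rP (.reg rL + .reg rH) ;; .set rS (.reg rSc)

def onSuccess : Cmd TreeQuery :=
  .set rG (.lit 0) ;; .ite (.reg rH) (.lit 1) (.set rRun (.lit 0)) .skip

def onFailure : Cmd TreeQuery :=
  .set rL (.reg rL + .reg rH) ;;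
    .ite (.lit 0) (.reg rG) (.set rH (.reg rH + .reg rH + .lit 1)) .skip ;;
    .set rP (.reg rNp) ;; .set rS (.reg rNd)

def searchStep : Cmd TreeQuery :=
  refineScale ;; test ;; .ite (.reg rFail) (.lit 1) onSuccess
    (onFailure ;; test ;; .ite (.reg rFail) (.lit 1) (.set rRun (.lit 0)) .skip)

def search : Cmd TreeQuery :=
  (.set rL (.lit 0) ;; .set rSc (.lit 1) ;; .set rH (.lit 0) ;; .set rG (.lit 1) ;;
    .set rRun (.lit 1)) ;; .loop (.lit 0) (.reg rRun) searchStep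

/-- Report a point as a point on an edge. -/
def emit (rx rn rd o : ℕ) : Cmd TreeQuery :=
  .ite (.lit 0) (.parent (.reg rx))
    (.set o (.reg rx) ;; .set (o + 1) (.parent (.reg rx)) ;; .set (o + 2) (.reg rn) ;;
      .set (o + 3) (.reg rd))
    (.set o (.firstChild .root) ;; .set (o + 1) .root ;; .set (o + 2) (.len (.firstChild .root)) ;;
      .set (o + 3) (.lit 1))

def twoCenter : Cmd TreeQuery := search ;; emit rA rAn rAd 50 ;; emit rB rBn rBd 54

/-! ### Termination of the search and exactness of the result -/

section

variable {n : ℕ} {T : WeightedTree n} {L : T.Layout} {W N P p s : ℕ}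

theorem Runs.bounded {Q : Type} {mem : ReadOnlyMemory Q} {W : ℕ} {c : Cmd Q} {σ : ℕ → ℕ} {t : ℕ}
    {post : (ℕ → ℕ) → Prop} (h : Runs mem W c σ t post) (hσ : ∀ i, σ i ≤ W) :
    Runs mem W c σ t fun σ' => post σ' ∧ ∀ i, σ' i ≤ W := by
  obtain ⟨σ', s, hs, he, h⟩ := h
  exact ⟨σ', s, hs, he, h, he.le hσ⟩

variable (T) in
/-- The search goes on, and needs at most `m` more steps. -/
def SearchState (N R m : ℕ) (σ : ℕ → ℕ) : Prop :=
  σ rRun = 1 ∧ Searching T N (σ rL) (σ rSc) (σ rH) (σ rG) ∧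
    2 ^ (R + σ rG) ≤ (σ rH + 1) * σ rSc * 2 ^ m

variable (L) in
/-- The points that have been found are optimal. -/
def FoundOptimal (σ : ℕ → ℕ) : Prop := σ rRun = 0 ∧ ∃ r, Found L r σ ∧ LowerBound T r

theorem Found.congr {r : ℝ} {σ σ' : ℕ → ℕ} (h : Found L r σ)
    (hσ : ∀ i, 20 ≤ i → i < 26 → σ' i = σ i) : Found L r σ' := by
  obtain ⟨a, b, h1, h2, h3⟩ := h
  refine ⟨a, b, (hσ _ (by simp) (by simp)).trans h1, (hσ _ (by simp) (by simp)).trans h2, ?_⟩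
  rwa [hσ rAn (by simp) (by simp), hσ rAd (by simp) (by simp), hσ rBn (by simp) (by simp),
    hσ rBd (by simp) (by simp)]

theorem runs_refineScale {l S H g : ℕ} (hP : (1 + (1 - g)) * l + H ≤ W)
    (hS : (1 + (1 - g)) * S ≤ W) (hg : g ≤ 1) {σ : ℕ → ℕ} (h1 : σ rL = l) (h2 : σ rSc = S)
    (h3 : σ rH = H) (h4 : σ rG = g) (h5 : σ rRun = 1) :
    Runs L.memory W refineScale σ 0 fun σ' => σ' rP = (1 + (1 - g)) * l + H ∧
      σ' rS = (1 + (1 - g)) * S ∧ σ' rL = (1 + (1 - g)) * l ∧ σ' rSc = (1 + (1 - g)) * S ∧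
      σ' rH = H ∧ σ' rG = g ∧ σ' rRun = 1 := by
  have h1' : σ 39 = l := h1
  have h2' : σ 40 = S := h2
  have h3' : σ 41 = H := h3
  have h4' : σ 42 = g := h4
  have h5' : σ 43 = 1 := h5
  refine .of_wp ?_
  obtain rfl | rfl : g = 0 ∨ g = 1 := by omega
  · simp [Cmd.wp, refineScale, h1', h2', h3', h4', h5']
    omega
  · simp [Cmd.wp, refineScale, h1', h2', h3', h4', h5']
    omega

/-- Every step that does not end the search doubles `(H + 1) * S`, with one exception: the success
that ends the galloping changes neither factor. That step is paid for by the summand `rG` in the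
exponent of `SearchState`, which drops from 1 to 0. -/
theorem runs_searchStep (hb : Bounds L W N (68 * N ^ 8)) {R m : ℕ} (hR : 128 * N ^ 8 < 2 ^ R)
    {σ : ℕ → ℕ} (h : SearchState T N R m σ) : ∃ m', m = m' + 1 ∧
      Runs L.memory W searchStep σ (44 * n) fun σ' =>
        SearchState T N R m' σ' ∨ FoundOptimal L σ' := by
  obtain ⟨hrun, hs, hm⟩ := h
  obtain ⟨l, hl⟩ : ∃ l, l = σ rL := ⟨_, rfl⟩
  obtain ⟨S, hS⟩ : ∃ S, S = σ rSc := ⟨_, rfl⟩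
  obtain ⟨H, hH⟩ : ∃ H, H = σ rH := ⟨_, rfl⟩
  obtain ⟨g, hg⟩ : ∃ g, g = σ rG := ⟨_, rfl⟩
  rw [← hl, ← hS, ← hH, ← hg] at hs
  rw [← hS, ← hH, ← hg] at hm
  have hN := hb.one_le_N
  obtain ⟨b1, b2, b3, b4, b5, b6, b7⟩ := hs.bounds hN
  have hW : 68 * N ^ 8 ≤ W := hb.mul_le hb.P_le
  -- With `m = 0` the product `(H + 1) * S` would be at least `2 ^ R`, beyond its bound `128 * N ^
  -- 8`.
  obtain ⟨m', rfl⟩ : ∃ m', m = m' + 1 := by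
    rcases m with _ | m
    · have := Nat.pow_le_pow_right (n := 2) (by omega) (Nat.le_add_right R g)
      omega
    · exact ⟨m, rfl⟩
  refine ⟨m', rfl, ?_⟩
  refine ((runs_refineScale (b1.trans hW) (b2.trans hW) b6 hl.symm hS.symm hH.symm hg.symm
    hrun).seq (t' := 44 * n) fun σ₁ ⟨h1, h2, h3, h4, h5, h6, h7⟩ => ?_).mono (by omega) fun _ h => h
  refine ((runs_test hb b1 b2 b5 h1 h2).frame.seq (t' := 22 * n) fun σ₂ ⟨ht, hf⟩ => ?_).mono
    (by omega) fun _ h => h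
  have hf' : ∀ i, 39 ≤ i → i < 46 → σ₂ i = σ₁ i := fun i hi hi' => hf i fun h => by
    have := writes_test h; omega
  have hL : σ₂ 39 = (1 + (1 - g)) * l := (hf' _ (by simp) (by simp)).trans h3
  have hSc : σ₂ 40 = (1 + (1 - g)) * S := (hf' _ (by simp) (by simp)).trans h4
  have hHH : σ₂ 41 = H := (hf' _ (by simp) (by simp)).trans h5
  have hG : σ₂ 42 = g := (hf' _ (by simp) (by simp)).trans h6
  have hRun : σ₂ 43 = 1 := (hf' _ (by simp) (by simp)).trans h7
  have hg01 : g = 0 ∨ g = 1 := by omega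
  rcases ht with ⟨hF, hfound⟩ | ⟨hF, hex, hlow⟩
  · have hF' : σ₂ 30 = 0 := hF
    refine .ite (fun _ => (Runs.of_wp (post := fun σ' => SearchState T N R m' σ' ∨
      FoundOptimal L σ') ?_).mono (Nat.zero_le _) fun _ h => h) fun h => absurd h (by simp [hF'])
    -- `H = 0` occurs only at the very start, where the tested value is 0; success there means that
    -- the optimal cost is 0.
    rcases Nat.eq_zero_or_pos H with h0 | h0
    · simp [Cmd.wp, onSuccess, hHH, h0]
      refine .inr ⟨by simp, 0, ?_, lowerBound_zero⟩
      have h1 : ((((1 + (1 - g)) * l + H : ℕ) : ℝ) / ((1 + (1 - g)) * S : ℕ)) = 0 := by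
        rcases hs with ⟨rfl, -⟩ | h
        · simp [h0]
        · have := h.one_le; omega
      rw [h1] at hfound
      exact hfound.congr fun i _ hi => by
        rw [Function.update_of_ne, Function.update_of_ne] <;> omega
    · have hnot : ¬ H < 1 := by omega
      simp only [Cmd.wp, onSuccess, WExpr.eval_lit, WExpr.eval_reg]
      refine ⟨Nat.zero_le _, fun h => absurd h (by simp [hHH]; omega), fun _ => .inl ⟨?_, ?_, ?_⟩⟩
      · simpa using hRun
      · simp [hL, hSc, hHH]
        exact .inr (hs.ok h0 (hfound.upperBound hb.two_le))
      · simp [hSc, hHH]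
        rcases hg01 with rfl | rfl <;> simp [pow_succ] at hm ⊢ <;> linarith
  · have hF' : σ₂ 30 = 1 := hF
    have hNN : 2 * N * N * N ≤ 68 * N ^ 8 := by
      have h3 : N ^ 3 ≤ N ^ 8 := Nat.pow_le_pow_right hN (by omega)
      calc 2 * N * N * N = 2 * N ^ 3 := by ring
        _ ≤ _ := by omega
    have hnp := hex.np_le.trans hNN
    have hnd : σ₂ rNd ≤ 68 * N ^ 8 := by
      have h3 : N ≤ N ^ 8 := Nat.le_self_pow (by omega) N
      exact hex.nd_le.trans (by omega)
    refine .ite (fun h => absurd h (by simp [hF'])) fun _ => ?_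
    have hfail : Runs L.memory W onFailure σ₂ 0 fun σ' => σ' rP = σ₂ rNp ∧ σ' rS = σ₂ rNd ∧
        σ' rL = (1 + (1 - g)) * l + H ∧ σ' rSc = (1 + (1 - g)) * S ∧
        σ' rH = (if 0 < g then 2 * H + 1 else H) ∧ σ' rG = g ∧ σ' rRun = 1 := by
      have e1 : σ₂ 31 ≤ W := hnp.trans hW
      have e2 : σ₂ 32 ≤ W := hnd.trans hW
      have e3 := b1.trans hW
      have e4 := b3.trans hW
      refine .of_wp ?_
      rcases hg01 with rfl | rfl
      · simp at hL hSc e3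
        simp [Cmd.wp, onFailure, hL, hSc, hHH, hG, hRun, e1, e2, e3]
      · simp at hL hSc e3
        simp [Cmd.wp, onFailure, hL, hSc, hHH, hG, hRun, e1, e2, e3]
        omega
    refine (hfail.seq (t' := 22 * n) fun σ₃ ⟨i1, i2, i3, i4, i5, i6, i7⟩ => ?_).mono (by omega)
      fun _ h => h
    refine ((runs_test hb hnp hnd hex.pos i1 i2).frame.seq (t' := 0) fun σ₄ ⟨ht, hf4⟩ =>
      .of_wp ?_).mono (by omega) fun _ h => h
    have hf4' : ∀ i, 39 ≤ i → i < 46 → σ₄ i = σ₃ i := fun i hi hi' => hf4 i fun h => by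
      have := writes_test h; omega
    -- The value tested here is a lower bound for all costs. If it passes, the points found attain
    -- it and are optimal; if not, a strictly larger lower bound has been found.
    rcases ht with ⟨hF4, hfound⟩ | ⟨hF4, hex4, hlow4⟩
    · have hF4' : σ₄ 30 = 0 := hF4
      simp only [Cmd.wp, WExpr.eval_lit, WExpr.eval_reg]
      refine ⟨fun _ => ⟨Nat.zero_le _, .inr ⟨by simp, _, hfound.congr fun i _ hi => ?_, hlow⟩⟩,
        fun h => absurd h (by simp [hF4'])⟩
      rw [Function.update_of_ne]
      simp; omega
    · have hF4' : σ₄ 30 = 1 := hF4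
      simp only [Cmd.wp, WExpr.eval_lit, WExpr.eval_reg]
      refine ⟨fun h => absurd h (by simp [hF4']), fun _ => .inl ⟨?_, ?_, ?_⟩⟩
      · rw [hf4' _ (by simp) (by simp), i7]
      · rw [hf4' rL (by simp) (by simp), hf4' rSc (by simp) (by simp), hf4' rH (by simp) (by simp),
          hf4' rG (by simp) (by simp), i3, i4, i5, i6]
        exact .inr (hs.fail hex hex4 hlow4)
      · rw [hf4' rSc (by simp) (by simp), hf4' rH (by simp) (by simp),
          hf4' rG (by simp) (by simp), i4, i5, i6]
        rcases hg01 with rfl | rfl <;> simp [pow_succ] at hm ⊢ <;> linarith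

/-- At the start `(H + 1) * S = 1` and `g = 1`, so `R + 1` steps are enough. Each consists of at
most two tests and the iteration of the loop itself. -/
theorem runs_search (hb : Bounds L W N (68 * N ^ 8)) {R : ℕ} (hR : 128 * N ^ 8 < 2 ^ R)
    (σ : ℕ → ℕ) : Runs L.memory W search σ ((R + 1) * (44 * n + 1)) (FoundOptimal L) := by
  have h1 : Runs L.memory W (.set rL (.lit 0) ;; .set rSc (.lit 1) ;; .set rH (.lit 0) ;;
      .set rG (.lit 1) ;; .set rRun (.lit 1)) σ 0 (SearchState T N R (R + 1)) := by
    refine .of_wp ?_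
    simp [Cmd.wp, hb.one_le_W, SearchState, Searching]
  let J : ℕ → (ℕ → ℕ) → Prop := fun k σ => FoundOptimal L σ ∨
    ∃ m, k = m * (44 * n + 1) ∧ SearchState T N R m σ
  refine (h1.seq (t' := (R + 1) * (44 * n + 1)) fun σ₁ hs => (Runs.loop (I := J) ?_
    (.inr ⟨R + 1, rfl, hs⟩)).mono le_rfl ?_).mono (by omega) fun _ h => h
  · rintro k σ (⟨h, -⟩ | ⟨m, rfl, hm⟩) hlt
    · simp only [WExpr.eval_lit, WExpr.eval_reg, h] at hlt
      omega
    · obtain ⟨m', rfl, h⟩ := runs_searchStep hb hR hm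
      refine ⟨44 * n, m' * (44 * n + 1), by rw [add_mul]; omega, h.mono le_rfl fun σ' h => ?_⟩
      rcases h with h | h
      exacts [.inr ⟨m', rfl, h⟩, .inl h]
  · rintro σ' ⟨⟨k, h | ⟨m, -, h, -⟩⟩, hlt⟩
    · exact h
    · simp only [WExpr.eval_lit, WExpr.eval_reg, h] at hlt
      omega

theorem runs_emit (hb : Bounds L W N P) (hlen : ∀ v, L.len v ≤ W) {rx rn rd o : ℕ} (hrx : rx < o)
    (hrn : rn < o) (hrd : rd < o) {a : Fin n} {sn sd : ℕ} (hsd : 0 < sd) (h : sn ≤ L.len a * sd)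
    (hsn : sn ≤ W) (hsd' : sd ≤ W) {σ : ℕ → ℕ} (h1 : σ rx = word a) (h2 : σ rn = sn)
    (h3 : σ rd = sd) : Runs L.memory W (emit rx rn rd o) σ 0 fun σ' => (∃ α : T.Point,
      (∀ v, α.dist v = pdist L a (sn / sd) v) ∧
      Describes T (σ' o) (σ' (o + 1)) (σ' (o + 2)) (σ' (o + 3)) α) ∧ ∀ i < o, σ' i = σ i := by
  have hw : ∀ v : Fin n, word v ≤ W := fun v => (word_le v).trans hb.n_le_W
  by_cases ha : a = L.root
  · obtain ⟨c, hc0, hc⟩ := exists_firstChild_root L hb.two_le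
    refine .ite (fun hlt => ?_) fun _ => .of_wp ?_
    · simp [h1, ha, parent_root] at hlt
    -- The root is reported on the edge to its first child, at the full length of that edge from the
    -- child.
    · obtain ⟨α, hα, hd⟩ := exists_point_of_parent hc one_pos (mul_one (L.len c)).ge
      simp [Cmd.wp, hc0, vertexWord_some, hw, hlen, hb.one_le_W]
      refine ⟨⟨α, fun v => ?_, hd⟩, fun i hi => ?_⟩
      · rw [ha, len_root, zero_mul, Nat.le_zero] at h
        rw [hα, ha, h, Nat.cast_one, div_one, pdist_len hc, Nat.cast_zero, zero_div]
      · rw [Function.update_of_ne, Function.update_of_ne, Function.update_of_ne,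
          Function.update_of_ne] <;> omega
  · obtain ⟨q, hq⟩ := exists_parent ha
    refine .ite (fun _ => .of_wp ?_) fun hge => ?_
    · obtain ⟨α, hα, hd⟩ := exists_point_of_parent hq hsd h
      have e1 : rx ≠ o := by omega
      have e2 : rn ≠ o := by omega
      have e3 : rn ≠ o + 1 := by omega
      have e4 : rd ≠ o := by omega
      have e5 : rd ≠ o + 1 := by omega
      have e6 : rd ≠ o + 2 := by omega
      simp [Cmd.wp, h1, h2, h3, hq, vertexWord_some, hw, e1, e2, e3, e4, e5, e6, hsn, hsd']
      refine ⟨⟨α, hα, hd⟩, fun i hi => ?_⟩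
      rw [Function.update_of_ne, Function.update_of_ne, Function.update_of_ne,
          Function.update_of_ne] <;> omega
    · simp [h1, hq, vertexWord_some] at hge

theorem runs_twoCenter (hb : Bounds L W N (68 * N ^ 8)) {R : ℕ} (hR : 128 * N ^ 8 < 2 ^ R) :
    Runs L.memory W twoCenter (fun _ => 0) ((R + 1) * (44 * n + 1)) fun σ =>
      ReportsTwoCenter T fun i : Fin 8 => σ (50 + i) := by
  have hlen : ∀ v, L.len v ≤ W := fun v => (len_le_depth v).trans (hb.depth_le_W v)
  refine (((runs_search hb hR _).bounded fun _ => Nat.zero_le _).seq (t' := 0)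
    fun σ₁ ⟨⟨_, r, ⟨a, b, hA, hB, hc⟩, hlow⟩, hle⟩ => ?_).mono (by omega) fun _ h => h
  refine ((runs_emit hb hlen (by simp) (by simp) (by simp) hc.pos hc.le (hle _) (hle _) hA rfl
    rfl).seq (t' := 0) fun σ₂ ⟨⟨α, hα, hαd⟩, hf⟩ => ?_).mono (by omega) fun _ h => h
  have hn : σ₂ rBn = σ₁ rBn := hf _ (by simp)
  have hd : σ₂ rBd = σ₁ rBd := hf _ (by simp)
  refine (runs_emit hb hlen (by simp) (by simp) (by simp) hc.pos' hc.le' (hle _) (hle _)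
    ((hf _ (by simp)).trans hB) hn hd).mono (by omega) fun σ₃ ⟨⟨β, hβ, hβd⟩, hf3⟩ => ?_
  classical
  obtain ⟨h1, h2⟩ := hc.cost_le (by have := hb.two_le; omega) hα hβ
  refine ⟨{α, β}, α, β, ⟨h1, fun Y hY => h2.trans (hlow Y hY)⟩, by simp, ?_, hβd⟩
  rw [← hf3 50 (by simp), ← hf3 51 (by simp), ← hf3 52 (by simp), ← hf3 53 (by simp)] at hαd
  exact hαd

end

/-! ### Bounds -/

/-- A depth is a sum of fewer than `n` lengths. The extra 1 in `κ + 1` absorbs this factor, because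
`n ≤ 2 ^ n.size`. -/
theorem WeightedTree.FitsInWords.bounds {n κ c : ℕ} (hn : 2 ≤ n) {T : WeightedTree n} {L : T.Layout}
    (h : T.FitsInWords κ) (hc : c = (κ + 1) * n.size) :
    Bounds L (204 * (2 ^ c) ^ 11) (2 ^ c) (68 * (2 ^ c) ^ 8) := by
  have hnc : n ≤ 2 ^ n.size := Nat.lt_size_self n |>.le
  have hle : 2 ^ (κ * n.size) ≤ 2 ^ c := Nat.pow_le_pow_right (by omega) (by
    rw [hc]; exact Nat.mul_le_mul_right _ (by omega))
  have hlen : ∀ v, L.len v ≤ 2 ^ (κ * n.size) := fun v => by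
    cases hp : L.parent v with
    | none => simp [len, hp]
    | some p =>
      rw [len_of_parent hp]
      exact (Nat.size_le.1 (h.2 _ (adj_of_parent hp).symm)).le
  refine ⟨hn, ?_, fun v => (Nat.size_le.1 (h.1 v)).le.trans hle, fun v => ?_, ?_, ?_⟩
  · refine hnc.trans (Nat.pow_le_pow_right (by omega) ?_)
    rw [hc]
    exact Nat.le_mul_of_pos_left _ (by omega)
  · refine (depth_le hlen v).trans ?_
    rw [hc, add_mul, one_mul, add_comm, pow_add]
    exact Nat.mul_le_mul_right _ ((hop_lt v).le.trans hnc)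
  · have := Nat.one_le_pow 8 (2 ^ c) (by positivity)
    omega
  · exact le_of_eq (by ring)

theorem Bounds.memory_le {n W N P : ℕ} {T : WeightedTree n} {L : T.Layout} (hb : Bounds L W N P)
    (q : TreeQuery) (x y : ℕ) : L.memory q x y ≤ W := by
  have hw : ∀ o : Option (Fin n), vertexWord o ≤ W := fun o => (vertexWord_le o).trans hb.n_le_W
  cases q with
  | size => exact hb.n_le_W
  | root => exact hw (some L.root)
  | parent | firstChild | nextChild => exact hw _
  | weight =>
    simp only [Layout.memory]
    cases wordVertex n x with
    | none => exact Nat.zero_le _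
    | some v => exact hb.weight_le_W v
  | length =>
    simp only [Layout.memory]
    cases wordVertex n x with
    | none => exact Nat.zero_le _
    | some v => exact (len_le_depth (L := L) v).trans (hb.depth_le_W v)

theorem size_le_two_mul_log {n : ℕ} (hn : 2 ≤ n) : n.size ≤ 2 * Nat.log 2 n := by
  have h1 : 1 ≤ Nat.log 2 n := Nat.log_pos (by omega) hn
  have h2 : n.size ≤ Nat.log 2 n + 1 := Nat.size_le.2 (Nat.lt_pow_succ_log_self (by omega) n)
  omega

/-- Since `c` is at most `2 * (κ + 1) * l`, the number of steps is at most `26 * (κ + 1) * l`, and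
each costs at most `45 * n`; so the time is of order `n * l`, within the stated bound. -/
theorem time_le {n κ c m l : ℕ} (hn : 2 ≤ n) (hl : l = Nat.log 2 n) (hc : c = (κ + 1) * n.size) :
    (8 + 8 * c + 1) * (44 * n + 1) + 1 ≤ 1300 * (κ + 1) * ((n + m) * l ^ 2) := by
  have hl1 : 1 ≤ l := hl ▸ Nat.log_pos (by omega) hn
  have hs : n.size ≤ 2 * l := hl ▸ size_le_two_mul_log hn
  have hcl : c ≤ 2 * ((κ + 1) * l) := by
    rw [hc]
    calc _ ≤ (κ + 1) * (2 * l) := Nat.mul_le_mul_left _ hs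
      _ = _ := by ring
  have h1 : 1 ≤ (κ + 1) * l := Nat.mul_pos (by omega) hl1
  calc (8 + 8 * c + 1) * (44 * n + 1) + 1 ≤
      26 * ((κ + 1) * l) * (45 * n) + 26 * ((κ + 1) * l) * n := by
        have h2 : 8 + 8 * c + 1 ≤ 26 * ((κ + 1) * l) := by omega
        have h3 := Nat.mul_le_mul h2 (show 44 * n + 1 ≤ 45 * n by omega)
        have h4 : 1 ≤ 26 * ((κ + 1) * l) * n := Nat.mul_pos (by omega) (by omega)
        omega
    _ = 1196 * (κ + 1) * (n * l) := by ring
    _ ≤ 1300 * (κ + 1) * ((n + m) * l ^ 2) := by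
        refine Nat.mul_le_mul (Nat.mul_le_mul_right _ (by omega)) ?_
        refine Nat.mul_le_mul (by omega) ?_
        rw [sq]
        exact Nat.le_mul_of_pos_left _ hl1

theorem size_bound_le {n κ c : ℕ} (hn : 2 ≤ n) (hc : c = (κ + 1) * n.size) :
    Nat.size (204 * (2 ^ c) ^ 11 + 2) ≤ (20 + 11 * κ) * n.size := by
  have hs : 1 ≤ n.size := Nat.size_pos.2 (by omega)
  have h1 : Nat.size (204 * (2 ^ c) ^ 11 + 2) ≤ 9 + 11 * c := by
    rw [Nat.size_le, pow_add, mul_comm 11 c, pow_mul]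
    have := Nat.one_le_pow 11 (2 ^ c) (by positivity)
    omega
  refine h1.trans ?_
  rw [hc]
  nlinarith

end ConstantWorkSpace

/-- All words have `O(log n)` bits, so that `O(log n)` tests of linear time locate the optimal
value by bisection; the median is not needed. -/
theorem mainTheorem6 (M : ℕ → ℕ) (hM : ConstantWorkSpace.MedianComputableInTime M) :
    ∃ P : ConstantWorkSpace.Program ConstantWorkSpace.TreeQuery 8,
      ∀ κ : ℕ, ∃ C : ℕ, ∀ n : ℕ, 2 ≤ n →
        ∀ (T : ConstantWorkSpace.WeightedTree n) (L : T.Layout), T.FitsInWords κ →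
          P.RunsIn L.memory (C * ((n + M n) * Nat.log 2 n ^ 2)) (C * Nat.size n)
            (fun o => ConstantWorkSpace.ReportsTwoCenter T o) := by
  obtain ⟨P, E, hP⟩ := ConstantWorkSpace.twoCenter.exists_program fun i : Fin 8 => 50 + i
  refine ⟨P, fun κ => ⟨E * (1300 * (κ + 1)), fun n hn T L hT => ?_⟩⟩
  obtain ⟨c, hc⟩ : ∃ c, c = (κ + 1) * n.size := ⟨_, rfl⟩
  have hb := hT.bounds (L := L) hn hc
  -- With `N = 2 ^ c` the right side is `256 * N ^ 8`, so `R = 8 + 8 * c` exceeds the logarithm of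
  -- every value that `(H + 1) * S` can take.
  have hR : 128 * (2 ^ c) ^ 8 < 2 ^ (8 + 8 * c) := by
    rw [pow_add, mul_comm 8 c, pow_mul]
    have := Nat.one_le_pow 8 (2 ^ c) (by positivity)
    omega
  obtain ⟨σ, t, ht, hex, hpost⟩ := ConstantWorkSpace.runs_twoCenter hb hR
  obtain ⟨⟨t', ht', hrun⟩, hbits⟩ := hP L.memory _ _ _ hb.memory_le ⟨σ, t, ht, hex, hpost⟩
  refine ⟨⟨t', ht'.trans ?_, hrun⟩, fun t i => (hbits t i).trans ?_⟩
  · rw [mul_assoc E]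
    exact Nat.mul_le_mul_left E (ConstantWorkSpace.time_le hn rfl hc)
  · rw [mul_assoc E]
    refine Nat.mul_le_mul_left E ((ConstantWorkSpace.size_bound_le hn hc).trans ?_)
    exact Nat.mul_le_mul_right _ (by omega)
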